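/- **Setting.** Let $\xi$ be a random sample, $\mathbf B_\xi\in\mathbb R^{n\times n}$ a random matrix with entries in $L^4$, $\mathbf B=\mathbb E\mathbf B_\xi$ nonsingular with $\lambda_{\max}(\mathbf B^\top\mathbf B)>0$, $\mathbf M=\mathbb E[\mathbf B_\xi\mathbf B_\xi^\top]$, $\widehat{\mathbf M}=\mathbb E[\mathbf B_\xi^\top\mathbf B_\xi]$, and put $\lambda=\lambda_{\min}(\mathbf B\mathbf B^\top)$, $\mu=\lambda_{\min}(\mathbf M)\wedge\lambda_{\min}(\widehat{\mathbf M})>0$. Let $\sigma_{\mathbf B},\sigma_{\mathbf B,2},\sigma_{\mathbf g}\ge 0$ satisfy $$\|\mathbb E(\mathbf B_\xi-\mathbf B)^\top(\mathbf B_\xi-\mathbf B)\|_{op}\vee\|\mathbb E(\mathbf B_\xi-\mathbf B)(\mathbf B_\xi-\mathbf B)^\top\|_{op}\le\sigma_{\mathbf B}^2,\qquad \|\mathbb E(\mathbf B_\xi^\top\mathbf B_\xi-\widehat{\mathbf M})^2\|_{op}\vee\|\mathbb E(\mathbf B_\xi\mathbf B_\xi^\top-\mathbf M)^2\|_{op}\le\sigma_{\mathbf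 B,2}^2 .$$ The intercepts $\mathbf g^{\mathbf x}_\xi,\mathbf g^{\mathbf y}_\xi\in\mathbb R^n$ are centred, the pair $(\mathbf g^{\mathbf x}_\xi,\mathbf g^{\mathbf y}_\xi)$ is independent of $\mathbf B_\xi$, and $\mathbb E[\|\mathbf g^{\mathbf x}_\xi\|^2+\|\mathbf g^{\mathbf y}_\xi\|^2]\le\sigma_{\mathbf g}^2$. Let $\eta_{\mathbf M}=(\rho_1\vee\rho_2)^{-1/2}$ with $\rho_1=\lambda_{\max}(\mathbf M^{-1/2}\,\mathbb E[(\mathbf B_\xi\mathbf B_\xi^\top)^2]\,\mathbf M^{-1/2})$ and $\rho_2=\lambda_{\max}(\widehat{\mathbf M}^{-1/2}\,\mathbb E[(\mathbf B_\xi^\top\mathbf B_\xi)^2]\,\widehat{\mathbf M}^{-1/2})$. For $\alpha\in(0,1)$ put $c=\alpha\lambda/(2\sigma_{\mathbf B}^2\sqrt{\lambda_{\max}(\mathbf B^\top\mathbf B)})$ ($c=+\infty$ if $\sigma_{\mathbf B}=0$), $\hat\eta=\frac{\eta_{\mathbf M}}{\sqrt2}\wedge c$, $\bar\eta=\eta_{\mathbf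 M}\wedge c$, and $\kappa_\zeta=(\sigma_{\mathbf B}^2+\hat\eta^2\sigma_{\mathbf B,2}^2)/\mu$. **Algorithm.** Start from deterministic $(\mathbf x_0,\mathbf y_0)$, $D=\|\mathbf x_0\|^2+\|\mathbf y_0\|^2$, $s=0$. With i.i.d. samples, step $t=1,2,\dots$ sets $s\leftarrow s+1$, performs $$\mathbf x_{t-1/2}=\mathbf x_{t-1}-\hat\eta[\mathbf B_{\xi,t}\mathbf y_{t-1}+\mathbf g^{\mathbf x}_{\xi,t}],\quad \mathbf y_{t-1/2}=\mathbf y_{t-1}+\hat\eta[\mathbf B_{\xi,t}^\top\mathbf x_{t-1}+\mathbf g^{\mathbf y}_{\xi,t}],$$ $$\mathbf x_{t}=\mathbf x_{t-1}-\hat\eta[\mathbf B_{\xi,t}\mathbf y_{t-1/2}+\mathbf g^{\mathbf x}_{\xi,t}],\quad \mathbf y_{t}=\mathbf y_{t-1}+\hat\eta[\mathbf B_{\xi,t}^\top\mathbf x_{t-1/2}+\mathbf g^{\mathbf y}_{\xi,t}],$$ updates $\hat{\mathbf x}_t=\frac{s-1}{s}\hat{\mathbf x}_{t-1}+\frac1s\mathbf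 x_t$, $\hat{\mathbf y}_t=\frac{s-1}{s}\hat{\mathbf y}_{t-1}+\frac1s\mathbf y_t$ (with $\hat{\mathbf x}_0=\mathbf x_0,\hat{\mathbf y}_0=\mathbf y_0$) and, if $t$ is a restarting time, overwrites $(\mathbf x_t,\mathbf y_t)$ by $(\hat{\mathbf x}_t,\hat{\mathbf y}_t)$ and sets $s\leftarrow0$. The restarting times are $T_i=\sum_{j=1}^iK_j$, $1\le i\le N$, where $K_j=\big\lceil\frac{q_2+\sqrt{q_2^2+4q_1q_3}}{2q_3}\big\rceil-1$ with $$q_1=\frac{16}{(1-\alpha)\lambda}\cdot\frac{e^{2-2j}D}{\hat\eta^2},\qquad q_2=\frac{4(\sigma_{\mathbf B}^2+\hat\eta^2\sigma_{\mathbf B,2}^2)\big[e^{2-2j}D+\frac{3\sigma_{\mathbf g}^2}{\mu}\big]+18\sigma_{\mathbf g}^2}{(1-\alpha)\lambda},\qquad q_3=e^{-2j}D,$$ and $N=\max\{0,\lceil\frac12\log\frac{\mu D}{3\sigma_{\mathbf g}^2}\rceil\}$ ($N=0$ if $D=0$, and $N=\infty$ if $\sigma_{\mathbf g}=0<D$);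 $T_0=0$. **Theorem.** All expectations below exist and: 1. For every finite $i$ with $1\le i\le N$, $\ \mathbb E[\|\hat{\mathbf x}_{T_i}\|^2+\|\hat{\mathbf y}_{T_i}\|^2]\le e^{-2i}D$. Moreover, if $N<\infty$: 2. For every integer $k\ge0$ and $K=T_N+k$, $$\mathbb E[\|\hat{\mathbf x}_K\|^2+\|\hat{\mathbf y}_K\|^2]\le\frac{18}{(1-\alpha)\lambda}\Big[1+\frac43\kappa_\zeta+\frac{8}{3(k+1)\hat\eta^2\mu}\Big]\frac{\sigma_{\mathbf g}^2}{k+1}.$$ 3. With $K_{\mathrm{complexity}}=T_N+\frac{8}{3\hat\eta^2\mu}$ and $C_1=\frac{18}{(1-\alpha)\lambda}\big[1+\frac43\kappa_\zeta\big]$, for all integers $K\ge K_{\mathrm{complexity}}+1$, $$\mathbb E[\|\hat{\mathbf x}_K\|^2+\|\hat{\mathbf y}_K\|^2]\le C_1\,\frac{\sigma_{\mathbf g}^2}{K-K_{\mathrm{complexity}}+1}.$$ 4. The restarting phase is logarithmic in the initial distance: $$T_N\le\Big(\sqrt{\tfrac{16e^2}{(1-\alpha)\hat\eta^2\lambda}}+\tfrac{4e^2(\sigma_{\mathbf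 B}^2+\hat\eta^2\sigma_{\mathbf B,2}^2)}{(1-\alpha)\lambda}\Big)N+\frac{e^2\,[6\mu+4(\sigma_{\mathbf B}^2+\hat\eta^2\sigma_{\mathbf B,2}^2)]}{(1-\alpha)\lambda(1-e^{-2})},$$ and, with $C_2=\bar\eta^{3/2}\lambda^{1/4}\sqrt{\sigma_{\mathbf B}^2+\bar\eta^2\sigma_{\mathbf B,2}^2}$, whenever $C_2<\frac1e\sqrt{(1-\alpha)\bar\eta^2\lambda}$, $$T_N\le\frac{3\log^+\!\big(\frac{\mu D}{3\sigma_{\mathbf g}^2}\big)+\frac{26}{\sqrt{1-\alpha}}}{\frac1e\sqrt{(1-\alpha)\bar\eta^2\lambda}-C_2},$$ where $\log^+u=\max(\log u,0)$, read as $0$ if $D=0$. -/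

import Mathlib

open MeasureTheory ProbabilityTheory

noncomputable section

namespace SEG

/-- The Euclidean space `ℝⁿ`. -/
abbrev Vec (n : ℕ) := EuclideanSpace ℝ (Fin n)

/-- Real square matrices. -/
abbrev Mat (n : ℕ) := Matrix (Fin n) (Fin n) ℝ

/-- Smallest eigenvalue of a symmetric matrix. -/
def lamMin {n : ℕ} (A : Mat n) : ℝ := sInf (spectrum ℝ A)

/-- Largest eigenvalue of a symmetric matrix. -/
def lamMax {n : ℕ} (A : Mat n) : ℝ := sSup (spectrum ℝ A)

/-- Operator norm of a matrix with respect to the Euclidean norm. -/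
def opNorm {n : ℕ} (A : Mat n) : ℝ := ‖Matrix.toEuclideanCLM (n := Fin n) (𝕜 := ℝ) A‖

/-- Inverse square root `A^{-1/2}` of a symmetric positive definite matrix
(continuous functional calculus). -/
def invSqrt {n : ℕ} (A : Mat n) : Mat n := cfc (fun t : ℝ => (Real.sqrt t)⁻¹) A

/-- Data of a stochastic bilinear game: the law `P` of the sample `ξ`, the random coupling
matrix `B_ξ` and the random intercepts `g^x_ξ`, `g^y_ξ`. -/
structure Game (n : ℕ) (Ξ : Type*) [MeasurableSpace Ξ] where
  P : Measure Ξ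
  B : Ξ → Mat n
  gx : Ξ → Vec n
  gy : Ξ → Vec n

section Moments

variable {n : ℕ} {Ξ : Type*} [MeasurableSpace Ξ]

/-- Entrywise expectation of a random matrix. -/
def matE (P : Measure Ξ) (X : Ξ → Mat n) : Mat n :=
  Matrix.of fun i j => ∫ s, X s i j ∂P

/-- `B = E[B_ξ]`. -/
def Game.meanB (G : Game n Ξ) : Mat n := matE G.P G.B

/-- `M = E[B_ξ B_ξᵀ]`. -/
def Game.M (G : Game n Ξ) : Mat n := matE G.P fun s => G.B s * (G.B s).transpose

/-- `M̂ = E[B_ξᵀ B_ξ]`. -/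
def Game.Mhat (G : Game n Ξ) : Mat n := matE G.P fun s => (G.B s).transpose * G.B s

/-- Assumption on the coupling matrix. The expectations in it exist because the entries of
`B_ξ` have finite fourth moments. -/
structure AssumptionB (G : Game n Ξ) (σB σB2 : ℝ) : Prop where
  measurable_B : ∀ i j, Measurable fun s => G.B s i j
  memLp_B : ∀ i j, MemLp (fun s => G.B s i j) 4 G.P
  lamMax_pos : 0 < lamMax (G.meanB.transpose * G.meanB)
  lamMin_pos : 0 < min (lamMin G.M) (lamMin G.Mhat)
  sigmaB_nonneg : 0 ≤ σB
  sigmaB2_nonneg : 0 ≤ σB2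
  var_left : opNorm (matE G.P fun s =>
    (G.B s - G.meanB).transpose * (G.B s - G.meanB)) ≤ σB ^ 2
  var_right : opNorm (matE G.P fun s =>
    (G.B s - G.meanB) * (G.B s - G.meanB).transpose) ≤ σB ^ 2
  var2_left : opNorm (matE G.P fun s =>
    ((G.B s).transpose * G.B s - G.Mhat) ^ 2) ≤ σB2 ^ 2
  var2_right : opNorm (matE G.P fun s =>
    (G.B s * (G.B s).transpose - G.M) ^ 2) ≤ σB2 ^ 2

/-- Assumption on the intercepts: centred, second moment at most `σ_g²`, and the pair of
intercepts independent of the matrix `B_ξ`. -/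
structure AssumptionG (G : Game n Ξ) (σg : ℝ) : Prop where
  measurable_gx : Measurable G.gx
  measurable_gy : Measurable G.gy
  memLp_gx : MemLp G.gx 2 G.P
  memLp_gy : MemLp G.gy 2 G.P
  sigmag_nonneg : 0 ≤ σg
  second_moment : ∫ s, (‖G.gx s‖ ^ 2 + ‖G.gy s‖ ^ 2) ∂G.P ≤ σg ^ 2
  mean_gx : ∫ s, G.gx s ∂G.P = 0
  mean_gy : ∫ s, G.gy s ∂G.P = 0
  indep : IndepFun (fun s (p : Fin n × Fin n) => G.B s p.1 p.2)
    (fun s => (G.gx s, G.gy s)) G.P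

/-- `μ = λ_min(M) ∧ λ_min(M̂)`. -/
def Game.mu (G : Game n Ξ) : ℝ := min (lamMin G.M) (lamMin G.Mhat)

/-- `λ = λ_min(B Bᵀ)`. -/
def Game.lam (G : Game n Ξ) : ℝ := lamMin (G.meanB * G.meanB.transpose)

/-- `η_M = 1 / √(ρ₁ ∨ ρ₂)`. -/
def Game.etaM (G : Game n Ξ) : ℝ :=
  1 / Real.sqrt (max
    (lamMax (invSqrt G.M * (matE G.P fun s => (G.B s * (G.B s).transpose) ^ 2) * invSqrt G.M))
    (lamMax (invSqrt G.Mhat * (matE G.P fun s => ((G.B s).transpose * G.B s) ^ 2) *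
      invSqrt G.Mhat)))

/-- `η ∧ α λ_min(B Bᵀ) / (2 σ_B² √λ_max(Bᵀ B))`, the second term being `+∞` if `σ_B = 0`. -/
def Game.capped (G : Game n Ξ) (σB α η : ℝ) : ℝ :=
  if σB = 0 then η
  else min η (α * G.lam / (2 * σB ^ 2 * Real.sqrt (lamMax (G.meanB.transpose * G.meanB))))

/-- The step size `η̂_M(α)`. -/
def Game.etaHat (G : Game n Ξ) (σB α : ℝ) : ℝ := G.capped σB α (G.etaM / Real.sqrt 2)

/-- The step size `η̄_M(α)`. -/
def Game.etaBar (G : Game n Ξ) (σB α : ℝ) : ℝ := G.capped σB α G.etaM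

/-- `σ_B² + η² σ_{B,2}²`. -/
def noiseB (σB σB2 η : ℝ) : ℝ := σB ^ 2 + η ^ 2 * σB2 ^ 2

end Moments

section Schedule

variable {n : ℕ} {Ξ : Type*} [MeasurableSpace Ξ]

/-! In this section `D` stands for `‖x₀‖² + ‖y₀‖²` and `e` for the number of an epoch. -/

def Game.q1 (G : Game n Ξ) (σB α D : ℝ) (e : ℕ) : ℝ :=
  16 / ((1 - α) * G.lam) * (Real.exp (2 - 2 * (e : ℝ)) * D / G.etaHat σB α ^ 2)

def Game.q2 (G : Game n Ξ) (σB σB2 σg α D : ℝ) (e : ℕ) : ℝ :=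
  (4 * noiseB σB σB2 (G.etaHat σB α) * (Real.exp (2 - 2 * (e : ℝ)) * D + 3 * σg ^ 2 / G.mu)
    + 18 * σg ^ 2) / ((1 - α) * G.lam)

def q3 (D : ℝ) (e : ℕ) : ℝ := D / Real.exp (2 * (e : ℝ))

/-- Length of epoch `e`: `⌈(q₂ + √(q₂² + 4 q₁ q₃)) / (2 q₃)⌉ - 1`. -/
def Game.epochLength (G : Game n Ξ) (σB σB2 σg α D : ℝ) (e : ℕ) : ℕ :=
  ⌈(G.q2 σB σB2 σg α D e +
      Real.sqrt (G.q2 σB σB2 σg α D e ^ 2 + 4 * G.q1 σB α D e * q3 D e)) / (2 * q3 D e)⌉₊ - 1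

/-- The logarithm `log (μ D / (3 σ_g²))` of the initial squared distance relative to the
noise floor `3 σ_g² / μ`. -/
def Game.logFactor (G : Game n Ξ) (σg D : ℝ) : ℝ :=
  Real.log (G.mu / (3 * σg ^ 2) * D)

/-- Number of restarting epochs, `⌈½ log (μ D / (3 σ_g²))⌉`, read as `0` if the start is
already at the noise floor, and as `∞` if `σ_g = 0 < D`. -/
def Game.numEpochs (G : Game n Ξ) (σg D : ℝ) : ℕ∞ :=
  if σg = 0 ∧ 0 < D then ⊤ else ((⌈1 / 2 * G.logFactor σg D⌉₊ : ℕ) : ℕ∞)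

/-- Restarting timestamp: the total length of epochs `1, …, i`. -/
def Game.timestamp (G : Game n Ξ) (σB σB2 σg α D : ℝ) (i : ℕ) : ℕ :=
  ∑ e ∈ Finset.Icc 1 i, G.epochLength σB σB2 σg α D e

/-- The set of the restarting timestamps of epochs `1, …, numEpochs`. -/
def Game.restartTimes (G : Game n Ξ) (σB σB2 σg α D : ℝ) : Set ℕ :=
  {t | ∃ i : ℕ, 1 ≤ i ∧ (i : ℕ∞) ≤ G.numEpochs σg D ∧ t = G.timestamp σB σB2 σg α D i}

end Schedule

section Algorithm

/-- State of the restarted iteration-averaged method: current iterate, running average and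
number `s` of iterates in the average. -/
structure State (n : ℕ) where
  x : Vec n
  y : Vec n
  xhat : Vec n
  yhat : Vec n
  s : ℕ

variable {n : ℕ}

/-- `B v`. -/
def act (B : Mat n) (v : Vec n) : Vec n := Matrix.toEuclideanCLM (n := Fin n) (𝕜 := ℝ) B v

/-- One extragradient step (extrapolation and update with the same sample and step size). -/
def segStep (η : ℝ) (B : Mat n) (gx gy : Vec n) (z : Vec n × Vec n) : Vec n × Vec n :=
  let xh := z.1 - η • (act B z.2 + gx)
  let yh := z.2 + η • (act B.transpose z.1 + gy)
  (z.1 - η • (act B yh + gx), z.2 + η • (act B.transpose xh + gy))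

open Classical in
/-- One iteration of the algorithm: extragradient step, update of the running average and,
if `restart` holds, overloading of the iterate by the average. -/
def algStep (η : ℝ) (B : Mat n) (gx gy : Vec n) (restart : Prop) (S : State n) : State n :=
  let z := segStep η B gx gy (S.x, S.y)
  let s' := S.s + 1
  let xa := (((s' : ℝ) - 1) / (s' : ℝ)) • S.xhat + (1 / (s' : ℝ)) • z.1
  let ya := (((s' : ℝ) - 1) / (s' : ℝ)) • S.yhat + (1 / (s' : ℝ)) • z.2
  if restart then ⟨xa, ya, xa, ya, 0⟩ else ⟨z.1, z.2, xa, ya, s'⟩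

/-- The algorithm with step sizes `η_t` and set `R` of restarting timestamps, run on the sample
sequence `ξ`; iteration `t + 1` uses the sample `ξ t`. The running average at time `0` is the
initial point. -/
def run {Ξ : Type*} [MeasurableSpace Ξ] (G : Game n Ξ) (η : ℕ → ℝ) (R : Set ℕ)
    (x₀ y₀ : Vec n) (ξ : ℕ → Ξ) : ℕ → State n
  | 0 => ⟨x₀, y₀, x₀, y₀, 0⟩
  | t + 1 => algStep (η (t + 1)) (G.B (ξ t)) (G.gx (ξ t)) (G.gy (ξ t)) (t + 1 ∈ R)
      (run G η R x₀ y₀ ξ t)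

/-- `‖x̂_K‖² + ‖ŷ_K‖²` for the output of `K` iterations of the algorithm with constant step
size `η̂_M(α)` and the above restarting schedule. -/
def outputSq {Ξ : Type*} [MeasurableSpace Ξ] (G : Game n Ξ) (σB σB2 σg α : ℝ)
    (x₀ y₀ : Vec n) (ξ : ℕ → Ξ) (K : ℕ) : ℝ :=
  let S := run G (fun _ => G.etaHat σB α)
    (G.restartTimes σB σB2 σg α (‖x₀‖ ^ 2 + ‖y₀‖ ^ 2)) x₀ y₀ ξ K
  ‖S.xhat‖ ^ 2 + ‖S.yhat‖ ^ 2

end Algorithm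

end SEG

end

/-! For a sample matrix `B` put `J (x, y) = (B y, -Bᵀ x)`, a skew operator on the joint space, and
`h = (-gx, gy)`. An extragradient step is `z ↦ (1 - ηJ + η²J²) z + η (1 - ηJ) h`. By skewness the
squared norm of the linear part is `‖z‖² - η²‖Jz‖² + η⁴‖J²z‖²`. The definition of `η_M` bounds the
mean quartic term by `ρ = ρ₁ ∨ ρ₂` times the mean quadratic one, and `η̂²ρ ≤ 1/2` preserves half of
the decrease. The second moment of the iterates therefore contracts by `1 - η²μ/2` up to an additive
noise `v`, and the iterates stay bounded.

The rate in `λ` comes from averaging. Let `A` be the mean of the step, a linear contraction. Summing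
`z_{i+1} - A z_{i+1} = (z_{i+1} - A z_i) + A (z_i - z_{i+1})` over an epoch of length `k` gives `(1
- A)(k ẑ) = (martingale sum) + A (z₀ - z_k)`. The martingale sum has second moment of order `k`, the
boundary term is controlled by the second moments of `z₀` and `z_k`, and `‖(1 - A) z‖² ≥ (1 - α) η²
λ ‖z‖²` because the cap on the step size dominates the variance of `B_ξ`. Dividing by `k²` bounds
`E‖ẑ‖²` by a `1/k²` term in the initial second moment plus a `1/k` term. The one-step facts are
collected in `isStep`, the averaging argument is `IsStep.average_le`, and `run_average_le` transfers
it to the algorithm.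

An epoch is long enough for this bound to gain a factor `e⁻²`: its length plus one exceeds the
positive root of `q₃x² - q₂x - q₁`. Induction over epochs (`Game.moment_timestamp_le`) brings the
second moment down to `3σ_g²/μ` after `N` epochs (`Game.noise_floor`), and one more use of the epoch
bound gives the final rate; `burn_in_shift` moves its second-order term into the burn-in.

The root is at most `q₂/q₃ + √(q₁/q₃)`. The part of this that does not depend on the epoch gives the
term linear in `N`, and the noise part is a geometric sum dominated by its last term
(`Game.timestamp_le`). The form with `η̄` follows from `η̄ ≤ √2 η̂`, `μ ≤ λ + σ_B²` and the
numerical inequality `burn_in_bound`. -/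

noncomputable section

namespace SEG

set_option linter.unusedSectionVars false

/-! ### Matrices acting on Euclidean space: spectral bounds for quadratic forms. -/

section MatrixAction

variable {n : ℕ}

lemma act_add (A : Mat n) (x y : Vec n) : act A (x + y) = act A x + act A y := map_add _ _ _

lemma act_sub (A : Mat n) (x y : Vec n) : act A (x - y) = act A x - act A y := map_sub _ _ _

lemma act_smul (A : Mat n) (c : ℝ) (x : Vec n) : act A (c • x) = c • act A x := map_smul _ _ _

lemma sub_act (A B : Mat n) (x : Vec n) : act (A - B) x = act A x - act B x := by simp [act]

lemma smul_act (c : ℝ) (A : Mat n) (x : Vec n) : act (c • A) x = c • act A x := by simp [act]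

lemma one_act (x : Vec n) : act (1 : Mat n) x = x := by simp [act]

lemma mul_act (A B : Mat n) (x : Vec n) : act (A * B) x = act A (act B x) := by simp [act]

lemma act_apply (A : Mat n) (x : Vec n) (i : Fin n) : act A x i = ∑ j, A i j * x j := by
  simp [act, Matrix.mulVec, dotProduct]

lemma inner_eq_sum (x y : Vec n) : inner ℝ x y = ∑ i, x i * y i := by
  simp [PiLp.inner_apply, mul_comm]

lemma inner_act_eq_sum (A : Mat n) (x y : Vec n) :
    inner ℝ x (act A y) = ∑ i, ∑ j, A i j * (x i * y j) := by
  rw [inner_eq_sum]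
  refine Finset.sum_congr rfl fun i _ => ?_
  rw [act_apply, Finset.mul_sum]
  exact Finset.sum_congr rfl fun j _ => by ring

lemma inner_act_transpose (A : Mat n) (x y : Vec n) :
    inner ℝ x (act A.transpose y) = inner ℝ (act A x) y := by
  rw [real_inner_comm y (act A x), inner_act_eq_sum, inner_act_eq_sum, Finset.sum_comm]
  exact Finset.sum_congr rfl fun i _ => Finset.sum_congr rfl fun j _ => by
    simp only [Matrix.transpose_apply]; ring

lemma inner_act (A : Mat n) (x y : Vec n) :
    inner ℝ x (act A y) = inner ℝ (act A.transpose x) y := by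
  rw [← inner_act_transpose, Matrix.transpose_transpose]

lemma norm_sq_act (A : Mat n) (x : Vec n) :
    ‖act A x‖ ^ 2 = inner ℝ x (act (A.transpose * A) x) := by
  rw [mul_act, inner_act_transpose, real_inner_self_eq_norm_sq]

lemma norm_sq_act_transpose (A : Mat n) (x : Vec n) :
    ‖act A.transpose x‖ ^ 2 = inner ℝ x (act (A * A.transpose) x) := by
  rw [norm_sq_act, Matrix.transpose_transpose]

lemma norm_act_le (A : Mat n) (x : Vec n) : ‖act A x‖ ≤ opNorm A * ‖x‖ :=
  ContinuousLinearMap.le_opNorm _ _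

lemma norm_act_le_of_opNorm_le {A : Mat n} {c : ℝ} (h : opNorm A ≤ c) (x : Vec n) :
    ‖act A x‖ ≤ c * ‖x‖ :=
  (norm_act_le A x).trans (mul_le_mul_of_nonneg_right h (norm_nonneg _))

lemma inner_act_le_of_opNorm_le {A : Mat n} {c : ℝ} (h : opNorm A ≤ c) (x : Vec n) :
    inner ℝ x (act A x) ≤ c * ‖x‖ ^ 2 := by
  have h1 := real_inner_le_norm x (act A x)
  have h2 := norm_act_le_of_opNorm_le h x
  have := mul_le_mul_of_nonneg_left h2 (norm_nonneg x)
  nlinarith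

lemma mem_spectrum_iff_exists_act (A : Mat n) (c : ℝ) :
    c ∈ spectrum ℝ A ↔ ∃ x : Vec n, x ≠ 0 ∧ act A x = c • x := by
  rw [← Matrix.spectrum_toLpLin 2, ← Module.End.hasEigenvalue_iff_mem_spectrum]
  constructor
  · intro h
    obtain ⟨v, hv⟩ := h.exists_hasEigenvector
    exact ⟨v, hv.2, hv.apply_eq_smul⟩
  · rintro ⟨x, hx, h⟩
    exact Module.End.hasEigenvalue_of_hasEigenvector (x := x)
      ⟨Module.End.mem_eigenspace_iff.2 h, hx⟩

lemma finite_spectrum {A : Mat n} (_hA : A.transpose = A) : (spectrum ℝ A).Finite :=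
  Matrix.finite_real_spectrum

lemma isHermitian_of_transpose_eq {A : Mat n} (hA : A.transpose = A) : A.IsHermitian := by
  rw [Matrix.IsHermitian, Matrix.conjTranspose_eq_transpose_of_trivial, hA]

lemma inner_act_nonneg_of_spectrum {A : Mat n} (hA : A.transpose = A)
    (h : ∀ c ∈ spectrum ℝ A, 0 ≤ c) (x : Vec n) : 0 ≤ inner ℝ x (act A x) := by
  have hp : A.PosSemidef := Matrix.posSemidef_iff_isHermitian_and_spectrum_nonneg.2
    ⟨isHermitian_of_transpose_eq hA, h⟩
  have := hp.dotProduct_mulVec_nonneg (x : Fin n → ℝ)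
  rw [inner_act_eq_sum]
  refine this.trans_eq ?_
  simp only [dotProduct, Matrix.mulVec, Finset.mul_sum]
  exact Finset.sum_congr rfl fun i _ => Finset.sum_congr rfl fun j _ => by simp; ring

/-- The shifted matrix `A - c` has nonnegative spectrum, hence a nonnegative quadratic form. -/
lemma le_inner_act_of_spectrum {A : Mat n} (hA : A.transpose = A) {c : ℝ}
    (h : ∀ t ∈ spectrum ℝ A, c ≤ t) (x : Vec n) : c * ‖x‖ ^ 2 ≤ inner ℝ x (act A x) := by
  have h0 : 0 ≤ inner ℝ x (act (A - c • 1) x) := by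
    refine inner_act_nonneg_of_spectrum (by simp [hA]) (fun t ht => ?_) x
    obtain ⟨v, hv, e⟩ := (mem_spectrum_iff_exists_act _ _).1 ht
    have : t + c ∈ spectrum ℝ A := by
      refine (mem_spectrum_iff_exists_act _ _).2 ⟨v, hv, ?_⟩
      rw [sub_act, smul_act, one_act] at e
      rw [add_smul, ← e, sub_add_cancel]
    linarith [h _ this]
  rw [sub_act, smul_act, one_act, inner_sub_right, inner_smul_right,
    real_inner_self_eq_norm_sq] at h0
  linarith

lemma inner_act_le_of_spectrum {A : Mat n} (hA : A.transpose = A) {c : ℝ}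
    (h : ∀ t ∈ spectrum ℝ A, t ≤ c) (x : Vec n) : inner ℝ x (act A x) ≤ c * ‖x‖ ^ 2 := by
  have h0 := le_inner_act_of_spectrum (A := (-1 : ℝ) • A) (by simp [hA]) (c := -c)
    (fun t ht => ?_) x
  · rw [smul_act, inner_smul_right] at h0
    linarith
  · obtain ⟨v, hv, e⟩ := (mem_spectrum_iff_exists_act _ _).1 ht
    have : -t ∈ spectrum ℝ A := by
      refine (mem_spectrum_iff_exists_act _ _).2 ⟨v, hv, ?_⟩
      rw [neg_smul, ← e, smul_act]; simp
    linarith [h _ this]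

lemma lamMin_mul_le {A : Mat n} (hA : A.transpose = A) (x : Vec n) :
    lamMin A * ‖x‖ ^ 2 ≤ inner ℝ x (act A x) :=
  le_inner_act_of_spectrum hA (fun _ ht => csInf_le (finite_spectrum hA).bddBelow ht) x

lemma le_lamMax_mul {A : Mat n} (hA : A.transpose = A) (x : Vec n) :
    inner ℝ x (act A x) ≤ lamMax A * ‖x‖ ^ 2 :=
  inner_act_le_of_spectrum hA (fun _ ht => le_csSup (finite_spectrum hA).bddAbove ht) x

lemma spectrum_nonempty [NeZero n] {A : Mat n} (hA : A.transpose = A) :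
    (spectrum ℝ A).Nonempty :=
  ⟨_, (isHermitian_of_transpose_eq hA).eigenvalues_mem_spectrum_real 0⟩

lemma lamMin_mem_spectrum [NeZero n] {A : Mat n} (hA : A.transpose = A) :
    lamMin A ∈ spectrum ℝ A :=
  (spectrum_nonempty hA).csInf_mem (finite_spectrum hA)

lemma le_lamMin [NeZero n] {A : Mat n} (hA : A.transpose = A) {c : ℝ}
    (h : ∀ x : Vec n, c * ‖x‖ ^ 2 ≤ inner ℝ x (act A x)) : c ≤ lamMin A := by
  obtain ⟨v, hv, e⟩ := (mem_spectrum_iff_exists_act _ _).1 (lamMin_mem_spectrum hA)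
  have := h v
  rw [e, inner_smul_right, real_inner_self_eq_norm_sq] at this
  exact le_of_mul_le_mul_right this (by positivity)

/-- For invertible `A` the products `AᵀA` and `AAᵀ` are conjugate by `A`, so they have the same
spectrum. This lets a single `λ` serve both players. -/
lemma lamMin_transpose_mul_self {A : Mat n} (hA : IsUnit A) :
    lamMin (A.transpose * A) = lamMin (A * A.transpose) := by
  obtain ⟨u, rfl⟩ := hA
  have : (u : Mat n) * (u : Mat n).transpose
      = u * ((u : Mat n).transpose * u) * (↑u⁻¹ : Mat n) := by
    simp [mul_assoc]
  rw [lamMin, lamMin, this, spectrum.units_conjugate]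

lemma lamMin_mul_transpose_pos [NeZero n] {A : Mat n} (hA : IsUnit A) :
    0 < lamMin (A * A.transpose) := by
  have hs : (A * A.transpose).transpose = A * A.transpose := by simp
  obtain ⟨v, hv, e⟩ := (mem_spectrum_iff_exists_act _ _).1 (lamMin_mem_spectrum hs)
  have h1 := norm_sq_act_transpose A v
  rw [e, inner_smul_right, real_inner_self_eq_norm_sq] at h1
  have h2 : act A.transpose v ≠ 0 := by
    intro h0
    obtain ⟨B, hB⟩ := ((Matrix.isUnit_transpose A).2 hA).exists_left_inv
    apply hv
    rw [← one_act v, ← hB, mul_act, h0]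
    simp [act]
  have h3 : 0 < ‖act A.transpose v‖ ^ 2 := by positivity
  rw [h1] at h3
  exact pos_of_mul_pos_left h3 (by positivity)

lemma norm_sq_act_le (A : Mat n) (x : Vec n) :
    ‖act A x‖ ^ 2 ≤ lamMax (A.transpose * A) * ‖x‖ ^ 2 := by
  rw [norm_sq_act]; exact le_lamMax_mul (by simp) x

/-- Cauchy–Schwarz gives `‖Aᵀx‖² = ⟨x, AAᵀx⟩ ≤ ‖x‖ ‖A(Aᵀx)‖`; the bound for `A` at the vector `Aᵀx`
then allows one factor `‖Aᵀx‖` to be cancelled. No comparison of the spectra of `AAᵀ` and `AᵀA` is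
needed. -/
lemma norm_sq_act_transpose_le (A : Mat n) (x : Vec n) :
    ‖act A.transpose x‖ ^ 2 ≤ lamMax (A.transpose * A) * ‖x‖ ^ 2 := by
  have h1 : ‖act A.transpose x‖ ^ 2 = inner ℝ x (act A (act A.transpose x)) := by
    rw [norm_sq_act_transpose, mul_act]
  have h2 := real_inner_le_norm x (act A (act A.transpose x))
  have h3 := norm_sq_act_le A (act A.transpose x)
  set a := ‖act A.transpose x‖
  set b := ‖act A (act A.transpose x)‖
  have hle : a ^ 2 ≤ ‖x‖ * b := h1.trans_le h2
  have h5 : (a ^ 2) ^ 2 ≤ (‖x‖ * b) ^ 2 := pow_le_pow_left₀ (by positivity) hle 2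
  by_cases ha : a = 0
  · rw [ha]
    have := norm_sq_act_le A x
    nlinarith [sq_nonneg ‖act A x‖]
  · have : 0 < a ^ 2 := by positivity
    refine le_of_mul_le_mul_right ?_ this
    nlinarith [sq_nonneg ‖x‖, mul_le_mul_of_nonneg_left h3 (sq_nonneg ‖x‖)]

/-- If `A` is symmetric positive definite and `A^{-1/2} Q A^{-1/2} ≤ ρ`, then `Q ≤ ρ A`. -/
lemma inner_act_le_of_lamMax_invSqrt {A Q : Mat n} (hA : A.transpose = A) (hQ : Q.transpose = Q)
    (hpos : 0 < lamMin A) {ρ : ℝ} (hρ : lamMax (invSqrt A * Q * invSqrt A) ≤ ρ) (x : Vec n) :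
    inner ℝ x (act Q x) ≤ ρ * inner ℝ x (act A x) := by
  have hsa : IsSelfAdjoint A := isHermitian_of_transpose_eq hA
  have hsp : ∀ t ∈ spectrum ℝ A, 0 < t := fun t ht =>
    hpos.trans_le (csInf_le (finite_spectrum hA).bddBelow ht)
  have hfin := finite_spectrum hA
  have hc : ∀ f : ℝ → ℝ, ContinuousOn f (spectrum ℝ A) := fun f => hfin.continuousOn f
  have hR : (invSqrt A).transpose = invSqrt A := by
    have : IsSelfAdjoint (invSqrt A) := cfc_predicate _ _
    rw [IsSelfAdjoint, Matrix.star_eq_conjTranspose,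
      Matrix.conjTranspose_eq_transpose_of_trivial] at this
    exact this
  have hRR : invSqrt A * invSqrt A * A = 1 := by
    conv_lhs => rw [← cfc_id' ℝ A hsa]
    rw [cfc_id' ℝ A hsa, invSqrt, ← cfc_mul _ _ A (hc _) (hc _)]
    nth_rw 2 [← cfc_id' ℝ A hsa]
    rw [← cfc_mul _ _ A (hc _) (hc _), ← cfc_one ℝ A hsa]
    refine cfc_congr fun t ht => ?_
    have h0 := hsp t ht
    have h1 : Real.sqrt t ≠ 0 := (Real.sqrt_pos.2 h0).ne'
    have h2 := Real.mul_self_sqrt h0.le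
    simp only [Pi.one_apply]
    rw [← mul_inv, h2, inv_mul_cancel₀ h0.ne']
  have hcomm : invSqrt A * A = A * invSqrt A := by
    have : Commute (cfc (fun t : ℝ => (Real.sqrt t)⁻¹) A) (cfc (fun t : ℝ => t) A) :=
      cfc_commute_cfc _ _ A
    rw [cfc_id' ℝ A hsa] at this
    exact this
  set R := invSqrt A with hRdef
  -- The test vector for `R Q R` is `A^{1/2} x`, written as `A R x`, so that `R` sends it back to
  -- `x`.
  have hu : act R (act (A * R) x) = x := by
    rw [← mul_act, ← hcomm, ← mul_assoc, hRR, one_act]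
  have h1 := (le_lamMax_mul (A := R * Q * R) (by simp [hR, hQ, mul_assoc])
    (act (A * R) x)).trans (mul_le_mul_of_nonneg_right hρ (by positivity))
  rw [mul_act (R * Q), hu, mul_act R, inner_act R, hR, hu, norm_sq_act] at h1
  have e : (A * R).transpose * (A * R) = A := by
    rw [Matrix.transpose_mul, hR, hA, ← hcomm, mul_assoc, ← mul_assoc A, ← hcomm, ← mul_assoc R,
      ← mul_assoc R, hRR, one_mul]
  rwa [e] at h1

end MatrixAction

/-! ### Calculus of integrable real random variables with prescribed mean. -/

section Mean

variable {Ξ : Type*} [MeasurableSpace Ξ] {P : Measure Ξ}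

/-- The real random variable `f` is integrable with expectation `a`. -/
def HasMean (P : Measure Ξ) (f : Ξ → ℝ) (a : ℝ) : Prop := Integrable f P ∧ ∫ s, f s ∂P = a

variable {f g : Ξ → ℝ} {a b : ℝ}

lemma HasMean.add (hf : HasMean P f a) (hg : HasMean P g b) :
    HasMean P (fun s => f s + g s) (a + b) :=
  ⟨hf.1.add hg.1, by rw [integral_add hf.1 hg.1, hf.2, hg.2]⟩

lemma HasMean.sub (hf : HasMean P f a) (hg : HasMean P g b) :
    HasMean P (fun s => f s - g s) (a - b) :=
  ⟨hf.1.sub hg.1, by rw [integral_sub hf.1 hg.1, hf.2, hg.2]⟩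

lemma HasMean.const_mul (c : ℝ) (hf : HasMean P f a) : HasMean P (fun s => c * f s) (c * a) :=
  ⟨hf.1.const_mul c, by rw [integral_const_mul, hf.2]⟩

lemma hasMean_const [IsProbabilityMeasure P] (c : ℝ) : HasMean P (fun _ => c) c :=
  ⟨integrable_const c, by simp⟩

lemma HasMean.congr (hf : HasMean P f a) (h : ∀ s, g s = f s) (hab : b = a) : HasMean P g b := by
  rw [hab, show g = f from funext h]; exact hf

lemma HasMean.mono (hf : HasMean P f a) (hg : HasMean P g b) (h : ∀ s, f s ≤ g s) : a ≤ b := by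
  rw [← hf.2, ← hg.2]; exact integral_mono hf.1 hg.1 h

lemma HasMean.nonneg (hf : HasMean P f a) (h : ∀ s, 0 ≤ f s) : 0 ≤ a := by
  rw [← hf.2]; exact integral_nonneg h

lemma HasMean.sum {ι : Type*} (s : Finset ι) {f : ι → Ξ → ℝ} {a : ι → ℝ}
    (h : ∀ i ∈ s, HasMean P (f i) (a i)) :
    HasMean P (fun t => ∑ i ∈ s, f i t) (∑ i ∈ s, a i) :=
  ⟨integrable_finsetSum s fun i hi => (h i hi).1, by
    rw [integral_finsetSum s fun i hi => (h i hi).1]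
    exact Finset.sum_congr rfl fun i hi => (h i hi).2⟩

end Mean

/-! ### Random matrices: integrability of entries and means under independence. -/

section RandomMatrix

variable {n : ℕ} {Ξ : Type*} [MeasurableSpace Ξ] {P : Measure Ξ}

/-- All entries of the random matrix `X` are in `L^p`. -/
def EntryMemLp (X : Ξ → Mat n) (p : ENNReal) (P : Measure Ξ) : Prop :=
  ∀ i j, MemLp (fun s => X s i j) p P

lemma EntryMemLp.transpose {X : Ξ → Mat n} {p : ENNReal} (h : EntryMemLp X p P) :
    EntryMemLp (fun s => (X s).transpose) p P := fun i j => h j i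

lemma EntryMemLp.mul {X Y : Ξ → Mat n} {p q r : ENNReal} [p.HolderTriple q r]
    (hX : EntryMemLp X p P) (hY : EntryMemLp Y q P) :
    EntryMemLp (fun s => X s * Y s) r P := fun i j => by
  simp only [Matrix.mul_apply]
  exact memLp_finsetSum _ fun k _ => (hY k j).mul' (hX i k)

lemma EntryMemLp.sub {X Y : Ξ → Mat n} {p : ENNReal} (hX : EntryMemLp X p P)
    (hY : EntryMemLp Y p P) : EntryMemLp (fun s => X s - Y s) p P :=
  fun i j => (hX i j).sub (hY i j)

lemma entryMemLp_const [IsFiniteMeasure P] (A : Mat n) (p : ENNReal) :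
    EntryMemLp (fun _ => A) p P := fun _ _ => memLp_const _

lemma EntryMemLp.mono [IsFiniteMeasure P] {X : Ξ → Mat n} {p q : ENNReal}
    (hX : EntryMemLp X q P) (hpq : p ≤ q) : EntryMemLp X p P :=
  fun i j => (hX i j).mono_exponent hpq

lemma EntryMemLp.integrable {X : Ξ → Mat n} (hX : EntryMemLp X 1 P) (i j : Fin n) :
    Integrable (fun s => X s i j) P := memLp_one_iff_integrable.1 (hX i j)

lemma EntryMemLp.hasMean_inner_act {X : Ξ → Mat n} (hX : EntryMemLp X 1 P) (x y : Vec n) :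
    HasMean P (fun s => inner ℝ x (act (X s) y)) (inner ℝ x (act (matE P X) y)) := by
  refine HasMean.congr (HasMean.sum Finset.univ fun i _ => HasMean.sum Finset.univ fun j _ =>
    HasMean.const_mul (x i * y j) ⟨hX.integrable i j, rfl⟩) (fun s => ?_) ?_
  · rw [inner_act_eq_sum]
    exact Finset.sum_congr rfl fun i _ => Finset.sum_congr rfl fun j _ => mul_comm _ _
  · rw [inner_act_eq_sum]
    exact Finset.sum_congr rfl fun i _ => Finset.sum_congr rfl fun j _ => mul_comm _ _

lemma matE_transpose (X : Ξ → Mat n) :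
    (matE P X).transpose = matE P fun s => (X s).transpose := rfl

lemma matE_transpose_eq {X : Ξ → Mat n} (h : ∀ s, (X s).transpose = X s) :
    (matE P X).transpose = matE P X := by
  rw [matE_transpose]; simp only [h]

/-- Entries of a random matrix and a random vector-valued variable are independent. -/
def EntryIndep {β : Type*} [MeasurableSpace β] (X : Ξ → Mat n) (g : Ξ → β) (P : Measure Ξ) : Prop :=
  ∀ i j, IndepFun (fun s => X s i j) g P

/-- Entrywise each product `X_ij g_j` has independent integrable factors, so it is integrable
without any higher moments, and `E g_j = 0` kills its mean. -/
lemma EntryMemLp.hasMean_inner_act_indep {X : Ξ → Mat n} (hX : EntryMemLp X 1 P) {g : Ξ → Vec n}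
    (hXg : EntryIndep X g P) (hg : Integrable g P) (hg0 : ∫ s, g s ∂P = 0)
    (x : Vec n) : HasMean P (fun s => inner ℝ x (act (X s) (g s))) 0 := by
  have hgi : ∀ j, HasMean P (fun s => g s j) 0 := fun j => by
    refine ⟨(EuclideanSpace.proj (𝕜 := ℝ) j).integrable_comp hg, ?_⟩
    have := (EuclideanSpace.proj (𝕜 := ℝ) j).integral_comp_comm hg
    rw [hg0] at this
    simpa using this
  refine HasMean.congr (HasMean.sum (a := fun _ => ∑ _j : Fin n, 0) Finset.univ fun i _ =>
    HasMean.sum (a := fun _ => 0) (f := fun j s => x i * (X s i j * g s j)) Finset.univ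
      fun j _ => ?_) (fun s => ?_) (by simp)
  · have hind : IndepFun (fun s => X s i j) (fun s => g s j) P :=
      (hXg i j).comp (φ := id) (ψ := fun v : Vec n => v j) measurable_id (by fun_prop)
    have := HasMean.const_mul (x i) (a := 0) (P := P) (f := fun s => X s i j * g s j)
      ⟨hind.integrable_mul (hX.integrable i j) (hgi j).1, by
        rw [hind.integral_fun_mul_eq_mul_integral (hX.integrable i j).1 (hgi j).1.1, (hgi j).2,
          mul_zero]⟩
    rwa [mul_zero] at this
  · rw [inner_act_eq_sum]
    exact Finset.sum_congr rfl fun i _ => Finset.sum_congr rfl fun j _ => by ring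

/-- Independence replaces `X` by its mean inside the quadratic form; `X_ij` and `g_i g_j` only have
to be integrable. -/
lemma EntryMemLp.hasMean_quadratic_indep {X : Ξ → Mat n} (hX : EntryMemLp X 1 P) {g : Ξ → Vec n}
    (hXg : EntryIndep X g P) (hg : MemLp g 2 P) :
    HasMean P (fun s => inner ℝ (g s) (act (X s) (g s)))
      (∫ s, inner ℝ (g s) (act (matE P X) (g s)) ∂P) := by
  have hgi : ∀ j, MemLp (fun s => g s j) 2 P := fun j =>
    (EuclideanSpace.proj (𝕜 := ℝ) j).comp_memLp' hg
  have hgg : ∀ i j, Integrable (fun s => g s i * g s j) P := fun i j =>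
    (hgi i).integrable_mul (hgi j)
  have hr : HasMean P (fun s => inner ℝ (g s) (act (matE P X) (g s)))
      (∑ i, ∑ j, matE P X i j * ∫ s, g s i * g s j ∂P) := by
    refine HasMean.congr (HasMean.sum Finset.univ fun i _ => HasMean.sum Finset.univ fun j _ =>
      HasMean.const_mul (matE P X i j) ⟨hgg i j, rfl⟩) (fun s => ?_) rfl
    rw [inner_act_eq_sum]
  rw [hr.2]
  refine HasMean.congr (HasMean.sum Finset.univ fun i _ => HasMean.sum
    (f := fun j s => X s i j * (g s i * g s j)) Finset.univ fun j _ => ?_) (fun s => ?_) rfl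
  · have hind : IndepFun (fun s => X s i j) (fun s => g s i * g s j) P :=
      (hXg i j).comp (φ := id) (ψ := fun v : Vec n => v i * v j) measurable_id (by fun_prop)
    exact ⟨hind.integrable_mul (hX.integrable i j) (hgg i j),
      hind.integral_fun_mul_eq_mul_integral (hX.integrable i j).1 (hgg i j).1⟩
  · rw [inner_act_eq_sum]

end RandomMatrix

/-! ### Moments of the coupling matrix and comparison of `M`, `M̂`, `B`, `ρ`, `μ` and `λ`. -/

section GameMoments

variable {n : ℕ} {Ξ : Type*} [MeasurableSpace Ξ] {G : Game n Ξ} {σB σB2 σg : ℝ}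

-- Hölder with `1/4 + 1/4 = 1/2`: entries in `L⁴` put the entries of `B_ξ B_ξᵀ` in `L²` and those of
-- its square in `L¹`.
instance : ENNReal.HolderTriple 4 4 2 where
  inv_add_inv_eq_inv := by
    have h4 : (4 : ENNReal)⁻¹ = 2⁻¹ * 2⁻¹ := by
      rw [← ENNReal.mul_inv (by simp) (by simp)]; norm_num
    rw [h4, ← mul_add, ENNReal.inv_two_add_inv_two, mul_one]

lemma AssumptionB.entry_B (hB : AssumptionB G σB σB2) : EntryMemLp G.B 4 G.P := hB.memLp_B

lemma AssumptionB.entry_BBt (hB : AssumptionB G σB σB2) :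
    EntryMemLp (fun s => G.B s * (G.B s).transpose) 2 G.P := hB.entry_B.mul hB.entry_B.transpose

lemma AssumptionB.entry_BtB (hB : AssumptionB G σB σB2) :
    EntryMemLp (fun s => (G.B s).transpose * G.B s) 2 G.P := hB.entry_B.transpose.mul hB.entry_B

lemma AssumptionB.entry_BBt_sq (hB : AssumptionB G σB σB2) :
    EntryMemLp (fun s => (G.B s * (G.B s).transpose) ^ 2) 1 G.P := by
  simp only [sq]; exact hB.entry_BBt.mul hB.entry_BBt

lemma AssumptionB.entry_BtB_sq (hB : AssumptionB G σB σB2) :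
    EntryMemLp (fun s => ((G.B s).transpose * G.B s) ^ 2) 1 G.P := by
  simp only [sq]; exact hB.entry_BtB.mul hB.entry_BtB

variable [IsProbabilityMeasure G.P]

lemma AssumptionB.entry_B_two (hB : AssumptionB G σB σB2) : EntryMemLp G.B 2 G.P :=
  hB.entry_B.mono (by norm_num)

lemma AssumptionB.entry_B_one (hB : AssumptionB G σB σB2) : EntryMemLp G.B 1 G.P :=
  hB.entry_B.mono (by norm_num)

lemma AssumptionB.entry_BBt_one (hB : AssumptionB G σB σB2) :
    EntryMemLp (fun s => G.B s * (G.B s).transpose) 1 G.P := hB.entry_BBt.mono (by norm_num)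

lemma AssumptionB.entry_BtB_one (hB : AssumptionB G σB σB2) :
    EntryMemLp (fun s => (G.B s).transpose * G.B s) 1 G.P := hB.entry_BtB.mono (by norm_num)

lemma AssumptionB.entry_BBtB (hB : AssumptionB G σB σB2) :
    EntryMemLp (fun s => G.B s * (G.B s).transpose * G.B s) 1 G.P :=
  hB.entry_BBt.mul hB.entry_B_two

lemma AssumptionB.entry_BtBBt (hB : AssumptionB G σB σB2) :
    EntryMemLp (fun s => (G.B s).transpose * G.B s * (G.B s).transpose) 1 G.P :=
  hB.entry_BtB.mul hB.entry_B_two.transpose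

lemma Game.M_transpose : G.M.transpose = G.M := matE_transpose_eq fun s => by simp

lemma Game.Mhat_transpose : G.Mhat.transpose = G.Mhat := matE_transpose_eq fun s => by simp

lemma AssumptionB.mean_B (hB : AssumptionB G σB σB2) (x y : Vec n) :
    HasMean G.P (fun s => inner ℝ x (act (G.B s) y)) (inner ℝ x (act G.meanB y)) :=
  hB.entry_B_one.hasMean_inner_act x y

lemma AssumptionB.mean_Bt (hB : AssumptionB G σB σB2) (x y : Vec n) :
    HasMean G.P (fun s => inner ℝ x (act (G.B s).transpose y))
      (inner ℝ x (act G.meanB.transpose y)) :=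
  hB.entry_B_one.transpose.hasMean_inner_act x y

lemma AssumptionB.mean_BBt (hB : AssumptionB G σB σB2) (x y : Vec n) :
    HasMean G.P (fun s => inner ℝ x (act (G.B s) (act (G.B s).transpose y)))
      (inner ℝ x (act G.M y)) :=
  (hB.entry_BBt_one.hasMean_inner_act x y).congr (fun s => by rw [mul_act]) rfl

lemma AssumptionB.mean_BtB (hB : AssumptionB G σB σB2) (x y : Vec n) :
    HasMean G.P (fun s => inner ℝ x (act (G.B s).transpose (act (G.B s) y)))
      (inner ℝ x (act G.Mhat y)) :=
  (hB.entry_BtB_one.hasMean_inner_act x y).congr (fun s => by rw [mul_act]) rfl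

lemma AssumptionB.mean_BBt_sq (hB : AssumptionB G σB σB2) (x : Vec n) :
    HasMean G.P (fun s => ‖act (G.B s) (act (G.B s).transpose x)‖ ^ 2)
      (inner ℝ x (act (matE G.P fun s => (G.B s * (G.B s).transpose) ^ 2) x)) :=
  (hB.entry_BBt_sq.hasMean_inner_act x x).congr
    (fun s => by rw [← mul_act, norm_sq_act]; simp [sq]) rfl

lemma AssumptionB.mean_BtB_sq (hB : AssumptionB G σB σB2) (x : Vec n) :
    HasMean G.P (fun s => ‖act (G.B s).transpose (act (G.B s) x)‖ ^ 2)
      (inner ℝ x (act (matE G.P fun s => ((G.B s).transpose * G.B s) ^ 2) x)) :=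
  (hB.entry_BtB_sq.hasMean_inner_act x x).congr
    (fun s => by rw [← mul_act, norm_sq_act]; simp [sq]) rfl

/-- The variance `E[(B_ξ - B)(B_ξ - B)ᵀ]` equals `M - B Bᵀ`. -/
lemma AssumptionB.inner_var_right (hB : AssumptionB G σB σB2) (x y : Vec n) :
    inner ℝ x (act (matE G.P fun s => (G.B s - G.meanB) * (G.B s - G.meanB).transpose) y)
      = inner ℝ x (act G.M y) - inner ℝ (act G.meanB.transpose x) (act G.meanB.transpose y) := by
  have hc : EntryMemLp (fun s => G.B s - G.meanB) 2 G.P :=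
    hB.entry_B_two.sub (entryMemLp_const _ _)
  have h1 := (hc.mul (r := 1) hc.transpose).hasMean_inner_act x y
  have h2 := (((hB.mean_BBt x y).sub (hB.mean_B x (act G.meanB.transpose y))).sub
    (hB.mean_Bt (act G.meanB.transpose x) y)).add
      (hasMean_const (inner ℝ (act G.meanB.transpose x) (act G.meanB.transpose y)))
  have h3 : ∀ s, inner ℝ x (act ((G.B s - G.meanB) * (G.B s - G.meanB).transpose) y)
      = inner ℝ x (act (G.B s) (act (G.B s).transpose y))
        - inner ℝ x (act (G.B s) (act G.meanB.transpose y))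
        - inner ℝ (act G.meanB.transpose x) (act (G.B s).transpose y)
        + inner ℝ (act G.meanB.transpose x) (act G.meanB.transpose y) := fun s => by
    rw [mul_act, Matrix.transpose_sub, sub_act, sub_act, act_sub, act_sub]
    simp only [inner_sub_right]
    rw [inner_act G.meanB, inner_act G.meanB]
    ring
  have h4 := (h2.congr h3 rfl).2
  rw [← h1.2, h4]
  rw [← inner_act G.meanB]; ring

lemma AssumptionB.inner_var_left (hB : AssumptionB G σB σB2) (x y : Vec n) :
    inner ℝ x (act (matE G.P fun s => (G.B s - G.meanB).transpose * (G.B s - G.meanB)) y)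
      = inner ℝ x (act G.Mhat y) - inner ℝ (act G.meanB x) (act G.meanB y) := by
  have hc : EntryMemLp (fun s => G.B s - G.meanB) 2 G.P :=
    hB.entry_B_two.sub (entryMemLp_const _ _)
  have h1 := (hc.transpose.mul (r := 1) hc).hasMean_inner_act x y
  have h2 := (((hB.mean_BtB x y).sub (hB.mean_Bt x (act G.meanB y))).sub
    (hB.mean_B (act G.meanB x) y)).add
      (hasMean_const (inner ℝ (act G.meanB x) (act G.meanB y)))
  have h3 : ∀ s, inner ℝ x (act ((G.B s - G.meanB).transpose * (G.B s - G.meanB)) y)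
      = inner ℝ x (act (G.B s).transpose (act (G.B s) y))
        - inner ℝ x (act (G.B s).transpose (act G.meanB y))
        - inner ℝ (act G.meanB x) (act (G.B s) y)
        + inner ℝ (act G.meanB x) (act G.meanB y) := fun s => by
    rw [mul_act, Matrix.transpose_sub, sub_act, sub_act, act_sub, act_sub]
    simp only [inner_sub_right, inner_act_transpose]
    ring
  have h4 := (h2.congr h3 rfl).2
  rw [← h1.2, h4, inner_act_transpose]; ring

lemma AssumptionB.abs_inner_M_sub_le (hB : AssumptionB G σB σB2) (x y : Vec n) :
    |inner ℝ x (act G.M y) - inner ℝ (act G.meanB.transpose x) (act G.meanB.transpose y)|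
      ≤ σB ^ 2 * (‖x‖ * ‖y‖) := by
  rw [← hB.inner_var_right]
  refine (abs_real_inner_le_norm _ _).trans ?_
  have := mul_le_mul_of_nonneg_left (norm_act_le_of_opNorm_le hB.var_right y) (norm_nonneg x)
  linarith

lemma AssumptionB.abs_inner_Mhat_sub_le (hB : AssumptionB G σB σB2) (x y : Vec n) :
    |inner ℝ x (act G.Mhat y) - inner ℝ (act G.meanB x) (act G.meanB y)|
      ≤ σB ^ 2 * (‖x‖ * ‖y‖) := by
  rw [← hB.inner_var_left]
  refine (abs_real_inner_le_norm _ _).trans ?_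
  have := mul_le_mul_of_nonneg_left (norm_act_le_of_opNorm_le hB.var_left y) (norm_nonneg x)
  linarith

lemma AssumptionB.norm_sq_meanB_transpose_le (hB : AssumptionB G σB σB2) (x : Vec n) :
    ‖act G.meanB.transpose x‖ ^ 2 ≤ inner ℝ x (act G.M x) := by
  have hc : EntryMemLp (fun s => G.B s - G.meanB) 2 G.P :=
    hB.entry_B_two.sub (entryMemLp_const _ _)
  have h1 := ((hc.mul (r := 1) hc.transpose).hasMean_inner_act x x).nonneg fun s => by
    rw [← norm_sq_act_transpose]; positivity
  rw [hB.inner_var_right, real_inner_self_eq_norm_sq] at h1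
  linarith

/-- Jensen's inequality, obtained by expanding `E‖Mx - B_ξ B_ξᵀ x‖² ≥ 0`. -/
lemma AssumptionB.norm_sq_M_le (hB : AssumptionB G σB σB2) (x : Vec n) :
    ‖act G.M x‖ ^ 2
      ≤ inner ℝ x (act (matE G.P fun s => (G.B s * (G.B s).transpose) ^ 2) x) := by
  have h := ((hB.mean_BBt_sq x).sub ((hB.mean_BBt (act G.M x) x).const_mul 2)).add
    (hasMean_const (‖act G.M x‖ ^ 2))
  have := h.nonneg fun s => by
    have := norm_sub_sq_real (act G.M x) (act (G.B s) (act (G.B s).transpose x))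
    nlinarith [sq_nonneg ‖act G.M x - act (G.B s) (act (G.B s).transpose x)‖]
  rw [real_inner_self_eq_norm_sq] at this
  linarith

lemma AssumptionB.norm_sq_Mhat_le (hB : AssumptionB G σB σB2) (x : Vec n) :
    ‖act G.Mhat x‖ ^ 2
      ≤ inner ℝ x (act (matE G.P fun s => ((G.B s).transpose * G.B s) ^ 2) x) := by
  have h := ((hB.mean_BtB_sq x).sub ((hB.mean_BtB (act G.Mhat x) x).const_mul 2)).add
    (hasMean_const (‖act G.Mhat x‖ ^ 2))
  have := h.nonneg fun s => by
    have := norm_sub_sq_real (act G.Mhat x) (act (G.B s).transpose (act (G.B s) x))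
    nlinarith [sq_nonneg ‖act G.Mhat x - act (G.B s).transpose (act (G.B s) x)‖]
  rw [real_inner_self_eq_norm_sq] at this
  linarith

lemma AssumptionB.mu_pos (hB : AssumptionB G σB σB2) : 0 < G.mu := hB.lamMin_pos

lemma Game.mu_mul_le_M (x : Vec n) : G.mu * ‖x‖ ^ 2 ≤ inner ℝ x (act G.M x) :=
  (mul_le_mul_of_nonneg_right (min_le_left _ _) (by positivity)).trans
    (lamMin_mul_le G.M_transpose x)

lemma Game.mu_mul_le_Mhat (x : Vec n) : G.mu * ‖x‖ ^ 2 ≤ inner ℝ x (act G.Mhat x) :=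
  (mul_le_mul_of_nonneg_right (min_le_right _ _) (by positivity)).trans
    (lamMin_mul_le G.Mhat_transpose x)

/-- `ρ₁ ∨ ρ₂`, so that `η_M = (ρ₁ ∨ ρ₂)^{-1/2}`. -/
def Game.rho (G : Game n Ξ) : ℝ :=
  max (lamMax (invSqrt G.M * (matE G.P fun s => (G.B s * (G.B s).transpose) ^ 2) * invSqrt G.M))
    (lamMax (invSqrt G.Mhat * (matE G.P fun s => ((G.B s).transpose * G.B s) ^ 2) *
      invSqrt G.Mhat))

lemma AssumptionB.BBt_sq_le (hB : AssumptionB G σB σB2) (x : Vec n) :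
    inner ℝ x (act (matE G.P fun s => (G.B s * (G.B s).transpose) ^ 2) x)
      ≤ G.rho * inner ℝ x (act G.M x) :=
  inner_act_le_of_lamMax_invSqrt G.M_transpose (matE_transpose_eq fun s => by simp [sq])
    (lt_min_iff.1 hB.lamMin_pos).1 (le_max_left _ _) x

lemma AssumptionB.BtB_sq_le (hB : AssumptionB G σB σB2) (x : Vec n) :
    inner ℝ x (act (matE G.P fun s => ((G.B s).transpose * G.B s) ^ 2) x)
      ≤ G.rho * inner ℝ x (act G.Mhat x) :=
  inner_act_le_of_lamMax_invSqrt G.Mhat_transpose (matE_transpose_eq fun s => by simp [sq])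
    (lt_min_iff.1 hB.lamMin_pos).2 (le_max_right _ _) x

/-- In dimension zero the spectrum is empty and its supremum is `0` by convention, against
`lamMax_pos`. -/
lemma AssumptionB.neZero (hB : AssumptionB G σB σB2) : NeZero n := by
  refine ⟨fun h => ?_⟩
  subst h
  have := hB.lamMax_pos
  rw [lamMax, spectrum.of_subsingleton, Real.sSup_empty] at this
  exact lt_irrefl _ this

/-- Applied to `M` and `M̂`, this turns `M² ≤ ρ M` into `M ≤ ρ`: by Cauchy–Schwarz `‖Ax‖² ≤ ρ ‖x‖
‖Ax‖`, and one factor `‖Ax‖` cancels. -/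
lemma inner_act_le_of_norm_sq_le {A : Mat n} {ρ : ℝ} {x : Vec n}
    (h : ‖act A x‖ ^ 2 ≤ ρ * inner ℝ x (act A x)) (hx : 0 < inner ℝ x (act A x)) :
    0 < ρ ∧ inner ℝ x (act A x) ≤ ρ * ‖x‖ ^ 2 := by
  have h1 := real_inner_le_norm x (act A x)
  have hA : 0 < ‖act A x‖ := by
    by_contra hc
    have : ‖act A x‖ = 0 := le_antisymm (not_lt.1 hc) (norm_nonneg _)
    rw [this, mul_zero] at h1
    linarith
  have hρ : 0 < ρ := by
    by_contra hc
    have : 0 < ‖act A x‖ ^ 2 := by positivity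
    nlinarith [mul_nonneg (neg_nonneg.2 (not_lt.1 hc)) hx.le]
  refine ⟨hρ, ?_⟩
  have h2 : ‖act A x‖ ≤ ρ * ‖x‖ := by
    refine le_of_mul_le_mul_right ?_ hA
    nlinarith [mul_le_mul_of_nonneg_left h1 hρ.le]
  nlinarith [mul_le_mul_of_nonneg_left h2 (norm_nonneg x)]

lemma AssumptionB.rho_pos (hB : AssumptionB G σB σB2) : 0 < G.rho := by
  have := hB.neZero
  obtain ⟨x, hx⟩ := exists_ne (0 : Vec n)
  exact (inner_act_le_of_norm_sq_le ((hB.norm_sq_M_le x).trans (hB.BBt_sq_le x))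
    ((mul_pos hB.mu_pos (by positivity)).trans_le (G.mu_mul_le_M x))).1

lemma AssumptionB.M_le (hB : AssumptionB G σB σB2) (x : Vec n) :
    inner ℝ x (act G.M x) ≤ G.rho * ‖x‖ ^ 2 := by
  rcases eq_or_ne x 0 with rfl | hx
  · simp
  exact (inner_act_le_of_norm_sq_le ((hB.norm_sq_M_le x).trans (hB.BBt_sq_le x))
    ((mul_pos hB.mu_pos (by positivity)).trans_le (G.mu_mul_le_M x))).2

lemma AssumptionB.Mhat_le (hB : AssumptionB G σB σB2) (x : Vec n) :
    inner ℝ x (act G.Mhat x) ≤ G.rho * ‖x‖ ^ 2 := by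
  rcases eq_or_ne x 0 with rfl | hx
  · simp
  exact (inner_act_le_of_norm_sq_le ((hB.norm_sq_Mhat_le x).trans (hB.BtB_sq_le x))
    ((mul_pos hB.mu_pos (by positivity)).trans_le (G.mu_mul_le_Mhat x))).2

lemma AssumptionB.etaM_pos (hB : AssumptionB G σB σB2) : 0 < G.etaM :=
  one_div_pos.2 (Real.sqrt_pos.2 hB.rho_pos)

lemma AssumptionB.etaM_sq (hB : AssumptionB G σB σB2) : G.etaM ^ 2 * G.rho = 1 := by
  have : G.etaM ^ 2 = 1 / G.rho := by
    rw [Game.etaM, div_pow, one_pow, ← Game.rho, Real.sq_sqrt hB.rho_pos.le]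
  rw [this, one_div_mul_cancel hB.rho_pos.ne']

lemma AssumptionB.lam_pos (hB : AssumptionB G σB σB2) (hns : IsUnit G.meanB) : 0 < G.lam :=
  have := hB.neZero
  lamMin_mul_transpose_pos hns

lemma Game.lam_mul_le_transpose (G : Game n Ξ) (x : Vec n) :
    G.lam * ‖x‖ ^ 2 ≤ ‖act G.meanB.transpose x‖ ^ 2 := by
  rw [norm_sq_act_transpose]; exact lamMin_mul_le (by simp) x

lemma Game.lam_mul_le (hns : IsUnit G.meanB) (x : Vec n) :
    G.lam * ‖x‖ ^ 2 ≤ ‖act G.meanB x‖ ^ 2 := by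
  rw [norm_sq_act, Game.lam, ← lamMin_transpose_mul_self hns]; exact lamMin_mul_le (by simp) x

lemma AssumptionB.lam_le_rho (hB : AssumptionB G σB σB2) : G.lam ≤ G.rho := by
  have := hB.neZero
  obtain ⟨x, hx⟩ := exists_ne (0 : Vec n)
  have h := (G.lam_mul_le_transpose x).trans ((hB.norm_sq_meanB_transpose_le x).trans (hB.M_le x))
  exact le_of_mul_le_mul_right h (by positivity)

/-- The variance identity `M = BBᵀ + Var` gives `M ≤ BBᵀ + σ_B²` as quadratic forms. It removes `μ`
from the last bound on the restarting phase. -/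
lemma AssumptionB.mu_le (hB : AssumptionB G σB σB2) : G.mu ≤ G.lam + σB ^ 2 := by
  have := hB.neZero
  rw [← sub_le_iff_le_add]
  refine le_lamMin (by simp) fun x => ?_
  have h1 := G.mu_mul_le_M x
  have h2 := (le_abs_self _).trans (hB.abs_inner_M_sub_le x x)
  rw [real_inner_self_eq_norm_sq, norm_sq_act_transpose] at h2
  linarith

end GameMoments

/-! ### First and second moments of one extragradient step. -/

section StepMoments

variable {n : ℕ}

/-- Linear part of the extragradient update, first player. -/
def linX (η : ℝ) (B : Mat n) (x y : Vec n) : Vec n :=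
  x - η • act B y - η ^ 2 • act B (act B.transpose x)

/-- Linear part of the extragradient update, second player. -/
def linY (η : ℝ) (B : Mat n) (x y : Vec n) : Vec n :=
  y + η • act B.transpose x - η ^ 2 • act B.transpose (act B y)

/-- Additive noise of the extragradient update, first player. -/
def noiseX (η : ℝ) (B : Mat n) (gx gy : Vec n) : Vec n := -(η • gx) - η ^ 2 • act B gy

/-- Additive noise of the extragradient update, second player. -/
def noiseY (η : ℝ) (B : Mat n) (gx gy : Vec n) : Vec n := η • gy - η ^ 2 • act B.transpose gx

lemma segStep_eq (η : ℝ) (B : Mat n) (gx gy x y : Vec n) :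
    segStep η B gx gy (x, y)
      = (linX η B x y + noiseX η B gx gy, linY η B x y + noiseY η B gx gy) := by
  simp only [segStep, linX, linY, noiseX, noiseY, act_add, act_sub, act_smul]
  ext1 <;> module

/-- The linear part is `1 - ηJ + η²J²` with `J (x, y) = (By, -Bᵀx)` skew: odd powers of `J` drop out
of the expansion, and `2η²⟨z, J²z⟩ = -2η²‖Jz‖²` outweighs `η²‖Jz‖²`. -/
lemma norm_sq_lin (η : ℝ) (B : Mat n) (x y : Vec n) :
    ‖linX η B x y‖ ^ 2 + ‖linY η B x y‖ ^ 2 = ‖x‖ ^ 2 + ‖y‖ ^ 2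
      - η ^ 2 * (inner ℝ x (act B (act B.transpose x)) + inner ℝ y (act B.transpose (act B y)))
      + η ^ 4 * (‖act B (act B.transpose x)‖ ^ 2 + ‖act B.transpose (act B y)‖ ^ 2) := by
  have h1 : inner ℝ x (act B y) = inner ℝ y (act B.transpose x) := by
    rw [inner_act, real_inner_comm]
  have h2 : inner ℝ x (act B (act B.transpose x)) = ‖act B.transpose x‖ ^ 2 := by
    rw [inner_act, real_inner_self_eq_norm_sq]
  have h3 : inner ℝ y (act B.transpose (act B y)) = ‖act B y‖ ^ 2 := by
    rw [inner_act_transpose, real_inner_self_eq_norm_sq]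
  have h4 : inner ℝ (act B y) (act B (act B.transpose x))
      = inner ℝ (act B.transpose x) (act B.transpose (act B y)) := by
    rw [inner_act, real_inner_comm]
  simp only [linX, linY, norm_sub_sq_real, norm_add_sq_real, inner_sub_left, inner_add_left,
    inner_smul_left, inner_smul_right, norm_smul, mul_pow, conj_trivial, Real.norm_eq_abs, sq_abs]
  rw [h2, h3, h1, h4]
  ring

/-- With `h = (-gx, gy)` the noise is `η (1 - ηJ) h`. As the adjoint of `1 - ηJ + η²J²` is `1 + ηJ +
η²J²`, the product telescopes to `η ⟨z, (1 - η³J³) h⟩`, so only the orders `η` and `η⁴` survive. -/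
lemma inner_lin_noise (η : ℝ) (B : Mat n) (x y gx gy : Vec n) :
    inner ℝ (linX η B x y) (noiseX η B gx gy) + inner ℝ (linY η B x y) (noiseY η B gx gy)
      = η * inner ℝ y gy - η * inner ℝ x gx
        + η ^ 4 * inner ℝ x (act (B * B.transpose * B) gy)
        + η ^ 4 * inner ℝ y (act (B.transpose * B * B.transpose) gx) := by
  simp only [linX, linY, noiseX, noiseY, inner_sub_left, inner_sub_right, inner_add_left,
    inner_smul_left, inner_smul_right, inner_neg_right, conj_trivial, mul_act]
  have h1 : inner ℝ (act B y) gx = inner ℝ y (act B.transpose gx) :=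
    (inner_act_transpose B y gx).symm
  have h2 : inner ℝ (act B.transpose x) gy = inner ℝ x (act B gy) := (inner_act B x gy).symm
  have h3 : inner ℝ (act B (act B.transpose x)) gx
      = inner ℝ (act B.transpose x) (act B.transpose gx) := (inner_act_transpose B _ _).symm
  have h4 : inner ℝ (act B.transpose (act B y)) gy = inner ℝ (act B y) (act B gy) :=
    (inner_act B _ _).symm
  have h5 : inner ℝ (act B (act B.transpose x)) (act B gy)
      = inner ℝ x (act B (act B.transpose (act B gy))) := by
    rw [← inner_act_transpose, ← inner_act]
  have h6 : inner ℝ (act B.transpose (act B y)) (act B.transpose gx)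
      = inner ℝ y (act B.transpose (act B (act B.transpose gx))) := by
    rw [← inner_act, ← inner_act_transpose]
  rw [h1, h2, h3, h4, h5, h6]
  ring

lemma inner_noise (η : ℝ) (B : Mat n) (x y gx gy : Vec n) :
    inner ℝ x (noiseX η B gx gy) + inner ℝ y (noiseY η B gx gy)
      = η * inner ℝ y gy - η * inner ℝ x gx - η ^ 2 * inner ℝ x (act B gy)
        - η ^ 2 * inner ℝ y (act B.transpose gx) := by
  simp only [noiseX, noiseY, inner_sub_right, inner_smul_right, inner_neg_right]
  ring

/-- The two parts of `η (1 - ηJ) h` are orthogonal because `J` is skew. -/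
lemma norm_sq_noise (η : ℝ) (B : Mat n) (gx gy : Vec n) :
    ‖noiseX η B gx gy‖ ^ 2 + ‖noiseY η B gx gy‖ ^ 2
      = η ^ 2 * (‖gx‖ ^ 2 + ‖gy‖ ^ 2)
        + η ^ 4 * (inner ℝ gx (act (B * B.transpose) gx)
          + inner ℝ gy (act (B.transpose * B) gy)) := by
  have h1 : inner ℝ gy (act B.transpose gx) = inner ℝ gx (act B gy) := by
    rw [inner_act_transpose, real_inner_comm]
  rw [← norm_sq_act_transpose, ← norm_sq_act]
  simp only [noiseX, noiseY, norm_sub_sq_real, norm_neg, inner_neg_left, inner_smul_left,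
    inner_smul_right, norm_smul, mul_pow, conj_trivial, Real.norm_eq_abs, sq_abs]
  rw [h1]
  ring

variable {Ξ : Type*} [MeasurableSpace Ξ] {G : Game n Ξ} {σB σB2 σg : ℝ}

/-- Mean of the extragradient update, first player. -/
def Game.meanX (G : Game n Ξ) (η : ℝ) (x y : Vec n) : Vec n :=
  x - η • act G.meanB y - η ^ 2 • act G.M x

/-- Mean of the extragradient update, second player. -/
def Game.meanY (G : Game n Ξ) (η : ℝ) (x y : Vec n) : Vec n :=
  y + η • act G.meanB.transpose x - η ^ 2 • act G.Mhat y

variable [IsProbabilityMeasure G.P]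

lemma AssumptionB.mean_inner_lin (hB : AssumptionB G σB σB2) (η : ℝ) (u v x y : Vec n) :
    HasMean G.P (fun s => inner ℝ u (linX η (G.B s) x y) + inner ℝ v (linY η (G.B s) x y))
      (inner ℝ u (G.meanX η x y) + inner ℝ v (G.meanY η x y)) := by
  refine HasMean.congr ((((hasMean_const (inner ℝ u x)).sub ((hB.mean_B u y).const_mul η)).sub
    ((hB.mean_BBt u x).const_mul (η ^ 2))).add (((hasMean_const (inner ℝ v y)).add
      ((hB.mean_Bt v x).const_mul η)).sub ((hB.mean_BtB v y).const_mul (η ^ 2))))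
    (fun s => ?_) ?_ <;>
  simp only [linX, linY, Game.meanX, Game.meanY, inner_sub_right, inner_add_right,
    inner_smul_right]

lemma AssumptionB.mean_norm_sq_lin (hB : AssumptionB G σB σB2) (η : ℝ) (x y : Vec n) :
    HasMean G.P (fun s => ‖linX η (G.B s) x y‖ ^ 2 + ‖linY η (G.B s) x y‖ ^ 2)
      (‖x‖ ^ 2 + ‖y‖ ^ 2 - η ^ 2 * (inner ℝ x (act G.M x) + inner ℝ y (act G.Mhat y))
      + η ^ 4 * (inner ℝ x (act (matE G.P fun s => (G.B s * (G.B s).transpose) ^ 2) x)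
        + inner ℝ y (act (matE G.P fun s => ((G.B s).transpose * G.B s) ^ 2) y))) :=
  (((hasMean_const _).sub (((hB.mean_BBt x x).add (hB.mean_BtB y y)).const_mul (η ^ 2))).add
    (((hB.mean_BBt_sq x).add (hB.mean_BtB_sq y)).const_mul (η ^ 4))).congr
    (fun s => norm_sq_lin η (G.B s) x y) rfl

/-- In the mean, the linear part contracts the squared norm by `1 - η² μ / 2`. -/
lemma AssumptionB.exists_mean_norm_sq_lin_le (hB : AssumptionB G σB σB2) {η : ℝ}
    (hη : η ^ 2 * G.rho ≤ 1 / 2) (x y : Vec n) :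
    ∃ a, HasMean G.P (fun s => ‖linX η (G.B s) x y‖ ^ 2 + ‖linY η (G.B s) x y‖ ^ 2) a ∧
      a ≤ (1 - η ^ 2 * G.mu / 2) * (‖x‖ ^ 2 + ‖y‖ ^ 2) := by
  refine ⟨_, hB.mean_norm_sq_lin η x y, ?_⟩
  have h1 := hB.BBt_sq_le x
  have h2 := hB.BtB_sq_le y
  have h3 := G.mu_mul_le_M x
  have h4 := G.mu_mul_le_Mhat y
  set a := inner ℝ x (act G.M x)
  set b := inner ℝ y (act G.Mhat y)
  have ha : 0 ≤ a := (mul_nonneg hB.mu_pos.le (by positivity)).trans h3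
  have hb : 0 ≤ b := (mul_nonneg hB.mu_pos.le (by positivity)).trans h4
  have h5 := mul_le_mul_of_nonneg_left (add_le_add h1 h2) (show 0 ≤ η ^ 4 by positivity)
  -- The step-size condition charges at most half of the quadratic decrease to the quartic term;
  -- this is the `1/2` in the rate.
  have h6 := mul_le_mul_of_nonneg_left hη (show 0 ≤ η ^ 2 * (a + b) by positivity)
  have h7 := mul_le_mul_of_nonneg_left (add_le_add h3 h4) (show 0 ≤ η ^ 2 by positivity)
  nlinarith

/-- The norm of a mean is at most the root mean square, and the latter contracts. -/
lemma AssumptionB.norm_sq_mean_le (hB : AssumptionB G σB σB2) {η : ℝ}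
    (hη : η ^ 2 * G.rho ≤ 1 / 2) (x y : Vec n) :
    ‖G.meanX η x y‖ ^ 2 + ‖G.meanY η x y‖ ^ 2 ≤ ‖x‖ ^ 2 + ‖y‖ ^ 2 := by
  obtain ⟨a, ha, hle⟩ := hB.exists_mean_norm_sq_lin_le hη x y
  have h := (ha.sub ((hB.mean_inner_lin η (G.meanX η x y) (G.meanY η x y) x y).const_mul 2)).add
    (hasMean_const (‖G.meanX η x y‖ ^ 2 + ‖G.meanY η x y‖ ^ 2))
  have h0 := h.nonneg fun s => by
    have h1 := norm_sub_sq_real (G.meanX η x y) (linX η (G.B s) x y)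
    have h2 := norm_sub_sq_real (G.meanY η x y) (linY η (G.B s) x y)
    nlinarith [sq_nonneg ‖G.meanX η x y - linX η (G.B s) x y‖,
      sq_nonneg ‖G.meanY η x y - linY η (G.B s) x y‖]
  rw [real_inner_self_eq_norm_sq, real_inner_self_eq_norm_sq] at h0
  have : 0 ≤ η ^ 2 * G.mu / 2 * (‖x‖ ^ 2 + ‖y‖ ^ 2) := by
    have := hB.mu_pos; positivity
  nlinarith

/-- Variance of the linear part. -/
lemma AssumptionB.exists_mean_norm_sq_lin_sub_le (hB : AssumptionB G σB σB2) (η : ℝ)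
    (x y : Vec n) :
    ∃ a, HasMean G.P (fun s => ‖linX η (G.B s) x y - G.meanX η x y‖ ^ 2
        + ‖linY η (G.B s) x y - G.meanY η x y‖ ^ 2) a ∧
      a ≤ 2 * η ^ 2 * noiseB σB σB2 η * (‖x‖ ^ 2 + ‖y‖ ^ 2) := by
  have hm : HasMean G.P (fun s => ‖linX η (G.B s) x y - G.meanX η x y‖ ^ 2
        + ‖linY η (G.B s) x y - G.meanY η x y‖ ^ 2) _ :=
    (((hB.mean_norm_sq_lin η x y).sub ((hB.mean_inner_lin η (G.meanX η x y) (G.meanY η x y)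
      x y).const_mul 2)).add
      (hasMean_const (‖G.meanX η x y‖ ^ 2 + ‖G.meanY η x y‖ ^ 2))).congr (fun s => by
        rw [norm_sub_sq_real, norm_sub_sq_real, real_inner_comm,
          real_inner_comm (G.meanY η x y)]
        ring) rfl
  refine ⟨_, hm, ?_⟩
  have hc : EntryMemLp (fun s => G.B s - G.meanB) 2 G.P :=
    hB.entry_B_two.sub (entryMemLp_const _ _)
  have hc1 : EntryMemLp (fun s => G.B s * (G.B s).transpose - G.M) 2 G.P :=
    hB.entry_BBt.sub (entryMemLp_const _ _)
  have hc2 : EntryMemLp (fun s => (G.B s).transpose * G.B s - G.Mhat) 2 G.P :=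
    hB.entry_BtB.sub (entryMemLp_const _ _)
  have e1 := (hc.transpose.mul (r := 1) hc).hasMean_inner_act y y
  have e2 := (hc.mul (r := 1) hc.transpose).hasMean_inner_act x x
  have e3 : HasMean G.P _ _ := EntryMemLp.hasMean_inner_act (P := G.P)
    (X := fun s => (G.B s * (G.B s).transpose - G.M) ^ 2)
    (by simp only [sq]; exact hc1.mul (r := 1) hc1) x x
  have e4 : HasMean G.P _ _ := EntryMemLp.hasMean_inner_act (P := G.P)
    (X := fun s => ((G.B s).transpose * G.B s - G.Mhat) ^ 2)
    (by simp only [sq]; exact hc2.mul (r := 1) hc2) y y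
  have hle := hm.mono (((e1.add e2).const_mul (2 * η ^ 2)).add
    ((e3.add e4).const_mul (2 * η ^ 4))) fun s => by
    rw [← norm_sq_act, ← norm_sq_act_transpose]
    have hs1 : (G.B s * (G.B s).transpose - G.M).transpose = G.B s * (G.B s).transpose - G.M := by
      rw [Matrix.transpose_sub, G.M_transpose]; simp
    have hs2 : ((G.B s).transpose * G.B s - G.Mhat).transpose
        = (G.B s).transpose * G.B s - G.Mhat := by
      rw [Matrix.transpose_sub, G.Mhat_transpose]; simp
    have q1 := norm_sq_act (G.B s * (G.B s).transpose - G.M) x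
    have q2 := norm_sq_act ((G.B s).transpose * G.B s - G.Mhat) y
    rw [hs1, ← sq] at q1
    rw [hs2, ← sq] at q2
    rw [← q1, ← q2]
    have r1 : linX η (G.B s) x y - G.meanX η x y
        = -(η • act (G.B s - G.meanB) y) - η ^ 2 • act (G.B s * (G.B s).transpose - G.M) x := by
      simp only [linX, Game.meanX, sub_act, mul_act]; module
    have r2 : linY η (G.B s) x y - G.meanY η x y
        = η • act (G.B s - G.meanB).transpose x
          - η ^ 2 • act ((G.B s).transpose * G.B s - G.Mhat) y := by
      simp only [linY, Game.meanY, Matrix.transpose_sub, sub_act, mul_act]; module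
    -- The deviation splits into an order `η` part from `B_ξ - B` and an order `η²` part from the
    -- quadratic products. Separating them costs the factor `2` in the multiplicative variance.
    have key : ∀ u v : Vec n, ‖u - v‖ ^ 2 ≤ 2 * ‖u‖ ^ 2 + 2 * ‖v‖ ^ 2 := fun u v => by
      have := norm_sub_sq_real u v
      have := norm_add_sq_real u v
      nlinarith [sq_nonneg ‖u + v‖]
    rw [r1, r2]
    have k1 := key (-(η • act (G.B s - G.meanB) y))
      (η ^ 2 • act (G.B s * (G.B s).transpose - G.M) x)
    have k2 := key (η • act (G.B s - G.meanB).transpose x)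
      (η ^ 2 • act ((G.B s).transpose * G.B s - G.Mhat) y)
    simp only [norm_neg, norm_smul, mul_pow, Real.norm_eq_abs, sq_abs] at k1 k2
    linarith
  have b1 := inner_act_le_of_opNorm_le hB.var_left y
  have b2 := inner_act_le_of_opNorm_le hB.var_right x
  have b3 := inner_act_le_of_opNorm_le hB.var2_right x
  have b4 := inner_act_le_of_opNorm_le hB.var2_left y
  refine hle.trans ?_
  have c1 := mul_le_mul_of_nonneg_left (add_le_add b1 b2) (show 0 ≤ 2 * η ^ 2 by positivity)
  have c2 := mul_le_mul_of_nonneg_left (add_le_add b3 b4) (show 0 ≤ 2 * η ^ 4 by positivity)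
  refine (add_le_add c1 c2).trans (le_of_eq ?_)
  rw [noiseB]; ring

lemma AssumptionG.entryIndep (hg : AssumptionG G σg) {φ : (Fin n × Fin n → ℝ) → Mat n}
    (hφ : ∀ i j, Measurable fun p => φ p i j) :
    EntryIndep (fun s => φ fun p => G.B s p.1 p.2) (fun s => (G.gx s, G.gy s)) G.P :=
  fun i j => hg.indep.comp (φ := fun p => φ p i j) (hφ i j) measurable_id

lemma EntryIndep.fst {P : Measure Ξ} {X : Ξ → Mat n} {g h : Ξ → Vec n}
    (hX : EntryIndep X (fun s => (g s, h s)) P) : EntryIndep X g P :=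
  fun i j => (hX i j).comp measurable_id measurable_fst

lemma EntryIndep.snd {P : Measure Ξ} {X : Ξ → Mat n} {g h : Ξ → Vec n}
    (hX : EntryIndep X (fun s => (g s, h s)) P) : EntryIndep X h P :=
  fun i j => (hX i j).comp measurable_id measurable_snd

lemma AssumptionG.indep_one (hg : AssumptionG G σg) :
    EntryIndep (fun _ => (1 : Mat n)) (fun s => (G.gx s, G.gy s)) G.P :=
  hg.entryIndep (φ := fun _ => 1) fun _ _ => measurable_const

lemma AssumptionG.indep_B (hg : AssumptionG G σg) :
    EntryIndep G.B (fun s => (G.gx s, G.gy s)) G.P :=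
  hg.entryIndep (φ := fun p => Matrix.of fun i j => p (i, j)) fun i j => by
    simp only [Matrix.of_apply]; fun_prop

lemma AssumptionG.indep_Bt (hg : AssumptionG G σg) :
    EntryIndep (fun s => (G.B s).transpose) (fun s => (G.gx s, G.gy s)) G.P :=
  fun i j => hg.indep_B j i

lemma AssumptionG.indep_BBt (hg : AssumptionG G σg) :
    EntryIndep (fun s => G.B s * (G.B s).transpose) (fun s => (G.gx s, G.gy s)) G.P :=
  hg.entryIndep (φ := fun p => (Matrix.of fun i j => p (i, j)) *
    (Matrix.of fun i j => p (i, j)).transpose) fun i j => by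
    simp only [Matrix.mul_apply, Matrix.transpose_apply, Matrix.of_apply]; fun_prop

lemma AssumptionG.indep_BtB (hg : AssumptionG G σg) :
    EntryIndep (fun s => (G.B s).transpose * G.B s) (fun s => (G.gx s, G.gy s)) G.P :=
  hg.entryIndep (φ := fun p => (Matrix.of fun i j => p (i, j)).transpose *
    (Matrix.of fun i j => p (i, j))) fun i j => by
    simp only [Matrix.mul_apply, Matrix.transpose_apply, Matrix.of_apply]; fun_prop

lemma AssumptionG.indep_BBtB (hg : AssumptionG G σg) :
    EntryIndep (fun s => G.B s * (G.B s).transpose * G.B s) (fun s => (G.gx s, G.gy s)) G.P :=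
  hg.entryIndep (φ := fun p => (Matrix.of fun i j => p (i, j)) *
    (Matrix.of fun i j => p (i, j)).transpose * (Matrix.of fun i j => p (i, j))) fun i j => by
    simp only [Matrix.mul_apply, Matrix.transpose_apply, Matrix.of_apply]; fun_prop

lemma AssumptionG.indep_BtBBt (hg : AssumptionG G σg) :
    EntryIndep (fun s => (G.B s).transpose * G.B s * (G.B s).transpose)
      (fun s => (G.gx s, G.gy s)) G.P :=
  hg.entryIndep (φ := fun p => (Matrix.of fun i j => p (i, j)).transpose *
    (Matrix.of fun i j => p (i, j)) * (Matrix.of fun i j => p (i, j)).transpose) fun i j => by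
    simp only [Matrix.mul_apply, Matrix.transpose_apply, Matrix.of_apply]; fun_prop

lemma AssumptionG.mean_gx_act (hg : AssumptionG G σg) {X : Ξ → Mat n} (hX : EntryMemLp X 1 G.P)
    (hi : EntryIndep X (fun s => (G.gx s, G.gy s)) G.P) (x : Vec n) :
    HasMean G.P (fun s => inner ℝ x (act (X s) (G.gx s))) 0 :=
  hX.hasMean_inner_act_indep hi.fst (hg.memLp_gx.integrable (by norm_num)) hg.mean_gx x

lemma AssumptionG.mean_gy_act (hg : AssumptionG G σg) {X : Ξ → Mat n} (hX : EntryMemLp X 1 G.P)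
    (hi : EntryIndep X (fun s => (G.gx s, G.gy s)) G.P) (x : Vec n) :
    HasMean G.P (fun s => inner ℝ x (act (X s) (G.gy s))) 0 :=
  hX.hasMean_inner_act_indep hi.snd (hg.memLp_gy.integrable (by norm_num)) hg.mean_gy x

lemma AssumptionG.mean_inner_gx (hg : AssumptionG G σg) (x : Vec n) :
    HasMean G.P (fun s => inner ℝ x (G.gx s)) 0 :=
  (hg.mean_gx_act (entryMemLp_const _ _) hg.indep_one x).congr (fun s => by rw [one_act]) rfl

lemma AssumptionG.mean_inner_gy (hg : AssumptionG G σg) (x : Vec n) :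
    HasMean G.P (fun s => inner ℝ x (G.gy s)) 0 :=
  (hg.mean_gy_act (entryMemLp_const _ _) hg.indep_one x).congr (fun s => by rw [one_act]) rfl

lemma mean_inner_noise (hB : AssumptionB G σB σB2) (hg : AssumptionG G σg) (η : ℝ)
    (x y : Vec n) :
    HasMean G.P (fun s => inner ℝ x (noiseX η (G.B s) (G.gx s) (G.gy s))
      + inner ℝ y (noiseY η (G.B s) (G.gx s) (G.gy s))) 0 :=
  (((((hg.mean_inner_gy y).const_mul η).sub ((hg.mean_inner_gx x).const_mul η)).sub
    ((hg.mean_gy_act hB.entry_B_one hg.indep_B x).const_mul (η ^ 2))).sub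
    ((hg.mean_gx_act hB.entry_B_one.transpose hg.indep_Bt y).const_mul (η ^ 2))).congr
    (fun s => inner_noise _ _ _ _ _ _) (by ring)

lemma mean_inner_lin_noise (hB : AssumptionB G σB σB2) (hg : AssumptionG G σg) (η : ℝ)
    (x y : Vec n) :
    HasMean G.P (fun s => inner ℝ (linX η (G.B s) x y) (noiseX η (G.B s) (G.gx s) (G.gy s))
      + inner ℝ (linY η (G.B s) x y) (noiseY η (G.B s) (G.gx s) (G.gy s))) 0 :=
  (((((hg.mean_inner_gy y).const_mul η).sub ((hg.mean_inner_gx x).const_mul η)).add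
    ((hg.mean_gy_act hB.entry_BBtB hg.indep_BBtB x).const_mul (η ^ 4))).add
    ((hg.mean_gx_act hB.entry_BtBBt hg.indep_BtBBt y).const_mul (η ^ 4))).congr
    (fun s => inner_lin_noise _ _ _ _ _ _) (by ring)

lemma AssumptionG.mean_norm_sq (hg : AssumptionG G σg) :
    HasMean G.P (fun s => ‖G.gx s‖ ^ 2 + ‖G.gy s‖ ^ 2)
      (∫ s, (‖G.gx s‖ ^ 2 + ‖G.gy s‖ ^ 2) ∂G.P) :=
  ⟨((memLp_two_iff_integrable_sq_norm hg.memLp_gx.1).1 hg.memLp_gx).add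
    ((memLp_two_iff_integrable_sq_norm hg.memLp_gy.1).1 hg.memLp_gy), rfl⟩

lemma integrable_inner_act_self {P : Measure Ξ} {g : Ξ → Vec n} (hg : MemLp g 2 P) (A : Mat n) :
    Integrable (fun s => inner ℝ (g s) (act A (g s))) P :=
  L2.integrable_inner (𝕜 := ℝ) hg.toLp ((Matrix.toEuclideanCLM (n := Fin n) (𝕜 := ℝ) A).comp_memLp' hg).toLp
    |>.congr (by
      filter_upwards [hg.coeFn_toLp,
        ((Matrix.toEuclideanCLM (n := Fin n) (𝕜 := ℝ) A).comp_memLp' hg).coeFn_toLp] with s h1 h2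
      rw [h1, h2]; rfl)

/-- Independence replaces `B_ξ B_ξᵀ` and `B_ξᵀ B_ξ` by `M` and `M̂`, both at most `ρ`; the constant
is `1 + η²ρ ≤ 3/2`. -/
lemma exists_mean_norm_sq_noise_le (hB : AssumptionB G σB σB2) (hg : AssumptionG G σg) {η : ℝ}
    (hη : η ^ 2 * G.rho ≤ 1 / 2) :
    ∃ a, HasMean G.P (fun s => ‖noiseX η (G.B s) (G.gx s) (G.gy s)‖ ^ 2
      + ‖noiseY η (G.B s) (G.gx s) (G.gy s)‖ ^ 2) a ∧ a ≤ 3 / 2 * η ^ 2 * σg ^ 2 := by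
  refine ⟨_, ((hg.mean_norm_sq.const_mul (η ^ 2)).add
    (((hB.entry_BBt_one.hasMean_quadratic_indep hg.indep_BBt.fst hg.memLp_gx).add
      (hB.entry_BtB_one.hasMean_quadratic_indep hg.indep_BtB.snd hg.memLp_gy)).const_mul
      (η ^ 4))).congr (fun s => norm_sq_noise _ _ _ _) rfl, ?_⟩
  have h1 : HasMean G.P _ _ := ⟨integrable_inner_act_self hg.memLp_gx G.M, rfl⟩
  have h2 : HasMean G.P _ _ := ⟨integrable_inner_act_self hg.memLp_gy G.Mhat, rfl⟩
  have h3 := (h1.add h2).mono (hg.mean_norm_sq.const_mul G.rho) fun s => by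
    have := hB.M_le (G.gx s)
    have := hB.Mhat_le (G.gy s)
    linarith
  have hs := hg.second_moment
  set m := ∫ s, (‖G.gx s‖ ^ 2 + ‖G.gy s‖ ^ 2) ∂G.P
  have hm : 0 ≤ m := integral_nonneg fun s => by positivity
  have h4 := mul_le_mul_of_nonneg_left h3 (show 0 ≤ η ^ 4 by positivity)
  have h5 := mul_le_mul_of_nonneg_left hη (show 0 ≤ η ^ 2 * m by positivity)
  have h6 := mul_le_mul_of_nonneg_left hs (show 0 ≤ η ^ 2 by positivity)
  refine (add_le_add_right h4 _).trans ?_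
  nlinarith

end StepMoments

/-- A random affine-type step `f` on a Hilbert space whose mean is the linear map `A`, with
contraction rate `θ`, additive variance `v`, multiplicative variance `w` and coercivity constant
`κ` of `1 - A`. -/
structure IsStep {Ξ H : Type*} [MeasurableSpace Ξ] [NormedAddCommGroup H] [InnerProductSpace ℝ H]
    [MeasurableSpace H] (P : Measure Ξ) (f : Ξ → H → H) (A : H →ₗ[ℝ] H) (θ v w κ : ℝ) :
    Prop where
  measurable : Measurable fun p : H × Ξ => f p.2 p.1
  sq : ∀ z, ∃ a, HasMean P (fun s => ‖f s z‖ ^ 2) a ∧ a ≤ (1 - θ) * ‖z‖ ^ 2 + v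
  mean : ∀ u z, HasMean P (fun s => inner ℝ u (f s z)) (inner ℝ u (A z))
  var : ∀ z, ∃ a, HasMean P (fun s => ‖f s z - A z‖ ^ 2) a ∧ a ≤ w * ‖z‖ ^ 2 + v
  contr : ∀ z, ‖A z‖ ^ 2 ≤ ‖z‖ ^ 2
  coercive : ∀ z, κ * ‖z‖ ^ 2 ≤ ‖z - A z‖ ^ 2
  θ_pos : 0 < θ
  θ_le : θ ≤ 1
  v_nonneg : 0 ≤ v
  w_nonneg : 0 ≤ w
  κ_pos : 0 < κ
  κ_le : κ ≤ 1 / 2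

/-! ### The extragradient step as a random step on the joint space. -/

section JointStep

variable {n : ℕ} {Ξ : Type*} [MeasurableSpace Ξ] {G : Game n Ξ} {σB σB2 σg : ℝ}

/-- The joint space of both players. -/
abbrev Pair (n : ℕ) := WithLp 2 (Vec n × Vec n)

/-- One extragradient step on the joint space. -/
def Game.step (G : Game n Ξ) (η : ℝ) (s : Ξ) (z : Pair n) : Pair n :=
  WithLp.toLp 2 (segStep η (G.B s) (G.gx s) (G.gy s) (z.fst, z.snd))

/-- Mean of the extragradient step on the joint space. -/
def Game.meanStep (G : Game n Ξ) (η : ℝ) : Pair n →ₗ[ℝ] Pair n where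
  toFun z := WithLp.toLp 2 (G.meanX η z.fst z.snd, G.meanY η z.fst z.snd)
  map_add' z z' := by
    apply WithLp.ofLp_injective
    ext1 <;> simp only [Game.meanX, Game.meanY, WithLp.add_fst, WithLp.add_snd, act_add,
      WithLp.ofLp_add, Prod.fst_add, Prod.snd_add] <;> module
  map_smul' c z := by
    apply WithLp.ofLp_injective
    ext1 <;> simp only [Game.meanX, Game.meanY, WithLp.smul_fst, WithLp.smul_snd, act_smul,
      WithLp.ofLp_smul, Prod.smul_fst, Prod.smul_snd, RingHom.id_apply] <;> module

lemma Game.step_eq (G : Game n Ξ) (η : ℝ) (s : Ξ) (z : Pair n) :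
    G.step η s z = WithLp.toLp 2
      (linX η (G.B s) z.fst z.snd + noiseX η (G.B s) (G.gx s) (G.gy s),
        linY η (G.B s) z.fst z.snd + noiseY η (G.B s) (G.gx s) (G.gy s)) := by
  rw [Game.step, segStep_eq]

lemma norm_sq_toLp (a b : Vec n) : ‖(WithLp.toLp 2 (a, b) : Pair n)‖ ^ 2 = ‖a‖ ^ 2 + ‖b‖ ^ 2 :=
  WithLp.prod_norm_sq_eq_of_L2 _

lemma inner_toLp (u : Pair n) (a b : Vec n) :
    inner ℝ u (WithLp.toLp 2 (a, b)) = inner ℝ u.fst a + inner ℝ u.snd b :=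
  WithLp.prod_inner_apply _ _

lemma measurable_act {β : Type*} [MeasurableSpace β] {X : β → Mat n} {g : β → Vec n}
    (hX : ∀ i j, Measurable fun b => X b i j) (hg : Measurable g) :
    Measurable fun b => act (X b) (g b) := by
  have : (fun b => act (X b) (g b)) = fun b => WithLp.toLp 2 fun i => ∑ j, X b i j * g b j := by
    funext b; ext i; rw [act_apply]
  rw [this]
  refine (WithLp.measurable_toLp 2 _).comp (measurable_pi_lambda _ fun i => ?_)
  exact Finset.measurable_sum _ fun j _ => (hX i j).mul (by fun_prop)

lemma measurable_step (hB : AssumptionB G σB σB2) (hg : AssumptionG G σg) (η : ℝ) :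
    Measurable fun p : Pair n × Ξ => G.step η p.2 p.1 := by
  have hb : ∀ i j, Measurable fun p : Pair n × Ξ => G.B p.2 i j := fun i j =>
    (hB.measurable_B i j).comp measurable_snd
  have hbt : ∀ i j, Measurable fun p : Pair n × Ξ => (G.B p.2).transpose i j := fun i j => hb j i
  have hx : Measurable fun p : Pair n × Ξ => p.1.fst :=
    measurable_fst.comp ((WithLp.measurable_ofLp 2 _).comp measurable_fst)
  have hy : Measurable fun p : Pair n × Ξ => p.1.snd :=
    measurable_snd.comp ((WithLp.measurable_ofLp 2 _).comp measurable_fst)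
  have hgx : Measurable fun p : Pair n × Ξ => G.gx p.2 := hg.measurable_gx.comp measurable_snd
  have hgy : Measurable fun p : Pair n × Ξ => G.gy p.2 := hg.measurable_gy.comp measurable_snd
  refine (WithLp.measurable_toLp 2 _).comp (Measurable.prodMk ?_ ?_)
  · exact hx.sub (((measurable_act hb
      (hy.add (((measurable_act hbt hx).add hgy).const_smul η))).add hgx).const_smul η)
  · exact hy.add (((measurable_act hbt
      (hx.sub (((measurable_act hb hy).add hgx).const_smul η))).add hgy).const_smul η)

variable [IsProbabilityMeasure G.P]

/-- The mean field `z ↦ z - E f(z)` is coercive when the step size is at most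
`α λ / (2 σ_B² √λ_max(Bᵀ B))`. -/
lemma AssumptionB.coercive (hB : AssumptionB G σB σB2) (hns : IsUnit G.meanB) {η α : ℝ}
    (hη : 0 ≤ η)
    (hcap : 2 * σB ^ 2 * √(lamMax (G.meanB.transpose * G.meanB)) * η ≤ α * G.lam)
    (x y : Vec n) :
    (1 - α) * η ^ 2 * G.lam * (‖x‖ ^ 2 + ‖y‖ ^ 2)
      ≤ ‖x - G.meanX η x y‖ ^ 2 + ‖y - G.meanY η x y‖ ^ 2 := by
  have e1 : x - G.meanX η x y = η • act G.meanB y + η ^ 2 • act G.M x := by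
    rw [Game.meanX]; module
  have e2 : y - G.meanY η x y = η ^ 2 • act G.Mhat y - η • act G.meanB.transpose x := by
    rw [Game.meanY]; module
  have l1 := G.lam_mul_le_transpose x
  have l2 := Game.lam_mul_le hns y
  have c1 := hB.abs_inner_M_sub_le (act G.meanB y) x
  have c2 := hB.abs_inner_Mhat_sub_le (act G.meanB.transpose x) y
  have e3 : inner ℝ (act G.meanB.transpose (act G.meanB y)) (act G.meanB.transpose x)
      = inner ℝ (act G.meanB (act G.meanB.transpose x)) (act G.meanB y) := by
    rw [real_inner_comm, inner_act_transpose]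
  rw [e3] at c1
  have n1 := norm_sq_act_le G.meanB y
  have n2 := norm_sq_act_transpose_le G.meanB x
  have hl := hB.lamMax_pos
  set L := lamMax (G.meanB.transpose * G.meanB)
  have s1 : ‖act G.meanB y‖ ≤ √L * ‖y‖ := by
    refine abs_le_of_sq_le_sq' ?_ (by positivity) |>.2
    rw [mul_pow, Real.sq_sqrt hl.le]; exact n1
  have s2 : ‖act G.meanB.transpose x‖ ≤ √L * ‖x‖ := by
    refine abs_le_of_sq_le_sq' ?_ (by positivity) |>.2
    rw [mul_pow, Real.sq_sqrt hl.le]; exact n2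
  rw [e1, e2, norm_add_sq_real, norm_sub_sq_real]
  simp only [inner_smul_left, inner_smul_right, norm_smul, mul_pow, conj_trivial,
    Real.norm_eq_abs, sq_abs]
  rw [real_inner_comm (act G.meanB.transpose x) (act G.Mhat y)]
  set p := inner ℝ (act G.meanB y) (act G.M x)
  set q := inner ℝ (act G.meanB.transpose x) (act G.Mhat y)
  set r := inner ℝ (act G.meanB (act G.meanB.transpose x)) (act G.meanB y)
  -- In `p - q` the contributions of `BBᵀ` to `M` and of `BᵀB` to `M̂` are both equal to `r` and
  -- cancel, so only the variances remain, each of size `σ_B² √L ‖x‖ ‖y‖`.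
  have t1 : -(σB ^ 2 * √L * (‖x‖ ^ 2 + ‖y‖ ^ 2)) ≤ p - q := by
    have := (abs_le.1 c1).1
    have := (abs_le.1 c2).2
    have u1 := mul_le_mul_of_nonneg_left s1 (show 0 ≤ σB ^ 2 * ‖x‖ by positivity)
    have u2 := mul_le_mul_of_nonneg_left s2 (show 0 ≤ σB ^ 2 * ‖y‖ by positivity)
    have u3 : 0 ≤ σB ^ 2 * √L * (‖x‖ - ‖y‖) ^ 2 := by positivity
    nlinarith
  have t2 := mul_le_mul_of_nonneg_left t1 (show 0 ≤ 2 * η ^ 3 by positivity)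
  -- The cap on the step size makes the cross term at most the fraction `α` of the main term,
  -- leaving `1 - α`.
  have t3 := mul_le_mul_of_nonneg_left hcap
    (show 0 ≤ η ^ 2 * (‖x‖ ^ 2 + ‖y‖ ^ 2) by positivity)
  have t4 := mul_le_mul_of_nonneg_left (add_le_add l1 l2) (show 0 ≤ η ^ 2 by positivity)
  have t5 : 0 ≤ (η ^ 2) ^ 2 * ‖act G.M x‖ ^ 2 := by positivity
  have t6 : 0 ≤ (η ^ 2) ^ 2 * ‖act G.Mhat y‖ ^ 2 := by positivity
  nlinarith

lemma HasMean.inner_step (hB : AssumptionB G σB σB2) (hg : AssumptionG G σg) (η : ℝ)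
    (u z : Pair n) :
    HasMean G.P (fun s => inner ℝ u (G.step η s z)) (inner ℝ u (G.meanStep η z)) :=
  ((hB.mean_inner_lin η u.fst u.snd z.fst z.snd).add
    (mean_inner_noise hB hg η u.fst u.snd)).congr (fun s => by
      rw [G.step_eq, inner_toLp]
      simp only [inner_add_right]
      ring) (by rw [add_zero]; exact inner_toLp _ _ _)

theorem isStep (hB : AssumptionB G σB σB2) (hg : AssumptionG G σg)
    (hns : IsUnit G.meanB) {η α : ℝ} (hη : 0 < η) (hα0 : 0 < α) (hα1 : α < 1)
    (hρ : η ^ 2 * G.rho ≤ 1 / 2)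
    (hcap : 2 * σB ^ 2 * √(lamMax (G.meanB.transpose * G.meanB)) * η ≤ α * G.lam) :
    IsStep G.P (G.step η) (G.meanStep η) (η ^ 2 * G.mu / 2) (3 / 2 * η ^ 2 * σg ^ 2)
      (2 * η ^ 2 * noiseB σB σB2 η) ((1 - α) * η ^ 2 * G.lam) where
  measurable := measurable_step hB hg η
  sq z := by
    obtain ⟨a, ha, hale⟩ := hB.exists_mean_norm_sq_lin_le hρ z.fst z.snd
    obtain ⟨b, hb, hble⟩ := exists_mean_norm_sq_noise_le hB hg hρ
    refine ⟨_, ((ha.add ((mean_inner_lin_noise hB hg η z.fst z.snd).const_mul 2)).add hb).congr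
      (fun s => ?_) rfl, ?_⟩
    · rw [G.step_eq, norm_sq_toLp, norm_add_sq_real, norm_add_sq_real]
      ring
    · rw [WithLp.prod_norm_sq_eq_of_L2]; linarith
  mean u z := HasMean.inner_step hB hg η u z
  var z := by
    obtain ⟨a, ha, hale⟩ := hB.exists_mean_norm_sq_lin_sub_le η z.fst z.snd
    obtain ⟨b, hb, hble⟩ := exists_mean_norm_sq_noise_le hB hg hρ
    refine ⟨_, ((ha.add (((mean_inner_lin_noise hB hg η z.fst z.snd).sub
      (mean_inner_noise hB hg η (G.meanX η z.fst z.snd) (G.meanY η z.fst z.snd))).const_mul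
      2)).add hb).congr (fun s => ?_) rfl, ?_⟩
    · rw [G.step_eq]
      change ‖(WithLp.toLp 2 (_ + _ - G.meanX η z.fst z.snd, _ + _ - G.meanY η z.fst z.snd)
        : Pair n)‖ ^ 2 = _
      rw [norm_sq_toLp, add_sub_right_comm, add_sub_right_comm,
        norm_add_sq_real, norm_add_sq_real, inner_sub_left, inner_sub_left]
      ring
    · rw [WithLp.prod_norm_sq_eq_of_L2]; linarith
  contr z := by
    rw [WithLp.prod_norm_sq_eq_of_L2, WithLp.prod_norm_sq_eq_of_L2 z]
    exact hB.norm_sq_mean_le hρ z.fst z.snd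
  coercive z := by
    rw [WithLp.prod_norm_sq_eq_of_L2, WithLp.prod_norm_sq_eq_of_L2]
    exact hB.coercive hns hη.le hcap z.fst z.snd
  θ_pos := by have := hB.mu_pos; positivity
  θ_le := by
    have := hB.neZero
    obtain ⟨x, hx⟩ := exists_ne (0 : Vec n)
    have h1 : G.mu ≤ G.rho :=
      le_of_mul_le_mul_right ((G.mu_mul_le_M x).trans (hB.M_le x)) (by positivity)
    nlinarith [mul_le_mul_of_nonneg_left h1 (sq_nonneg η)]
  v_nonneg := by positivity
  w_nonneg := by rw [noiseB]; positivity
  κ_pos := mul_pos (mul_pos (by linarith) (by positivity)) (hB.lam_pos hns)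
  κ_le := by
    -- Since `λ ≤ ρ`, the coercivity constant is at most `η²ρ ≤ 1/2`.
    have h1 := mul_le_mul_of_nonneg_left hB.lam_le_rho (sq_nonneg η)
    have h2 : 0 < α * (η ^ 2 * G.lam) := by
      have := hB.lam_pos hns
      positivity
    nlinarith

end JointStep

/-! ### Fresh samples: integrating out a sample independent of the past. -/

section Sampling

variable {Ξ Ω : Type*} [MeasurableSpace Ξ] {m : MeasurableSpace Ω} [mΩ : MeasurableSpace Ω] {P : Measure Ξ}
  {Pr : Measure Ω}

/-- The samples `ξ t` have law `P`, are adapted to the increasing σ-algebras `ℱ (t + 1)` and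
independent of `ℱ t`. -/
structure IsSampling (ξ : ℕ → Ω → Ξ) (ℱ : ℕ → MeasurableSpace Ω) (P : Measure Ξ)
    (Pr : Measure Ω) : Prop where
  mono : Monotone ℱ
  le : ∀ t, ℱ t ≤ mΩ
  measurable : ∀ t, Measurable[ℱ (t + 1)] (ξ t)
  law : ∀ t, Pr.map (ξ t) = P
  indep : ∀ t, Indep (ℱ t) (MeasurableSpace.comap (ξ t) inferInstance) Pr

lemma IsSampling.shift {ξ : ℕ → Ω → Ξ} {ℱ : ℕ → MeasurableSpace Ω} (h : IsSampling ξ ℱ P Pr)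
    (τ : ℕ) : IsSampling (fun t => ξ (τ + t)) (fun t => ℱ (τ + t)) P Pr where
  mono _ _ hab := h.mono (by omega)
  le t := h.le _
  measurable t := h.measurable (τ + t)
  law t := h.law _
  indep t := h.indep _

lemma isSampling_of_iIndepFun [IsProbabilityMeasure Pr] {ξ : ℕ → Ω → Ξ}
    (hm : ∀ t, Measurable (ξ t)) (hlaw : ∀ t, Pr.map (ξ t) = P) (hind : iIndepFun ξ Pr) :
    IsSampling ξ (fun t => ⨆ i ∈ Set.Iio t, MeasurableSpace.comap (ξ i) inferInstance) P Pr where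
  mono _ _ hab := biSup_mono fun _ hi => lt_of_lt_of_le hi hab
  le t := iSup₂_le fun i _ => (hm i).comap_le
  measurable t := Measurable.mono (comap_measurable (ξ t))
    (le_biSup (fun i => MeasurableSpace.comap (ξ i) inferInstance)
      (Set.mem_Iio.2 (Nat.lt_succ_self t))) le_rfl
  law := hlaw
  indep t := by
    have h := indep_iSup_of_disjoint (fun i => (hm i).comap_le)
      ((iIndepFun_iff_iIndep _ _ _).1 hind) (S := Set.Iio t) (T := {t}) (by simp)
    simpa using h

variable [IsProbabilityMeasure Pr] [IsProbabilityMeasure P] {β : Type*} [MeasurableSpace β]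
  {ζ : Ω → Ξ} {U : Ω → β}

lemma map_prodMk_eq (hm : m ≤ mΩ) (hζ : Measurable ζ) (hlaw : Pr.map ζ = P)
    (hind : Indep m (MeasurableSpace.comap ζ inferInstance) Pr) (hU : Measurable[m] U) :
    Pr.map (fun ω => (U ω, ζ ω)) = (Pr.map U).prod P := by
  have hi : IndepFun U ζ Pr := (IndepFun_iff_Indep _ _ _).2
    (indep_of_indep_of_le_left hind hU.comap_le)
  rw [(indepFun_iff_map_prod_eq_prod_map_map (hU.mono hm le_rfl).aemeasurable
    hζ.aemeasurable).1 hi, hlaw]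

/-- The joint law of `U` and `ζ` is a product, so `U` can be frozen and `ζ` integrated first.
Nonnegativity of `F` makes the bound on the inner integral also give integrability. -/
lemma integral_le_of_indep (hm : m ≤ mΩ) (hζ : Measurable ζ) (hlaw : Pr.map ζ = P)
    (hind : Indep m (MeasurableSpace.comap ζ inferInstance) Pr) (hU : Measurable[m] U)
    {F : β × Ξ → ℝ} (hF : Measurable F) (hF0 : ∀ p, 0 ≤ F p) {b : β → ℝ} (hb : Measurable b)
    (hFb : ∀ u, ∃ a, HasMean P (fun s => F (u, s)) a ∧ a ≤ b u)
    (hbU : Integrable (fun ω => b (U ω)) Pr) :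
    Integrable (fun ω => F (U ω, ζ ω)) Pr ∧
      ∫ ω, F (U ω, ζ ω) ∂Pr ≤ ∫ ω, b (U ω) ∂Pr := by
  have hU' : Measurable U := hU.mono hm le_rfl
  have hmap := map_prodMk_eq hm hζ hlaw hind hU
  have : IsProbabilityMeasure (Pr.map U) := Measure.isProbabilityMeasure_map hU'.aemeasurable
  have hpair : Measurable fun ω => (U ω, ζ ω) := hU'.prodMk hζ
  have hb' : Integrable b (Pr.map U) :=
    (integrable_map_measure hb.aestronglyMeasurable hU'.aemeasurable).2 hbU
  have hle : ∀ u, ∫ s, F (u, s) ∂P ≤ b u := fun u => by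
    obtain ⟨a, ha, hle⟩ := hFb u
    rw [ha.2]; exact hle
  have hint : Integrable F ((Pr.map U).prod P) := by
    refine (integrable_prod_iff hF.aestronglyMeasurable).2 ⟨.of_forall fun u => ?_, ?_⟩
    · obtain ⟨a, ha, -⟩ := hFb u
      exact ha.1
    · refine hb'.mono' ?_ (.of_forall fun u => ?_)
      · exact (hF.norm.stronglyMeasurable.integral_prod_right (ν := P)).aestronglyMeasurable
      · rw [Real.norm_of_nonneg (integral_nonneg fun s => norm_nonneg _)]
        simp_rw [Real.norm_of_nonneg (hF0 _)]
        exact hle u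
  refine ⟨?_, ?_⟩
  · rw [← hmap] at hint
    exact (integrable_map_measure hF.aestronglyMeasurable hpair.aemeasurable).1 hint
  · calc ∫ ω, F (U ω, ζ ω) ∂Pr = ∫ p, F p ∂((Pr.map U).prod P) := by
          rw [← hmap, integral_map hpair.aemeasurable hF.aestronglyMeasurable]
      _ = ∫ u, ∫ s, F (u, s) ∂P ∂(Pr.map U) := integral_prod _ hint
      _ ≤ ∫ u, b u ∂(Pr.map U) := integral_mono hint.integral_prod_left hb' hle
      _ = ∫ ω, b (U ω) ∂Pr := integral_map hU'.aemeasurable hb.aestronglyMeasurable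

/-- Here `F` may change sign, so integrability has to be supplied before Fubini applies. -/
lemma integral_eq_zero_of_indep (hm : m ≤ mΩ) (hζ : Measurable ζ) (hlaw : Pr.map ζ = P)
    (hind : Indep m (MeasurableSpace.comap ζ inferInstance) Pr) (hU : Measurable[m] U)
    {F : β × Ξ → ℝ} (hF : Measurable F) (hF0 : ∀ u, HasMean P (fun s => F (u, s)) 0)
    (hint : Integrable (fun ω => F (U ω, ζ ω)) Pr) :
    ∫ ω, F (U ω, ζ ω) ∂Pr = 0 := by
  have hU' : Measurable U := hU.mono hm le_rfl
  have hmap := map_prodMk_eq hm hζ hlaw hind hU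
  have : IsProbabilityMeasure (Pr.map U) := Measure.isProbabilityMeasure_map hU'.aemeasurable
  have hpair : Measurable fun ω => (U ω, ζ ω) := hU'.prodMk hζ
  have hint' : Integrable F ((Pr.map U).prod P) := by
    rw [← hmap]
    exact (integrable_map_measure hF.aestronglyMeasurable hpair.aemeasurable).2 hint
  calc ∫ ω, F (U ω, ζ ω) ∂Pr = ∫ p, F p ∂((Pr.map U).prod P) := by
        rw [← hmap, integral_map hpair.aemeasurable hF.aestronglyMeasurable]
    _ = ∫ u, ∫ s, F (u, s) ∂P ∂(Pr.map U) := integral_prod _ hint'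
    _ = 0 := by simp [(hF0 _).2]

end Sampling

/-! ### One epoch of an abstract random step: the running average. -/

section Epoch

variable {Ξ Ω H : Type*} [MeasurableSpace Ξ] {m : MeasurableSpace Ω} [mΩ : MeasurableSpace Ω] {P : Measure Ξ}
  {Pr : Measure Ω} [NormedAddCommGroup H] [InnerProductSpace ℝ H] [FiniteDimensional ℝ H]
  [MeasurableSpace H] [BorelSpace H] [IsProbabilityMeasure P] [IsProbabilityMeasure Pr]
  {f : Ξ → H → H} {A : H →ₗ[ℝ] H} {θ v w κ : ℝ}

lemma norm_sq_convex_le {a b : ℝ} (ha : 0 ≤ a) (hb : 0 ≤ b) (hab : a + b = 1) (x y : H) :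
    ‖a • x + b • y‖ ^ 2 ≤ a * ‖x‖ ^ 2 + b * ‖y‖ ^ 2 := by
  have h1 := norm_add_sq_real (a • x) (b • y)
  have h2 := norm_sub_sq_real x y
  simp only [inner_smul_left, inner_smul_right, norm_smul, mul_pow, conj_trivial,
    Real.norm_eq_abs, sq_abs] at h1
  have h3 : a * b * ‖x - y‖ ^ 2
      = a * b * (‖x‖ ^ 2 + ‖y‖ ^ 2) - 2 * (a * (b * inner ℝ x y)) := by rw [h2]; ring
  have h4 : 0 ≤ a * b * ‖x - y‖ ^ 2 := by positivity
  have h5 : b = 1 - a := by linarith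
  subst h5
  nlinarith

/-- The weights `1 + 2/3` and `1 + 3/2` are tuned to epochs of length at least `5`, where `5/3 · 6/5
= 2` is the constant wanted in front of the martingale term. -/
lemma norm_add_sq_le_young (x y : H) : ‖x + y‖ ^ 2 ≤ 5 / 3 * ‖x‖ ^ 2 + 5 / 2 * ‖y‖ ^ 2 := by
  have h1 := norm_add_sq_real x y
  have h2 := real_inner_le_norm x y
  nlinarith [sq_nonneg (2 * ‖x‖ - 3 * ‖y‖)]

lemma norm_sub_sq_le_two (x y : H) : ‖x - y‖ ^ 2 ≤ 2 * (‖x‖ ^ 2 + ‖y‖ ^ 2) := by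
  have h1 := norm_add_sq_real x y
  have h2 := norm_sub_sq_real x y
  nlinarith [sq_nonneg ‖x + y‖]

lemma IsStep.measurable_mean (_ : IsStep P f A θ v w κ) : Measurable A :=
  A.continuous_of_finiteDimensional.measurable

lemma integrable_inner_of_sq {X Y : Ω → H} (hX : Measurable X) (hY : Measurable Y)
    (hX2 : Integrable (fun ω => ‖X ω‖ ^ 2) Pr) (hY2 : Integrable (fun ω => ‖Y ω‖ ^ 2) Pr) :
    Integrable (fun ω => inner ℝ (X ω) (Y ω)) Pr := by
  refine (hX2.add hY2).mono' (hX.inner hY).aestronglyMeasurable (.of_forall fun ω => ?_)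
  have := norm_inner_le_norm (𝕜 := ℝ) (X ω) (Y ω)
  simp only [Pi.add_apply]
  nlinarith [sq_nonneg (‖X ω‖ - ‖Y ω‖), sq_nonneg (‖X ω‖ + ‖Y ω‖)]

section OneStep

variable {ζ : Ω → Ξ}

lemma IsStep.integral_sq_le (hf : IsStep P f A θ v w κ) (hm : m ≤ mΩ) (hζ : Measurable ζ)
    (hlaw : Pr.map ζ = P) (hind : Indep m (MeasurableSpace.comap ζ inferInstance) Pr)
    {z : Ω → H} (hz : Measurable[m] z) (hz2 : Integrable (fun ω => ‖z ω‖ ^ 2) Pr) :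
    Integrable (fun ω => ‖f (ζ ω) (z ω)‖ ^ 2) Pr ∧
      ∫ ω, ‖f (ζ ω) (z ω)‖ ^ 2 ∂Pr ≤ (1 - θ) * ∫ ω, ‖z ω‖ ^ 2 ∂Pr + v := by
  have h := integral_le_of_indep hm hζ hlaw hind hz (F := fun p => ‖f p.2 p.1‖ ^ 2)
    (hf.measurable.norm.pow_const 2) (fun p => by positivity)
    (b := fun z => (1 - θ) * ‖z‖ ^ 2 + v) (by fun_prop) hf.sq
    ((hz2.const_mul _).add (integrable_const _))
  refine ⟨h.1, h.2.trans (le_of_eq ?_)⟩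
  rw [integral_add (hz2.const_mul _) (integrable_const _), integral_const_mul]
  simp

lemma IsStep.integral_var_le (hf : IsStep P f A θ v w κ) (hm : m ≤ mΩ) (hζ : Measurable ζ)
    (hlaw : Pr.map ζ = P) (hind : Indep m (MeasurableSpace.comap ζ inferInstance) Pr)
    {z : Ω → H} (hz : Measurable[m] z) (hz2 : Integrable (fun ω => ‖z ω‖ ^ 2) Pr) :
    Integrable (fun ω => ‖f (ζ ω) (z ω) - A (z ω)‖ ^ 2) Pr ∧
      ∫ ω, ‖f (ζ ω) (z ω) - A (z ω)‖ ^ 2 ∂Pr ≤ w * ∫ ω, ‖z ω‖ ^ 2 ∂Pr + v := by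
  have h := integral_le_of_indep hm hζ hlaw hind hz (F := fun p => ‖f p.2 p.1 - A p.1‖ ^ 2)
    ((hf.measurable.sub (hf.measurable_mean.comp measurable_fst)).norm.pow_const 2)
    (fun p => by positivity)
    (b := fun z => w * ‖z‖ ^ 2 + v) (by fun_prop) hf.var
    ((hz2.const_mul _).add (integrable_const _))
  refine ⟨h.1, h.2.trans (le_of_eq ?_)⟩
  rw [integral_add (hz2.const_mul _) (integrable_const _), integral_const_mul]
  simp

/-- The deviation of a step from its mean is orthogonal to everything determined by the past. -/
lemma IsStep.integral_inner_eq_zero (hf : IsStep P f A θ v w κ) (hm : m ≤ mΩ)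
    (hζ : Measurable ζ) (hlaw : Pr.map ζ = P)
    (hind : Indep m (MeasurableSpace.comap ζ inferInstance) Pr)
    {z N : Ω → H} (hz : Measurable[m] z) (hN : Measurable[m] N)
    (hz2 : Integrable (fun ω => ‖z ω‖ ^ 2) Pr) (hN2 : Integrable (fun ω => ‖N ω‖ ^ 2) Pr) :
    Integrable (fun ω => inner ℝ (N ω) (f (ζ ω) (z ω) - A (z ω))) Pr ∧
      ∫ ω, inner ℝ (N ω) (f (ζ ω) (z ω) - A (z ω)) ∂Pr = 0 := by
  have hmeas : Measurable fun p : H × Ξ => f p.2 p.1 - A p.1 :=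
    hf.measurable.sub (hf.measurable_mean.comp measurable_fst)
  have hint : Integrable (fun ω => inner ℝ (N ω) (f (ζ ω) (z ω) - A (z ω))) Pr :=
    integrable_inner_of_sq (hN.mono hm le_rfl)
      (hmeas.comp ((hz.mono hm le_rfl).prodMk hζ)) hN2
      (hf.integral_var_le hm hζ hlaw hind hz hz2).1
  refine ⟨hint, integral_eq_zero_of_indep hm hζ hlaw hind (hN.prodMk hz)
    (F := fun p => inner ℝ p.1.1 (f p.2 p.1.2 - A p.1.2)) ?_ (fun u => ?_) hint⟩
  · exact (measurable_fst.comp measurable_fst).inner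
      (hmeas.comp ((measurable_snd.comp measurable_fst).prodMk measurable_snd))
  · exact ((hf.mean u.1 u.2).sub (hasMean_const (inner ℝ u.1 (A u.2)))).congr
      (fun s => inner_sub_right _ _ _) (sub_self _).symm

end OneStep

variable {ξ : ℕ → Ω → Ξ} {ℱ : ℕ → MeasurableSpace Ω} {z : ℕ → Ω → H}

/-- Two bounds with different uses: the linear growth `t v` controls the boundary term of the
averaging identity, while the uniform `v / θ`, which needs the contraction, controls the
multiplicative noise. -/
lemma IsStep.process (hf : IsStep P f A θ v w κ) (hξ : IsSampling ξ ℱ P Pr)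
    (hz0 : Measurable[ℱ 0] (z 0)) (hz02 : Integrable (fun ω => ‖z 0 ω‖ ^ 2) Pr)
    (hz : ∀ t ω, z (t + 1) ω = f (ξ t ω) (z t ω)) (t : ℕ) :
    Measurable[ℱ t] (z t) ∧ Integrable (fun ω => ‖z t ω‖ ^ 2) Pr ∧
      ∫ ω, ‖z t ω‖ ^ 2 ∂Pr ≤ ∫ ω, ‖z 0 ω‖ ^ 2 ∂Pr + t * v ∧
      ∫ ω, ‖z t ω‖ ^ 2 ∂Pr ≤ ∫ ω, ‖z 0 ω‖ ^ 2 ∂Pr + v / θ := by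
  have hθ := hf.θ_pos
  have hv := hf.v_nonneg
  induction t with
  | zero => exact ⟨hz0, hz02, by simp, by simp; positivity⟩
  | succ t ih =>
    obtain ⟨h1, h2, h3, h4⟩ := ih
    have hζ : Measurable (ξ t) := (hξ.measurable t).mono (hξ.le _) le_rfl
    have hs := hf.integral_sq_le (hξ.le t) hζ (hξ.law t) (hξ.indep t) h1 h2
    have e : z (t + 1) = fun ω => f (ξ t ω) (z t ω) := funext (hz t)
    have h0 : 0 ≤ ∫ ω, ‖z t ω‖ ^ 2 ∂Pr := integral_nonneg fun _ => by positivity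
    have h00 : 0 ≤ ∫ ω, ‖z 0 ω‖ ^ 2 ∂Pr := integral_nonneg fun _ => by positivity
    rw [e]
    refine ⟨?_, hs.1, hs.2.trans ?_, hs.2.trans ?_⟩
    · exact hf.measurable.comp
        ((h1.mono (hξ.mono (Nat.le_succ t)) le_rfl).prodMk (hξ.measurable t))
    · push_cast
      nlinarith
    · have h5 := mul_le_mul_of_nonneg_left h4 (sub_nonneg.2 hf.θ_le)
      have h6 : θ * (v / θ) = v := mul_div_cancel₀ v hθ.ne'
      nlinarith

/-- Sum of the martingale differences `z (t + 1) - A (z t)`. -/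
def noiseSum (A : H →ₗ[ℝ] H) (z : ℕ → Ω → H) (t : ℕ) (ω : Ω) : H :=
  ∑ i ∈ Finset.range t, (z (i + 1) ω - A (z i ω))

/-- Martingale differences are orthogonal, so second moments add; the uniform bound on the iterates
makes each increment cost the same. -/
lemma IsStep.noiseSum_sq_le (hf : IsStep P f A θ v w κ) (hξ : IsSampling ξ ℱ P Pr)
    (hz0 : Measurable[ℱ 0] (z 0)) (hz02 : Integrable (fun ω => ‖z 0 ω‖ ^ 2) Pr)
    (hz : ∀ t ω, z (t + 1) ω = f (ξ t ω) (z t ω)) (t : ℕ) :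
    Measurable[ℱ t] (noiseSum A z t) ∧ Integrable (fun ω => ‖noiseSum A z t ω‖ ^ 2) Pr ∧
      ∫ ω, ‖noiseSum A z t ω‖ ^ 2 ∂Pr
        ≤ t * (w * (∫ ω, ‖z 0 ω‖ ^ 2 ∂Pr + v / θ) + v) := by
  induction t with
  | zero =>
    have : noiseSum A z 0 = fun _ => 0 := by funext ω; simp [noiseSum]
    rw [this]
    exact ⟨measurable_const, by simp, by simp⟩
  | succ t ih =>
    obtain ⟨h1, h2, h3⟩ := ih
    have hζ : Measurable (ξ t) := (hξ.measurable t).mono (hξ.le _) le_rfl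
    obtain ⟨p1, p2, -, p4⟩ := hf.process hξ hz0 hz02 hz t
    have hc := hf.integral_inner_eq_zero (hξ.le t) hζ (hξ.law t) (hξ.indep t) p1 h1 p2 h2
    have hv := hf.integral_var_le (hξ.le t) hζ (hξ.law t) (hξ.indep t) p1 p2
    have e : noiseSum A z (t + 1)
        = fun ω => noiseSum A z t ω + (f (ξ t ω) (z t ω) - A (z t ω)) := by
      funext ω; rw [noiseSum, Finset.sum_range_succ, hz t ω]; rfl
    have e2 : ∀ ω, ‖noiseSum A z (t + 1) ω‖ ^ 2 = ‖noiseSum A z t ω‖ ^ 2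
        + 2 * inner ℝ (noiseSum A z t ω) (f (ξ t ω) (z t ω) - A (z t ω))
        + ‖f (ξ t ω) (z t ω) - A (z t ω)‖ ^ 2 := fun ω => by
      rw [e]; exact norm_add_sq_real _ _
    refine ⟨?_, ?_, ?_⟩
    · rw [e]
      have hmono := hξ.mono (Nat.le_succ t)
      have hz' : Measurable[ℱ (t + 1)] (z t) := p1.mono hmono le_rfl
      exact (h1.mono hmono le_rfl).add
        ((hf.measurable.comp (hz'.prodMk (hξ.measurable t))).sub (hf.measurable_mean.comp hz'))
    · simp_rw [e2]
      exact (h2.add (hc.1.const_mul 2)).add hv.1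
    · simp_rw [e2]
      have hm := (HasMean.add (P := Pr) ⟨h2, rfl⟩ (HasMean.const_mul 2 hc)).add ⟨hv.1, rfl⟩
      rw [hm.2]
      push_cast
      have := mul_le_mul_of_nonneg_left p4 hf.w_nonneg
      linarith [hv.2]

/-- Second moment of the running average within one epoch. -/
theorem IsStep.average_le (hf : IsStep P f A θ v w κ) (hξ : IsSampling ξ ℱ P Pr)
    (hz0 : Measurable[ℱ 0] (z 0)) (hz02 : Integrable (fun ω => ‖z 0 ω‖ ^ 2) Pr)
    (hz : ∀ t ω, z (t + 1) ω = f (ξ t ω) (z t ω)) {zhat : ℕ → Ω → H} (h0 : zhat 0 = z 0)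
    (hs : ∀ t ω, zhat (t + 1) ω
      = ((t : ℝ) / (t + 1)) • zhat t ω + (1 / ((t : ℝ) + 1)) • z (t + 1) ω) (k : ℕ) :
    κ * ∫ ω, ‖zhat k ω‖ ^ 2 ∂Pr ≤ 16 * (∫ ω, ‖z 0 ω‖ ^ 2 ∂Pr) / ((k : ℝ) + 1) ^ 2
      + (2 * w * (∫ ω, ‖z 0 ω‖ ^ 2 ∂Pr + v / θ) + 12 * v) / ((k : ℝ) + 1) := by
  have hp := hf.process hξ hz0 hz02 hz
  set E := ∫ ω, ‖z 0 ω‖ ^ 2 ∂Pr with hE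
  have hE0 : 0 ≤ E := integral_nonneg fun _ => by positivity
  have hv := hf.v_nonneg
  have hw := hf.w_nonneg
  have hθ := hf.θ_pos
  have hκ := hf.κ_pos
  have hB : 0 ≤ E + v / θ := by positivity
  -- A crude convexity bound, needed for integrability and for short epochs.
  have hconv : ∀ t, Measurable (zhat t) ∧ Integrable (fun ω => ‖zhat t ω‖ ^ 2) Pr ∧
      ∫ ω, ‖zhat t ω‖ ^ 2 ∂Pr ≤ E + t * v := by
    intro t
    induction t with
    | zero =>
      rw [h0]
      exact ⟨hz0.mono (hξ.le 0) le_rfl, hz02, by simp [hE]⟩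
    | succ t ih =>
      obtain ⟨i1, i2, i3⟩ := ih
      obtain ⟨p1, p2, p3, -⟩ := hp (t + 1)
      have t1 : (0 : ℝ) < t + 1 := by positivity
      have hle : ∀ ω, ‖zhat (t + 1) ω‖ ^ 2
          ≤ (t : ℝ) / (t + 1) * ‖zhat t ω‖ ^ 2 + 1 / ((t : ℝ) + 1) * ‖z (t + 1) ω‖ ^ 2 :=
        fun ω => by
          rw [hs]
          exact norm_sq_convex_le (by positivity) (by positivity) (by field_simp) _ _
      have hmeas : Measurable (zhat (t + 1)) := by
        rw [show zhat (t + 1) = _ from funext (hs t)]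
        exact (i1.const_smul _).add ((p1.mono (hξ.le _) le_rfl).const_smul _)
      have hint := (i2.const_mul ((t : ℝ) / (t + 1))).add (p2.const_mul (1 / ((t : ℝ) + 1)))
      have hint' : Integrable (fun ω => ‖zhat (t + 1) ω‖ ^ 2) Pr :=
        hint.mono' (hmeas.norm.pow_const 2).aestronglyMeasurable (.of_forall fun ω => by
          rw [Real.norm_of_nonneg (by positivity)]; exact hle ω)
      refine ⟨hmeas, hint', (integral_mono hint' hint hle).trans ?_⟩
      rw [Pi.add_def, integral_add (i2.const_mul _) (p2.const_mul _), integral_const_mul,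
        integral_const_mul]
      push_cast at p3 ⊢
      have j1 := mul_le_mul_of_nonneg_left i3 (show (0 : ℝ) ≤ t / (t + 1) by positivity)
      have j2 := mul_le_mul_of_nonneg_left p3 (show (0 : ℝ) ≤ 1 / (t + 1) by positivity)
      refine (add_le_add j1 j2).trans ?_
      have : (t : ℝ) / (t + 1) * (E + t * v) + 1 / (t + 1) * (E + (t + 1) * v)
          = E + (t + 1) * v - t / (t + 1) * v := by field_simp; ring
      rw [this]
      have : 0 ≤ (t : ℝ) / (t + 1) * v := by positivity
      linarith
  obtain ⟨-, c2, c3⟩ := hconv k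
  -- For `k ≤ 4` the crude bound and `κ ≤ 1/2` suffice: `(k + 1)² ≤ 32` and `k (k + 1) ≤ 24`. From
  -- `k = 5` on, replacing `k` by `k + 1` costs at most the factor `6/5`.
  rcases lt_or_ge k 5 with hk | hk
  · have hI : 0 ≤ ∫ ω, ‖zhat k ω‖ ^ 2 ∂Pr := integral_nonneg fun _ => by positivity
    have h1 : κ * ∫ ω, ‖zhat k ω‖ ^ 2 ∂Pr ≤ 1 / 2 * (E + k * v) :=
      mul_le_mul hf.κ_le c3 hI (by norm_num)
    have h2 : (0 : ℝ) ≤ 2 * w * (E + v / θ) := by positivity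
    refine h1.trans ?_
    rw [add_div]
    have h3 : 0 ≤ 2 * w * (E + v / θ) / ((k : ℝ) + 1) := by positivity
    have h4 : 1 / 2 * E ≤ 16 * E / ((k : ℝ) + 1) ^ 2 := by
      rw [le_div_iff₀ (by positivity)]
      have : ((k : ℝ) + 1) ^ 2 ≤ 32 := by
        have : (k : ℝ) ≤ 4 := by exact_mod_cast Nat.lt_succ_iff.1 hk
        nlinarith [Nat.cast_nonneg (α := ℝ) k]
      nlinarith
    have h5 : 1 / 2 * (k * v) ≤ 12 * v / ((k : ℝ) + 1) := by
      rw [le_div_iff₀ (by positivity)]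
      have : (k : ℝ) * ((k : ℝ) + 1) ≤ 24 := by
        have : (k : ℝ) ≤ 4 := by exact_mod_cast Nat.lt_succ_iff.1 hk
        nlinarith [Nat.cast_nonneg (α := ℝ) k]
      nlinarith
    linarith
  · obtain ⟨-, n2, n3⟩ := hf.noiseSum_sq_le hξ hz0 hz02 hz k
    obtain ⟨-, p2, p3, -⟩ := hp k
    have hk5 : (5 : ℝ) ≤ k := by exact_mod_cast hk
    have hsum : ∀ (t : ℕ) ω, (t : ℝ) • zhat t ω = ∑ i ∈ Finset.range t, z (i + 1) ω := by
      intro t ω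
      induction t with
      | zero => simp
      | succ t ih =>
        have t1 : (t : ℝ) + 1 ≠ 0 := by positivity
        rw [Finset.sum_range_succ, ← ih, hs]
        push_cast
        rw [smul_add, smul_smul, smul_smul, mul_div_cancel₀ _ t1, mul_one_div_cancel t1, one_smul]
    -- The key identity: by linearity `(1 - A) Σ z_{i+1}` is the martingale sum plus `A` applied to
    -- a telescoping sum.
    have hid : ∀ ω, (k : ℝ) • zhat k ω - A ((k : ℝ) • zhat k ω)
        = noiseSum A z k ω + A (z 0 ω - z k ω) := fun ω => by
      have : z 0 ω - z k ω = ∑ i ∈ Finset.range k, (z i ω - z (i + 1) ω) :=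
        (Finset.sum_range_sub' (fun i => z i ω) k).symm
      rw [hsum, this, noiseSum, map_sum, map_sum, ← Finset.sum_sub_distrib,
        ← Finset.sum_add_distrib]
      refine Finset.sum_congr rfl fun i _ => ?_
      rw [map_sub]; abel
    have hpt : ∀ ω, κ * (k : ℝ) ^ 2 * ‖zhat k ω‖ ^ 2
        ≤ 5 / 3 * ‖noiseSum A z k ω‖ ^ 2 + 5 * (‖z 0 ω‖ ^ 2 + ‖z k ω‖ ^ 2) := fun ω => by
      have a1 := hf.coercive ((k : ℝ) • zhat k ω)
      rw [hid, norm_smul, mul_pow, Real.norm_eq_abs, sq_abs] at a1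
      have a2 := norm_add_sq_le_young (noiseSum A z k ω) (A (z 0 ω - z k ω))
      have a3 := hf.contr (z 0 ω - z k ω)
      have a4 := norm_sub_sq_le_two (z 0 ω) (z k ω)
      linarith
    have hI := integral_mono (c2.const_mul (κ * (k : ℝ) ^ 2))
      ((n2.const_mul (5 / 3)).add ((hz02.add p2).const_mul 5)) hpt
    rw [Pi.add_def, integral_add (n2.const_mul _) ((hz02.add p2).const_mul 5)] at hI
    simp only [integral_const_mul, Pi.add_apply] at hI
    rw [integral_add hz02 p2, ← hE] at hI
    set X := w * (E + v / θ) with hX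
    have hX0 : 0 ≤ X := by positivity
    have hbd : κ * ∫ ω, ‖zhat k ω‖ ^ 2 ∂Pr
        ≤ 10 * E / (k : ℝ) ^ 2 + (5 / 3 * X + 20 / 3 * v) / k := by
      have hk0 : (0 : ℝ) < k := by linarith
      rw [div_add_div _ _ (by positivity) (by positivity), le_div_iff₀ (by positivity)]
      have := mul_le_mul_of_nonneg_left (hI.trans (by linarith :
        _ ≤ 10 * E + k * (5 / 3 * X + 20 / 3 * v))) hk0.le
      nlinarith
    -- For `k ≥ 5`: `10 · (6/5)² ≤ 16`, `5/3 · 6/5 = 2` and `20/3 · 6/5 ≤ 12`.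
    refine hbd.trans (add_le_add ?_ ?_)
    · rw [div_le_div_iff₀ (by positivity) (by positivity)]
      have : 10 * ((k : ℝ) + 1) ^ 2 ≤ 16 * (k : ℝ) ^ 2 := by nlinarith
      nlinarith
    · rw [div_le_div_iff₀ (by positivity) (by positivity)]
      nlinarith [mul_nonneg hX0 (sub_nonneg.2 hk5), mul_nonneg hv (sub_nonneg.2 hk5)]

end Epoch

/-! ### The algorithm between two restarts, and adaptedness of its state. -/

section Run

variable {n : ℕ}

/-- Current iterate on the joint space. -/
def State.z (S : State n) : Pair n := WithLp.toLp 2 (S.x, S.y)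

/-- Running average on the joint space. -/
def State.zhat (S : State n) : Pair n := WithLp.toLp 2 (S.xhat, S.yhat)

lemma State.norm_sq_zhat (S : State n) : ‖S.zhat‖ ^ 2 = ‖S.xhat‖ ^ 2 + ‖S.yhat‖ ^ 2 :=
  norm_sq_toLp _ _

variable {Ξ : Type*} [MeasurableSpace Ξ] {G : Game n Ξ}

lemma algStep_zhat (η : ℝ) (s : Ξ) (r : Prop) (S : State n) :
    (algStep η (G.B s) (G.gx s) (G.gy s) r S).zhat
      = ((S.s : ℝ) / (S.s + 1)) • S.zhat + (1 / ((S.s : ℝ) + 1)) • G.step η s S.z := by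
  unfold algStep
  split_ifs <;> simp [State.zhat, State.z, Game.step] <;> rfl

lemma algStep_of_restart (η : ℝ) (s : Ξ) {r : Prop} (hr : r) (S : State n) :
    (algStep η (G.B s) (G.gx s) (G.gy s) r S).z = (algStep η (G.B s) (G.gx s) (G.gy s) r S).zhat
      ∧ (algStep η (G.B s) (G.gx s) (G.gy s) r S).s = 0 := by
  unfold algStep
  rw [if_pos hr]
  exact ⟨rfl, rfl⟩

lemma algStep_of_not_restart (η : ℝ) (s : Ξ) {r : Prop} (hr : ¬ r) (S : State n) :
    (algStep η (G.B s) (G.gx s) (G.gy s) r S).z = G.step η s S.z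
      ∧ (algStep η (G.B s) (G.gx s) (G.gy s) r S).s = S.s + 1 := by
  unfold algStep
  rw [if_neg hr]
  exact ⟨rfl, rfl⟩

lemma run_start (η : ℕ → ℝ) (R : Set ℕ) (x₀ y₀ : Vec n) (ξ : ℕ → Ξ) {τ : ℕ}
    (hτ : τ = 0 ∨ τ ∈ R) :
    (run G η R x₀ y₀ ξ τ).z = (run G η R x₀ y₀ ξ τ).zhat ∧ (run G η R x₀ y₀ ξ τ).s = 0 := by
  cases τ with
  | zero => exact ⟨rfl, rfl⟩
  | succ t => exact algStep_of_restart _ _ (by simpa using hτ) _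

/-- Iterates of an epoch that starts at time `τ` and is never interrupted. -/
def epochIter (G : Game n Ξ) (η : ℝ) (z : Pair n) (ξ : ℕ → Ξ) : ℕ → Pair n
  | 0 => z
  | t + 1 => G.step η (ξ t) (epochIter G η z ξ t)

/-- Running average of the iterates of an epoch. -/
def epochAvg (G : Game n Ξ) (η : ℝ) (z : Pair n) (ξ : ℕ → Ξ) : ℕ → Pair n
  | 0 => z
  | t + 1 => ((t : ℝ) / (t + 1)) • epochAvg G η z ξ t
      + (1 / ((t : ℝ) + 1)) • epochIter G η z ξ (t + 1)

lemma run_epoch (η : ℝ) (R : Set ℕ) (x₀ y₀ : Vec n) (ξ : ℕ → Ξ) {τ : ℕ}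
    (hτ : τ = 0 ∨ τ ∈ R) (k : ℕ) (hk : ∀ j, 0 < j → j ≤ k → τ + j ∉ R) :
    (run G (fun _ => η) R x₀ y₀ ξ (τ + k)).z
        = epochIter G η (run G (fun _ => η) R x₀ y₀ ξ τ).zhat (fun t => ξ (τ + t)) k ∧
    (run G (fun _ => η) R x₀ y₀ ξ (τ + k)).zhat
        = epochAvg G η (run G (fun _ => η) R x₀ y₀ ξ τ).zhat (fun t => ξ (τ + t)) k ∧
    (run G (fun _ => η) R x₀ y₀ ξ (τ + k)).s = k := by
  induction k with
  | zero => exact ⟨(run_start _ R x₀ y₀ ξ hτ).1, rfl, (run_start _ R x₀ y₀ ξ hτ).2⟩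
  | succ k ih =>
    obtain ⟨h1, h2, h3⟩ := ih fun j hj hjk => hk j hj (by omega)
    have hnot : τ + k + 1 ∉ R := hk (k + 1) (by omega) le_rfl
    obtain ⟨a1, a2⟩ := algStep_of_not_restart (G := G) η (ξ (τ + k)) hnot
      (run G (fun _ => η) R x₀ y₀ ξ (τ + k))
    have a3 := algStep_zhat (G := G) η (ξ (τ + k)) (τ + k + 1 ∈ R)
      (run G (fun _ => η) R x₀ y₀ ξ (τ + k))
    rw [h1] at a1
    rw [h1, h2, h3] at a3
    rw [h3] at a2
    exact ⟨a1, a3, a2⟩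

/-- Step `k` itself may be a restart: the average is updated before the iterate is overwritten.
Hence only times strictly before `τ + k` must avoid `R`. -/
lemma run_epoch_zhat (η : ℝ) (R : Set ℕ) (x₀ y₀ : Vec n) (ξ : ℕ → Ξ) {τ : ℕ}
    (hτ : τ = 0 ∨ τ ∈ R) (k : ℕ) (hk : ∀ j, 0 < j → j < k → τ + j ∉ R) :
    (run G (fun _ => η) R x₀ y₀ ξ (τ + k)).zhat
        = epochAvg G η (run G (fun _ => η) R x₀ y₀ ξ τ).zhat (fun t => ξ (τ + t)) k := by
  cases k with
  | zero => rfl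
  | succ k =>
    obtain ⟨h1, h2, h3⟩ := run_epoch (G := G) η R x₀ y₀ ξ hτ k
      fun j hj hjk => hk j hj (by omega)
    have a3 := algStep_zhat (G := G) η (ξ (τ + k)) (τ + k + 1 ∈ R)
      (run G (fun _ => η) R x₀ y₀ ξ (τ + k))
    rw [h1, h2, h3] at a3
    exact a3

variable {Ω : Type*} [mΩ : MeasurableSpace Ω] {Pr : Measure Ω} [IsProbabilityMeasure G.P]
  [IsProbabilityMeasure Pr] {θ v w κ η : ℝ} {ξ : ℕ → Ω → Ξ} {ℱ : ℕ → MeasurableSpace Ω}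

lemma integrable_norm_sq_convex {X Y : Ω → Pair n} (hX : Measurable X) (hY : Measurable Y)
    (hX2 : Integrable (fun ω => ‖X ω‖ ^ 2) Pr) (hY2 : Integrable (fun ω => ‖Y ω‖ ^ 2) Pr)
    {a b : ℝ} (ha : 0 ≤ a) (hb : 0 ≤ b) (hab : a + b = 1) :
    Integrable (fun ω => ‖a • X ω + b • Y ω‖ ^ 2) Pr := by
  refine ((hX2.const_mul a).add (hY2.const_mul b)).mono'
    (((hX.const_smul a).add (hY.const_smul b)).norm.pow_const 2).aestronglyMeasurable
    (.of_forall fun ω => ?_)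
  rw [Real.norm_of_nonneg (by positivity)]
  exact norm_sq_convex_le ha hb hab _ _

/-- The random state `S` is square integrable, `m`-measurable and has a deterministic counter. -/
structure IsAdaptedState {Ω : Type*} (m : MeasurableSpace Ω) {mΩ : MeasurableSpace Ω}
    (Pr : Measure Ω) (S : Ω → State n) : Prop where
  counter : ∃ c, ∀ ω, (S ω).s = c
  measurable_z : Measurable[m] fun ω => (S ω).z
  measurable_zhat : Measurable[m] fun ω => (S ω).zhat
  integrable_z : Integrable (fun ω => ‖(S ω).z‖ ^ 2) Pr
  integrable_zhat : Integrable (fun ω => ‖(S ω).zhat‖ ^ 2) Pr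

lemma IsAdaptedState.algStep
    (hf : IsStep G.P (G.step η) (G.meanStep η) θ v w κ) (hξ : IsSampling ξ ℱ G.P Pr) (t : ℕ)
    {S : Ω → State n} (hS : IsAdaptedState (ℱ t) Pr S) (r : Prop) :
    IsAdaptedState (ℱ (t + 1)) Pr fun ω =>
      algStep η (G.B (ξ t ω)) (G.gx (ξ t ω)) (G.gy (ξ t ω)) r (S ω) := by
  obtain ⟨⟨c, h0⟩, h1, h2, h3, h4⟩ := hS
  have hζ : Measurable (ξ t) := (hξ.measurable t).mono (hξ.le _) le_rfl
  have hi := (hf.integral_sq_le (hξ.le t) hζ (hξ.law t) (hξ.indep t) h1 h3).1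
  have hle := hξ.mono (Nat.le_succ t)
  have hm : Measurable[ℱ (t + 1)] (fun ω => G.step η (ξ t ω) (S ω).z) :=
    hf.measurable.comp ((h1.mono hle le_rfl).prodMk (hξ.measurable t))
  have hzh : ∀ ω, (SEG.algStep η (G.B (ξ t ω)) (G.gx (ξ t ω)) (G.gy (ξ t ω)) r (S ω)).zhat
      = ((c : ℝ) / (c + 1)) • (S ω).zhat
        + (1 / ((c : ℝ) + 1)) • G.step η (ξ t ω) (S ω).z := fun ω => by
    rw [← h0 ω]
    exact algStep_zhat _ _ _ _
  have hmh : Measurable[ℱ (t + 1)] (fun ω => ((c : ℝ) / (c + 1)) • (S ω).zhat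
        + (1 / ((c : ℝ) + 1)) • G.step η (ξ t ω) (S ω).z) :=
    Measurable.add ((measurable_const_smul _).comp (h2.mono hle le_rfl))
      ((measurable_const_smul _).comp hm)
  have hih : Integrable (fun ω => ‖((c : ℝ) / (c + 1)) • (S ω).zhat
        + (1 / ((c : ℝ) + 1)) • G.step η (ξ t ω) (S ω).z‖ ^ 2) Pr :=
    integrable_norm_sq_convex (h2.mono (hξ.le _) le_rfl) (hm.mono (hξ.le _) le_rfl)
      h4 hi (by positivity) (by positivity) (by field_simp)
  simp_rw [← hzh] at hmh hih
  by_cases hr : r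
  · have e := fun ω => algStep_of_restart (G := G) η (ξ t ω) hr (S ω)
    refine ⟨⟨0, fun ω => (e ω).2⟩, ?_, hmh, ?_, hih⟩
    · simp_rw [fun ω => (e ω).1]; exact hmh
    · simp_rw [fun ω => (e ω).1]; exact hih
  · have e := fun ω => algStep_of_not_restart (G := G) η (ξ t ω) hr (S ω)
    refine ⟨⟨c + 1, fun ω => ?_⟩, ?_, hmh, ?_, hih⟩
    · rw [(e ω).2, h0]
    · simp_rw [fun ω => (e ω).1]; exact hm
    · simp_rw [fun ω => (e ω).1]; exact hi

lemma isAdaptedState_run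
    (hf : IsStep G.P (G.step η) (G.meanStep η) θ v w κ) (hξ : IsSampling ξ ℱ G.P Pr)
    (R : Set ℕ) (x₀ y₀ : Vec n) (t : ℕ) :
    IsAdaptedState (ℱ t) Pr fun ω => run G (fun _ => η) R x₀ y₀ (fun t => ξ t ω) t := by
  induction t with
  | zero =>
    have : IsAdaptedState (ℱ 0) Pr fun _ : Ω => (⟨x₀, y₀, x₀, y₀, 0⟩ : State n) :=
      ⟨⟨0, fun _ => rfl⟩, measurable_const, measurable_const, integrable_const _,
        integrable_const _⟩
    exact this
  | succ t ih => exact ih.algStep hf hξ t _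

/-- Second moment of the output `k` steps after the restart at time `τ`. -/
theorem run_average_le
    (hf : IsStep G.P (G.step η) (G.meanStep η) θ v w κ) (hξ : IsSampling ξ ℱ G.P Pr)
    (R : Set ℕ) (x₀ y₀ : Vec n) {τ : ℕ} (hτ : τ = 0 ∨ τ ∈ R) (k : ℕ)
    (hk : ∀ j, 0 < j → j < k → τ + j ∉ R) {Z : ℕ → ℝ}
    (hZ : ∀ t, Z t = ∫ ω, ‖(run G (fun _ => η) R x₀ y₀ (fun t => ξ t ω) t).zhat‖ ^ 2 ∂Pr) :
    κ * Z (τ + k) ≤ 16 * Z τ / ((k : ℝ) + 1) ^ 2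
      + (2 * w * (Z τ + v / θ) + 12 * v) / ((k : ℝ) + 1) := by
  obtain ⟨-, -, h2, -, h4⟩ := isAdaptedState_run hf hξ R x₀ y₀ τ
  have h := hf.average_le (hξ.shift τ)
    (z := fun t ω => epochIter G η (run G (fun _ => η) R x₀ y₀ (fun t => ξ t ω) τ).zhat
      (fun t => ξ (τ + t) ω) t) h2 h4 (fun _ _ => rfl)
    (zhat := fun t ω => epochAvg G η (run G (fun _ => η) R x₀ y₀ (fun t => ξ t ω) τ).zhat
      (fun t => ξ (τ + t) ω) t) rfl (fun _ _ => rfl) k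
  rw [hZ, hZ]
  simp_rw [fun ω => run_epoch_zhat (G := G) η R x₀ y₀ (fun t => ξ t ω) hτ k hk]
  exact h

end Run

/-! ### Real inequalities: roots of quadratics, geometric sums, numerical constants. -/

section RealBounds

open Real

/-- Beyond its larger root, `q₃x² - q₂x - q₁` is nonnegative; dividing by `x²` gives the claim. -/
lemma div_sq_add_div_le_of_root_le {q₁ q₂ q₃ x : ℝ} (h3 : 0 < q₃)
    (hx0 : 0 < x) (hx : (q₂ + √(q₂ ^ 2 + 4 * q₁ * q₃)) / (2 * q₃) ≤ x) :
    q₁ / x ^ 2 + q₂ / x ≤ q₃ := by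
  rw [div_le_iff₀ (by positivity)] at hx
  have hs : √(q₂ ^ 2 + 4 * q₁ * q₃) ≤ 2 * q₃ * x - q₂ := by linarith
  have hsq := (Real.sqrt_le_left (by linarith [Real.sqrt_nonneg (q₂ ^ 2 + 4 * q₁ * q₃)])).1 hs
  have : q₁ + q₂ * x ≤ q₃ * x ^ 2 := by
    have : 0 ≤ 4 * q₃ * (q₃ * x ^ 2 - q₂ * x - q₁) := by nlinarith
    have := nonneg_of_mul_nonneg_right this (by positivity)
    linarith
  rw [div_add_div _ _ (by positivity) hx0.ne', div_le_iff₀ (by positivity)]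
  nlinarith

lemma root_le {q₁ q₂ q₃ : ℝ} (h1 : 0 ≤ q₁) (h2 : 0 ≤ q₂) (h3 : 0 < q₃) :
    (q₂ + √(q₂ ^ 2 + 4 * q₁ * q₃)) / (2 * q₃) ≤ q₂ / q₃ + √(q₁ / q₃) := by
  have hs : √(q₂ ^ 2 + 4 * q₁ * q₃) ≤ q₂ + 2 * q₃ * √(q₁ / q₃) := by
    refine (Real.sqrt_le_left (by positivity)).2 ?_
    have : √(q₁ / q₃) ^ 2 * q₃ = q₁ := by
      rw [Real.sq_sqrt (by positivity), div_mul_cancel₀ _ h3.ne']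
    have h4 : 0 ≤ q₂ * q₃ * √(q₁ / q₃) := by positivity
    nlinarith
  rw [div_le_iff₀ (by positivity)]
  have : (q₂ / q₃ + √(q₁ / q₃)) * (2 * q₃) = q₂ + (q₂ + 2 * q₃ * √(q₁ / q₃)) := by
    field_simp; ring
  linarith

lemma sum_exp_le (N : ℕ) :
    ∑ e ∈ Finset.Icc 1 N, exp (2 * (e : ℝ)) ≤ exp (2 * (N : ℝ)) / (1 - exp (-2)) := by
  have hlt : exp (-2) < 1 := by rw [Real.exp_lt_one_iff]; norm_num
  have h0 : 0 < 1 - exp (-2) := by linarith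
  induction N with
  | zero => simp
  | succ N ih =>
    rw [Finset.sum_Icc_succ_top (by omega)]
    refine (add_le_add_left ih _).trans (le_of_eq ?_)
    have : exp (2 * (N : ℝ)) = exp (2 * ((N + 1 : ℕ) : ℝ)) * exp (-2) := by
      rw [← exp_add]; congr 1; push_cast; ring
    rw [this]
    field_simp
    ring

lemma cast_ceil_sub_one_le {r : ℝ} (hr : 0 ≤ r) : ((⌈r⌉₊ - 1 : ℕ) : ℝ) ≤ r := by
  have h := Nat.ceil_lt_add_one hr
  rcases Nat.eq_zero_or_pos ⌈r⌉₊ with h0 | h0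
  · rw [h0]; simpa using hr
  · rw [Nat.cast_sub h0]; push_cast; linarith

lemma exp_neg_two_le : exp (-2) ≤ 0.1355 := by
  have h1 : exp (-2) * (exp 1 * exp 1) = 1 := by
    rw [← exp_add, ← exp_add]; norm_num
  have he1 := Real.exp_one_gt_d9
  nlinarith [exp_pos (-2), mul_le_mul he1.le he1.le (by norm_num) (exp_pos 1).le]

/-- The maximum over `θ ≥ 0` is at `θ = 2/3`; the difference of the two sides is `(3θ - 2)² (3θ + 1)
/ 27`. -/
lemma sq_mul_one_sub_le {θ : ℝ} (h : 0 ≤ θ) : θ ^ 2 * (1 - θ) ≤ 4 / 27 := by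
  nlinarith [mul_nonneg (sq_nonneg (3 * θ - 2)) (show 0 ≤ 3 * θ + 1 by linarith)]

set_option maxHeartbeats 400000 in
-- With `C = θ s` and `p = Y s`, multiplying by `s - C = s (1 - θ)` makes everything scale-free. The
-- hypothesis on `C` becomes `e p ≤ θ²`, so `p (1 - θ) ≤ 4 / (27 e)` is a small constant however
-- large `Y` is.
lemma burn_in_bound {s C Y X L β T : ℝ} (hs : 0 < s) (hC : 0 ≤ C) (hlt : C < s) (hY : 0 ≤ Y)
    (hYs : exp 1 * Y * s ^ 3 ≤ C ^ 2) (hL : 0 ≤ L) (hβ : 0 < β) (hβ1 : β ≤ 1)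
    (hX : X ≤ exp 1 / (β * s))
    (hT : T ≤ (4 * √2 / s + 4 * Y) * (L / 2 + 1) + (6 * (X + Y) + 4 * Y) / (1 - exp (-2))) :
    T * (s - C) ≤ 3 * L + 26 / β := by
  have he1 := Real.exp_one_gt_d9
  have he2 := Real.exp_one_lt_d9
  have hsqrt : √2 ≤ 1.41422 := by
    refine (Real.sqrt_le_left (by norm_num)).2 (by norm_num)
  have hexp2 := exp_neg_two_le
  obtain ⟨θ, rfl⟩ : ∃ θ, C = θ * s := ⟨C / s, (div_mul_cancel₀ _ hs.ne').symm⟩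
  have hθ0 : 0 ≤ θ := nonneg_of_mul_nonneg_left hC hs
  have hθ1 : θ < 1 := by nlinarith
  set p := Y * s with hp
  have hp0 : 0 ≤ p := by positivity
  have hpe : exp 1 * p ≤ θ ^ 2 := by
    refine le_of_mul_le_mul_right ?_ (show 0 < s ^ 2 by positivity)
    linear_combination hYs
  have hcub := sq_mul_one_sub_le hθ0
  have hpu : p * (1 - θ) ≤ 0.0546 := by
    have h1 := mul_le_mul_of_nonneg_right hpe (sub_nonneg.2 hθ1.le)
    have h2 : 0 ≤ p * (1 - θ) := mul_nonneg hp0 (sub_nonneg.2 hθ1.le)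
    have h3 := mul_le_mul_of_nonneg_right he1.le h2
    linarith
  have hXs : X * s ≤ 2.7183 * (1 / β) := by
    have h1 := mul_le_mul_of_nonneg_right hX hs.le
    have h2 : exp 1 / (β * s) * s = exp 1 * (1 / β) := by field_simp
    rw [h2] at h1
    refine h1.trans (mul_le_mul_of_nonneg_right (by linarith) (by positivity))
  have hb1 : 1 ≤ 1 / β := by rw [le_div_iff₀ hβ]; linarith
  set B := 1 / β with hB
  have hd : 0 < 1 - exp (-2) := by linarith
  have hmul := mul_le_mul_of_nonneg_right hT (show 0 ≤ s - θ * s by nlinarith)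
  have hexpand : ((4 * √2 / s + 4 * Y) * (L / 2 + 1) + (6 * (X + Y) + 4 * Y) / (1 - exp (-2)))
      * (s - θ * s) = (4 * √2 * (1 - θ) + 4 * (p * (1 - θ))) * (L / 2 + 1)
        + (6 * (X * s) * (1 - θ) + 10 * (p * (1 - θ))) / (1 - exp (-2)) := by
    rw [hp]; field_simp; ring
  rw [hexpand] at hmul
  -- `4√2 + 4 · 0.0546` stays below `6`, so half of it fits under the coefficient `3` of `L`; the
  -- other `5.876` joins the constant term.
  have hA : 4 * √2 * (1 - θ) + 4 * (p * (1 - θ)) ≤ 5.876 := by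
    have := mul_nonneg (Real.sqrt_nonneg 2) hθ0
    linarith
  have hA' := mul_le_mul_of_nonneg_right hA (show 0 ≤ L / 2 + 1 by linarith)
  -- Together with the leftover `5.876 ≤ 5.876 B` this stays below `26 B`.
  have hE : (6 * (X * s) * (1 - θ) + 10 * (p * (1 - θ))) / (1 - exp (-2)) ≤ 19.6 * B := by
    rw [div_le_iff₀ hd]
    have h1 : X * s * (1 - θ) ≤ 2.7183 * B := by
      have := mul_le_mul_of_nonneg_right hXs (sub_nonneg.2 hθ1.le)
      have := mul_nonneg hθ0 (show 0 ≤ B by linarith)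
      linarith
    have := mul_le_mul_of_nonneg_left hexp2 (show 0 ≤ B by linarith)
    linarith
  have : 26 / β = 26 * B := by rw [hB]; ring
  rw [this]
  linarith

end RealBounds

/-! ### Admissibility and comparison of the step sizes `η̂` and `η̄`. -/

section StepSize

variable {n : ℕ} {Ξ : Type*} [MeasurableSpace Ξ] {G : Game n Ξ} {σB σB2 σg α e : ℝ}
  [IsProbabilityMeasure G.P]

lemma Game.capped_le : G.capped σB α e ≤ e := by
  unfold Game.capped; split_ifs
  · exact le_rfl
  · exact min_le_left _ _

lemma AssumptionB.capped_pos (hB : AssumptionB G σB σB2) (hns : IsUnit G.meanB) (hα : 0 < α)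
    (he : 0 < e) : 0 < G.capped σB α e := by
  have := hB.lam_pos hns
  have := Real.sqrt_pos.2 hB.lamMax_pos
  unfold Game.capped; split_ifs with h
  · exact he
  · exact lt_min he (by positivity)

lemma AssumptionB.mul_capped_le (hB : AssumptionB G σB σB2) (hns : IsUnit G.meanB)
    (hα : 0 < α) :
    2 * σB ^ 2 * √(lamMax (G.meanB.transpose * G.meanB)) * G.capped σB α e ≤ α * G.lam := by
  have := hB.lam_pos hns
  have hl := Real.sqrt_pos.2 hB.lamMax_pos
  unfold Game.capped; split_ifs with h
  · rw [h]
    have : 0 ≤ α * G.lam := by positivity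
    simpa using this
  · refine (mul_le_mul_of_nonneg_left (min_le_right _ _) (by positivity)).trans (le_of_eq ?_)
    exact mul_div_cancel₀ _ (by positivity)

lemma AssumptionB.capped_mono (_ : AssumptionB G σB σB2) {e' : ℝ} (h : e ≤ e') :
    G.capped σB α e ≤ G.capped σB α e' := by
  unfold Game.capped; split_ifs
  · exact h
  · exact min_le_min_right _ h

/-- Dividing both entries of the minimum by `c ≥ 1` only lowers the cap; for `c = √2` this gives `η̄
≤ √2 η̂`. -/
lemma AssumptionB.capped_div_le (hB : AssumptionB G σB σB2) (hns : IsUnit G.meanB) (hα : 0 < α)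
    {c : ℝ} (hc : 1 ≤ c) : G.capped σB α e / c ≤ G.capped σB α (e / c) := by
  have := hB.lam_pos hns
  have hl := Real.sqrt_pos.2 hB.lamMax_pos
  have hc0 : 0 < c := by linarith
  unfold Game.capped; split_ifs with h
  · exact le_rfl
  · refine le_min (div_le_div_of_nonneg_right (min_le_left _ _) hc0.le) ?_
    exact (div_le_div_of_nonneg_right (min_le_right _ _) hc0.le).trans
      (div_le_self (by positivity) hc)

lemma AssumptionB.etaHat_pos (hB : AssumptionB G σB σB2) (hns : IsUnit G.meanB) (hα : 0 < α) :
    0 < G.etaHat σB α := hB.capped_pos hns hα (div_pos hB.etaM_pos (by positivity))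

lemma AssumptionB.etaBar_pos (hB : AssumptionB G σB σB2) (hns : IsUnit G.meanB) (hα : 0 < α) :
    0 < G.etaBar σB α := hB.capped_pos hns hα hB.etaM_pos

lemma AssumptionB.etaHat_le_etaBar (hB : AssumptionB G σB σB2) :
    G.etaHat σB α ≤ G.etaBar σB α :=
  hB.capped_mono (div_le_self hB.etaM_pos.le (Real.one_le_sqrt.2 (by norm_num)))

lemma AssumptionB.etaBar_le (hB : AssumptionB G σB σB2) (hns : IsUnit G.meanB) (hα : 0 < α) :
    G.etaBar σB α ≤ √2 * G.etaHat σB α := by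
  have h := hB.capped_div_le hns hα (e := G.etaM) (c := √2) (Real.one_le_sqrt.2 (by norm_num))
  rw [div_le_iff₀ (by positivity)] at h
  rw [mul_comm]; exact h

lemma AssumptionB.etaHat_sq_rho_le (hB : AssumptionB G σB σB2) (hns : IsUnit G.meanB)
    (hα : 0 < α) : G.etaHat σB α ^ 2 * G.rho ≤ 1 / 2 := by
  have h1 : G.etaHat σB α ^ 2 ≤ (G.etaM / √2) ^ 2 :=
    pow_le_pow_left₀ (hB.etaHat_pos hns hα).le Game.capped_le 2
  rw [div_pow, Real.sq_sqrt (by norm_num)] at h1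
  have h2 := mul_le_mul_of_nonneg_right h1 hB.rho_pos.le
  have h3 := hB.etaM_sq
  linarith

lemma AssumptionB.etaBar_sq_lam_le (hB : AssumptionB G σB σB2) (hns : IsUnit G.meanB)
    (hα : 0 < α) : G.etaBar σB α ^ 2 * G.lam ≤ 1 := by
  have h1 : G.etaBar σB α ^ 2 ≤ G.etaM ^ 2 :=
    pow_le_pow_left₀ (hB.etaBar_pos hns hα).le Game.capped_le 2
  have h2 := mul_le_mul h1 hB.lam_le_rho (hB.lam_pos hns).le (sq_nonneg _)
  rwa [hB.etaM_sq] at h2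

theorem isStep_etaHat (hB : AssumptionB G σB σB2) (hg : AssumptionG G σg)
    (hns : IsUnit G.meanB) (hα0 : 0 < α) (hα1 : α < 1) :
    IsStep G.P (G.step (G.etaHat σB α)) (G.meanStep (G.etaHat σB α))
      (G.etaHat σB α ^ 2 * G.mu / 2) (3 / 2 * G.etaHat σB α ^ 2 * σg ^ 2)
      (2 * G.etaHat σB α ^ 2 * noiseB σB σB2 (G.etaHat σB α))
      ((1 - α) * G.etaHat σB α ^ 2 * G.lam) :=
  isStep hB hg hns (hB.etaHat_pos hns hα0) hα0 hα1 (hB.etaHat_sq_rho_le hns hα0)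
    (hB.mul_capped_le hns hα0)

end StepSize

/-! ### The restarting schedule: decay per epoch, noise floor, total length. -/

section ScheduleBounds

open Real

variable {n : ℕ} {Ξ : Type*} [MeasurableSpace Ξ] {G : Game n Ξ} {σB σB2 σg α D : ℝ}

/-- Bound on the second moment of the running average `k` steps after a restart from a point
with second moment `E`. -/
def Game.epochBound (G : Game n Ξ) (σB σB2 σg α E : ℝ) (k : ℕ) : ℝ :=
  16 / ((1 - α) * G.lam) * (E / G.etaHat σB α ^ 2) / ((k : ℝ) + 1) ^ 2
    + (4 * noiseB σB σB2 (G.etaHat σB α) * (E + 3 * σg ^ 2 / G.mu) + 18 * σg ^ 2)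
      / ((1 - α) * G.lam) / ((k : ℝ) + 1)

lemma noiseB_nonneg (σB σB2 η : ℝ) : 0 ≤ noiseB σB σB2 η := by rw [noiseB]; positivity

lemma Game.epochBound_mono (hc : 0 < (1 - α) * G.lam) {E E' : ℝ} (h : E ≤ E') (k : ℕ) :
    G.epochBound σB σB2 σg α E k ≤ G.epochBound σB σB2 σg α E' k := by
  have := noiseB_nonneg σB σB2 (G.etaHat σB α)
  unfold Game.epochBound
  gcongr

lemma Game.q1_eq (e : ℕ) : G.q1 σB α D (e + 1)
    = 16 / ((1 - α) * G.lam) * (exp (-(2 * (e : ℝ))) * D / G.etaHat σB α ^ 2) := by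
  rw [Game.q1]; congr 5; push_cast; ring

lemma Game.q2_eq (e : ℕ) : G.q2 σB σB2 σg α D (e + 1)
    = (4 * noiseB σB σB2 (G.etaHat σB α) * (exp (-(2 * (e : ℝ))) * D + 3 * σg ^ 2 / G.mu)
      + 18 * σg ^ 2) / ((1 - α) * G.lam) := by
  rw [Game.q2]; congr 6; push_cast; ring_nf

lemma Game.q1_nonneg (hc : 0 < (1 - α) * G.lam) (hD : 0 ≤ D) (e : ℕ) : 0 ≤ G.q1 σB α D e := by
  rw [Game.q1]; positivity

lemma Game.q2_nonneg (hc : 0 < (1 - α) * G.lam) (hμ : 0 < G.mu) (hD : 0 ≤ D) (e : ℕ) :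
    0 ≤ G.q2 σB σB2 σg α D e := by
  have := noiseB_nonneg σB σB2 (G.etaHat σB α)
  rw [Game.q2]; positivity

lemma q3_pos (hD : 0 < D) (e : ℕ) : 0 < q3 D e := div_pos hD (exp_pos _)

/-- The length of an epoch suffices to shrink the second moment by the factor `e⁻²`. -/
lemma Game.epochBound_epochLength_le (hD : 0 < D) (e : ℕ) :
    G.epochBound σB σB2 σg α (exp (-(2 * (e : ℝ))) * D) (G.epochLength σB σB2 σg α D (e + 1))
      ≤ exp (-(2 * ((e + 1 : ℕ) : ℝ))) * D := by
  rw [Game.epochBound, ← G.q1_eq, ← G.q2_eq]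
  have h3 := q3_pos hD (e + 1)
  have h := div_sq_add_div_le_of_root_le (q₁ := G.q1 σB α D (e + 1))
    (q₂ := G.q2 σB σB2 σg α D (e + 1)) h3
    -- The epoch bound involves `k + 1`, which undoes the `- 1` in the epoch length; truncation of
    -- the subtraction at `0` only helps.
    (x := (G.epochLength σB σB2 σg α D (e + 1) : ℝ) + 1) (by positivity) (by
      refine (Nat.le_ceil _).trans ?_
      rw [Game.epochLength]
      norm_cast; omega)
  refine h.trans (le_of_eq ?_)
  rw [q3, exp_neg]; field_simp

lemma Game.timestamp_zero : G.timestamp σB σB2 σg α D 0 = 0 := by simp [Game.timestamp]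

lemma Game.timestamp_succ (i : ℕ) : G.timestamp σB σB2 σg α D (i + 1)
    = G.timestamp σB σB2 σg α D i + G.epochLength σB σB2 σg α D (i + 1) :=
  Finset.sum_Icc_succ_top (by omega) _

lemma Game.timestamp_mono : Monotone (G.timestamp σB σB2 σg α D) :=
  monotone_nat_of_le_succ fun i => by rw [G.timestamp_succ]; omega

lemma Game.timestamp_restart {i : ℕ} (hi : (i : ℕ∞) ≤ G.numEpochs σg D) :
    G.timestamp σB σB2 σg α D i = 0 ∨
      G.timestamp σB σB2 σg α D i ∈ G.restartTimes σB σB2 σg α D := by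
  rcases Nat.eq_zero_or_pos i with rfl | h
  · exact .inl G.timestamp_zero
  · exact .inr ⟨i, h, hi, rfl⟩

/-- Timestamps are monotone, so none lies strictly between two consecutive ones; epochs of length
zero do no harm. -/
lemma Game.not_mem_restartTimes_of_lt {i j : ℕ} (hj : 0 < j)
    (hjk : j < G.epochLength σB σB2 σg α D (i + 1)) :
    G.timestamp σB σB2 σg α D i + j ∉ G.restartTimes σB σB2 σg α D := by
  rintro ⟨i', -, -, h⟩
  rcases le_or_gt i' i with hle | hlt
  · have := G.timestamp_mono (σB := σB) (σB2 := σB2) (σg := σg) (α := α) (D := D) hle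
    omega
  · have := G.timestamp_mono (σB := σB) (σB2 := σB2) (σg := σg) (α := α) (D := D)
      (Nat.succ_le_of_lt hlt)
    rw [Nat.succ_eq_add_one, G.timestamp_succ] at this
    omega

lemma Game.not_mem_restartTimes_of_last {N j : ℕ} (hN : G.numEpochs σg D = N) (hj : 0 < j) :
    G.timestamp σB σB2 σg α D N + j ∉ G.restartTimes σB σB2 σg α D := by
  rintro ⟨i', -, hi, h⟩
  rw [hN, Nat.cast_le] at hi
  have := G.timestamp_mono (σB := σB) (σB2 := σB2) (σg := σg) (α := α) (D := D) hi
  omega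

/-- For `D = 0` the convention `log 0 = 0` yields no epochs. -/
lemma Game.pos_of_one_le_numEpochs (hD : 0 ≤ D) (h : 1 ≤ G.numEpochs σg D) : 0 < D := by
  rcases hD.lt_or_eq with h0 | rfl
  · exact h0
  · simp [Game.numEpochs, Game.logFactor] at h

/-- The second moments at the restarting times decay geometrically. -/
lemma Game.moment_timestamp_le (hc : 0 < (1 - α) * G.lam) (hD : 0 ≤ D) {Z : ℕ → ℝ}
    (hZ0 : Z 0 = D)
    (hZ : ∀ τ k, (τ = 0 ∨ τ ∈ G.restartTimes σB σB2 σg α D) →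
      (∀ j, 0 < j → j < k → τ + j ∉ G.restartTimes σB σB2 σg α D) →
      Z (τ + k) ≤ G.epochBound σB σB2 σg α (Z τ) k) (i : ℕ)
    (hi : (i : ℕ∞) ≤ G.numEpochs σg D) :
    Z (G.timestamp σB σB2 σg α D i) ≤ exp (-(2 * (i : ℝ))) * D := by
  induction i with
  | zero => rw [G.timestamp_zero, hZ0]; simp
  | succ i ih =>
    have hD' : 0 < D := G.pos_of_one_le_numEpochs hD
      (le_trans (by exact_mod_cast Nat.succ_pos i) hi)
    have hi' : (i : ℕ∞) ≤ G.numEpochs σg D := le_trans (by exact_mod_cast Nat.le_succ i) hi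
    rw [G.timestamp_succ]
    exact (hZ _ _ (G.timestamp_restart hi') fun j h0 h1 =>
      G.not_mem_restartTimes_of_lt h0 h1).trans
      ((G.epochBound_mono hc (ih hi') _).trans (G.epochBound_epochLength_le hD' i))

lemma Game.numEpochs_eq {N : ℕ} (hN : G.numEpochs σg D = N) :
    ¬ (σg = 0 ∧ 0 < D) ∧ N = ⌈1 / 2 * G.logFactor σg D⌉₊ := by
  unfold Game.numEpochs at hN
  split_ifs at hN with h
  · exact absurd hN (by simp)
  · exact ⟨h, (Nat.cast_injective hN).symm⟩

lemma Game.of_numEpochs_pos (hμ : 0 < G.mu) (hD : 0 ≤ D) {N : ℕ} (hN : G.numEpochs σg D = N)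
    (hpos : 0 < N) : 0 < D ∧ 0 < σg ^ 2 ∧ 0 < G.logFactor σg D ∧
      (N : ℝ) ≤ G.logFactor σg D / 2 + 1 ∧ G.logFactor σg D ≤ 2 * N ∧
      exp (G.logFactor σg D) = G.mu / (3 * σg ^ 2) * D := by
  obtain ⟨h1, h2⟩ := G.numEpochs_eq hN
  have hD' : 0 < D := G.pos_of_one_le_numEpochs (σg := σg) hD (by rw [hN]; exact_mod_cast hpos)
  have hσ : σg ≠ 0 := fun h => h1 ⟨h, hD'⟩
  have hL : 0 < G.logFactor σg D := by
    rw [h2, Nat.ceil_pos] at hpos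
    linarith
  refine ⟨hD', by positivity, hL, ?_, ?_, ?_⟩
  · have := Nat.ceil_lt_add_one (show 0 ≤ 1 / 2 * G.logFactor σg D by linarith)
    rw [← h2] at this
    linarith
  · have := Nat.le_ceil (1 / 2 * G.logFactor σg D)
    rw [← h2] at this
    linarith
  · exact exp_log (by positivity)

/-- After the last restart the second moment is at the noise floor `3 σ_g² / μ`. -/
lemma Game.noise_floor (hμ : 0 < G.mu) (hD : 0 ≤ D) {N : ℕ} (hN : G.numEpochs σg D = N) :
    exp (-(2 * (N : ℝ))) * D ≤ 3 * σg ^ 2 / G.mu := by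
  rcases Nat.eq_zero_or_pos N with rfl | hpos
  · obtain ⟨h1, h2⟩ := G.numEpochs_eq hN
    rcases hD.lt_or_eq with hD' | rfl
    · have hσ : σg ≠ 0 := fun h => h1 ⟨h, hD'⟩
      have hL : G.logFactor σg D ≤ 0 := by
        have := Nat.ceil_eq_zero.1 h2.symm
        linarith
      have := (log_nonpos_iff (by positivity)).1 hL
      have h3 : G.mu / (3 * σg ^ 2) * D * (3 * σg ^ 2 / G.mu) = D := by field_simp
      have h4 := mul_le_mul_of_nonneg_right this (show 0 ≤ 3 * σg ^ 2 / G.mu by positivity)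
      rw [h3] at h4
      simpa using h4
    · simp; positivity
  · obtain ⟨hD', hσ, -, -, h, he⟩ := G.of_numEpochs_pos hμ hD hN hpos
    have h5 : exp (-(2 * (N : ℝ))) ≤ (exp (G.logFactor σg D))⁻¹ := by
      rw [← exp_neg]; exact exp_le_exp.2 (by linarith)
    rw [he] at h5
    refine (mul_le_mul_of_nonneg_right h5 hD).trans (le_of_eq ?_)
    field_simp

/-- The bound after the last restart. -/
lemma Game.epochBound_noise_floor (hc : 0 < (1 - α) * G.lam) (hη : 0 < G.etaHat σB α)
    (hμ : 0 < G.mu) (k : ℕ) :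
    G.epochBound σB σB2 σg α (3 * σg ^ 2 / G.mu) k
      = 18 / ((1 - α) * G.lam) * (1 + 4 / 3 * (noiseB σB σB2 (G.etaHat σB α) / G.mu) +
          8 / (3 * ((k : ℝ) + 1) * (G.etaHat σB α ^ 2 * G.mu))) * (σg ^ 2 / ((k : ℝ) + 1)) := by
  rw [Game.epochBound]
  generalize (1 - α) * G.lam = c at *
  have hk : (k : ℝ) + 1 ≠ 0 := by positivity
  field_simp
  ring

/-- With `x = K - T + 1` the claim is `(c x + a)(x - a) ≤ c x²`, that is `a x (1 - c) ≤ a²`, which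
holds as `c ≥ 1`. -/
lemma burn_in_shift {c a σ T : ℝ} {C K : ℝ} (hC : 0 ≤ C) (hc : 1 ≤ c) (ha : 0 ≤ a)
    (hσ : 0 ≤ σ) (hK : T + a + 1 ≤ K) :
    C * (c + a / (K - T + 1)) * (σ / (K - T + 1)) ≤ C * c * (σ / (K - (T + a) + 1)) := by
  have h1 : 0 < K - T + 1 := by linarith
  have h2 : 0 < K - (T + a) + 1 := by linarith
  have : (c + a / (K - T + 1)) * (1 / (K - T + 1)) ≤ c * (1 / (K - (T + a) + 1)) := by
    rw [mul_one_div, mul_one_div, div_le_div_iff₀ h1 h2]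
    have h3 : a / (K - T + 1) * (K - T + 1) = a := div_mul_cancel₀ _ h1.ne'
    have h4 : 0 ≤ a / (K - T + 1) := by positivity
    nlinarith [mul_nonneg h4 ha, mul_nonneg (sub_nonneg.2 hc) ha]
  have h5 := mul_le_mul_of_nonneg_left this (mul_nonneg hC hσ)
  calc _ = C * σ * ((c + a / (K - T + 1)) * (1 / (K - T + 1))) := by ring
    _ ≤ _ := h5
    _ = _ := by ring

/-- Length of a single epoch. -/
lemma Game.epochLength_le (hc : 0 < (1 - α) * G.lam) (hμ : 0 < G.mu)
    (hη : 0 < G.etaHat σB α) (hD : 0 < D) (e : ℕ) :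
    (G.epochLength σB σB2 σg α D e : ℝ)
      ≤ (√(16 * exp 2 / ((1 - α) * G.etaHat σB α ^ 2 * G.lam))
          + 4 * exp 2 * noiseB σB σB2 (G.etaHat σB α) / ((1 - α) * G.lam))
        + (4 * noiseB σB σB2 (G.etaHat σB α) + 6 * G.mu) / ((1 - α) * G.lam)
          * (3 * σg ^ 2 / (G.mu * D)) * exp (2 * (e : ℝ)) := by
  have h3 := q3_pos hD e
  have h1 := G.q1_nonneg (σB := σB) hc hD.le e
  have h2 := G.q2_nonneg (σB := σB) (σB2 := σB2) (σg := σg) hc hμ hD.le e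
  refine (cast_ceil_sub_one_le (by positivity)).trans ((root_le h1 h2 h3).trans (le_of_eq ?_))
  have e1 : exp (2 - 2 * (e : ℝ)) = exp 2 / exp (2 * (e : ℝ)) := exp_sub _ _
  -- This ratio is free of `D` and of the epoch, so every epoch pays the same square-root term; only
  -- the noise part of `q₂ / q₃` grows, like `exp (2e)`.
  have e2 : G.q1 σB α D e / q3 D e = 16 * exp 2 / ((1 - α) * G.etaHat σB α ^ 2 * G.lam) := by
    have ha : (1 - α) ≠ 0 := left_ne_zero_of_mul hc.ne'
    have hb : G.lam ≠ 0 := right_ne_zero_of_mul hc.ne'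
    rw [Game.q1, q3, e1]
    field_simp
  rw [e2, Game.q2, q3, e1]
  generalize (1 - α) * G.lam = c at *
  field_simp
  ring

/-- Length of the restarting phase. -/
lemma Game.timestamp_le (hc : 0 < (1 - α) * G.lam) (hμ : 0 < G.mu)
    (hη : 0 < G.etaHat σB α) (hD : 0 ≤ D) {N : ℕ} (hN : G.numEpochs σg D = N) :
    (G.timestamp σB σB2 σg α D N : ℝ) ≤
      (√(16 * exp 2 / ((1 - α) * G.etaHat σB α ^ 2 * G.lam)) +
          4 * exp 2 * noiseB σB σB2 (G.etaHat σB α) / ((1 - α) * G.lam)) * (N : ℝ) +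
        exp 2 * (6 * G.mu + 4 * noiseB σB σB2 (G.etaHat σB α)) /
          ((1 - α) * G.lam * (1 - exp (-2))) := by
  have hν := noiseB_nonneg σB σB2 (G.etaHat σB α)
  have hd : 0 < 1 - exp (-2) := by linarith [exp_neg_two_le]
  rcases Nat.eq_zero_or_pos N with rfl | hpos
  · rw [G.timestamp_zero]; simp; positivity
  obtain ⟨hD', hσ, -, h, -, he⟩ := G.of_numEpochs_pos hμ hD hN hpos
  rw [Game.timestamp, Nat.cast_sum]
  refine (Finset.sum_le_sum fun e _ => G.epochLength_le hc hμ hη hD' e).trans ?_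
  rw [Finset.sum_add_distrib, ← Finset.mul_sum]
  simp only [Finset.sum_const, Nat.card_Icc, add_tsub_cancel_right, nsmul_eq_mul]
  rw [mul_comm (N : ℝ)]
  refine add_le_add_right ?_ _
  -- Rounding up overshoots by less than one epoch, whence the factor `e²`; the ratio `μD / (3σ_g²)`
  -- then cancels the noise coefficient.
  have hexp : exp (2 * (N : ℝ)) ≤ exp 2 * (G.mu / (3 * σg ^ 2) * D) := by
    rw [← he, ← exp_add]
    exact exp_le_exp.2 (by linarith)
  have hsum := (sum_exp_le N).trans (div_le_div_of_nonneg_right hexp hd.le)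
  refine (mul_le_mul_of_nonneg_left hsum (by positivity)).trans (le_of_eq ?_)
  have hσ0 : σg ≠ 0 := by rintro rfl; simp at hσ
  generalize (1 - α) * G.lam = c at *
  field_simp
  ring

end ScheduleBounds

/-! ### The restarting phase in terms of `η̄`. -/

section BurnIn

open Real

variable {n : ℕ} {Ξ : Type*} [MeasurableSpace Ξ] {G : Game n Ξ} {σB σB2 σg α D : ℝ}
  [IsProbabilityMeasure G.P]

/-- Length of the restarting phase in terms of the step size `η̄_M(α)`. -/
lemma AssumptionB.timestamp_le_etaBar (hB : AssumptionB G σB σB2) (hns : IsUnit G.meanB)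
    (hα0 : 0 < α) (hα1 : α < 1) (hD : 0 ≤ D) {N : ℕ} (hN : G.numEpochs σg D = N) {s C : ℝ}
    (hs : s = (1 / exp 1) * √((1 - α) * G.etaBar σB α ^ 2 * G.lam))
    (hC : C = G.etaBar σB α ^ (3 / 2 : ℝ) * G.lam ^ (1 / 4 : ℝ) *
      √(noiseB σB σB2 (G.etaBar σB α))) (hlt : C < s) :
    (G.timestamp σB σB2 σg α D N : ℝ) ≤
      (3 * max (G.logFactor σg D) 0 + 26 / √(1 - α)) / (s - C) := by
  have hlam := hB.lam_pos hns
  have hμ := hB.mu_pos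
  have h1α : 0 < 1 - α := by linarith
  have hc : 0 < (1 - α) * G.lam := mul_pos h1α hlam
  have hη := hB.etaHat_pos hns hα0
  have hb := hB.etaBar_pos hns hα0
  have hηb := hB.etaHat_le_etaBar (α := α)
  have hbη := hB.etaBar_le hns hα0
  have hb1 := hB.etaBar_sq_lam_le hns hα0
  have hT := G.timestamp_le (σB := σB) (σB2 := σB2) (σg := σg) hc hμ hη hD hN
  set η := G.etaHat σB α
  set b := G.etaBar σB α
  set ν := noiseB σB σB2 b with hν
  have hν0 : 0 ≤ ν := noiseB_nonneg _ _ _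
  have hνη : noiseB σB σB2 η ≤ ν := by
    rw [hν, noiseB, noiseB]
    have := mul_le_mul_of_nonneg_right (pow_le_pow_left₀ hη.le hηb 2) (sq_nonneg σB2)
    linarith
  have hσν : σB ^ 2 ≤ ν := by
    rw [hν, noiseB]
    have : 0 ≤ b ^ 2 * σB2 ^ 2 := by positivity
    linarith
  have hC0 : 0 ≤ C := by rw [hC]; positivity
  have hspos : 0 < s := hC0.trans_lt hlt
  rw [le_div_iff₀ (by linarith)]
  rcases Nat.eq_zero_or_pos N with rfl | hpos
  · rw [G.timestamp_zero]
    have : 0 ≤ max (G.logFactor σg D) 0 := le_max_right _ _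
    simp only [Nat.cast_zero, zero_mul]
    positivity
  obtain ⟨-, -, hL, hNL, -, -⟩ := G.of_numEpochs_pos hμ hD hN hpos
  rw [max_eq_left hL.le]
  have hd : 0 < 1 - exp (-2) := by linarith [exp_neg_two_le]
  have he2 : exp 2 = exp 1 ^ 2 := by rw [← exp_nat_mul]; norm_num
  obtain ⟨β, hβ⟩ : ∃ β, β = √(1 - α) := ⟨_, rfl⟩
  have hβ2 : β ^ 2 = 1 - α := by rw [hβ, sq_sqrt h1α.le]
  have hβ0 : 0 < β := by rw [hβ]; exact sqrt_pos.2 h1α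
  have hβ1 : β ≤ 1 := by nlinarith
  obtain ⟨l, hl⟩ : ∃ l, l = √G.lam := ⟨_, rfl⟩
  have hl2 : l ^ 2 = G.lam := by rw [hl, sq_sqrt hlam.le]
  have hl0 : 0 < l := by rw [hl]; exact sqrt_pos.2 hlam
  have hbl : b * l ≤ 1 := by
    rw [← hl2, ← mul_pow] at hb1
    exact (sq_le_one_iff₀ (by positivity)).1 hb1
  have hs' : s = β * b * l / exp 1 := by
    rw [hs, ← hβ2, ← hl2, ← mul_pow, ← mul_pow, sqrt_sq (by positivity)]
    ring
  have hC2 : C ^ 2 = b ^ 3 * l * ν := by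
    rw [hC, mul_pow, mul_pow, sq_sqrt hν0, ← rpow_natCast, ← rpow_mul hb.le, ← rpow_natCast,
      ← rpow_mul hlam.le, hl, sqrt_eq_rpow]
    norm_num
  rw [← hβ]
  -- `Y` carries the variance of the coupling matrix and `X` the remainder of the noise part; here
  -- `e Y s³ = √(1 - α) C²`, and `X` is bounded through `η̄ √λ ≤ 1`.
  refine burn_in_bound (Y := exp 2 * ν / ((1 - α) * G.lam)) (X := exp 2 / (1 - α))
    hspos hC0 hlt (by positivity) ?_ hL.le hβ0 hβ1 ?_ ?_
  · have : exp 1 * (exp 2 * ν / ((1 - α) * G.lam)) * s ^ 3 = β * C ^ 2 := by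
      rw [hC2, hs', he2, ← hβ2, ← hl2]; field_simp
    rw [this]
    exact mul_le_of_le_one_left (sq_nonneg C) hβ1
  · rw [hs', he2, ← hβ2, div_le_div_iff₀ (by positivity) (by positivity)]
    have : exp 1 ^ 2 * (β * (β * b * l / exp 1)) = exp 1 * β ^ 2 * (b * l) := by field_simp
    rw [this]
    exact mul_le_of_le_one_right (by positivity) hbl
  · refine hT.trans (add_le_add (mul_le_mul (add_le_add ?_ ?_) (by linarith) (by positivity)
      (by positivity)) ?_)
    · refine (sqrt_le_left (by positivity)).2 ?_
      rw [hs', he2, ← hβ2, ← hl2, div_pow, mul_pow 4, sq_sqrt (by norm_num),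
        div_le_div_iff₀ (by positivity) (by positivity)]
      have hb2 : b ^ 2 ≤ 2 * η ^ 2 := by
        have := pow_le_pow_left₀ hb.le hbη 2
        rwa [mul_pow, sq_sqrt (by norm_num)] at this
      have : 16 * exp 1 ^ 2 * (β * b * l / exp 1) ^ 2 = 16 * β ^ 2 * l ^ 2 * b ^ 2 := by
        field_simp
      rw [this]
      have := mul_le_mul_of_nonneg_left hb2 (show 0 ≤ 16 * β ^ 2 * l ^ 2 by positivity)
      linarith
    · rw [mul_assoc, mul_div_assoc]
      gcongr
    · rw [← div_div]
      refine div_le_div_of_nonneg_right ?_ hd.le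
      -- Here `μ ≤ λ + σ_B² ≤ λ + ν`, which turns `6 μ` into `6 (X + Y)` after division by `(1 - α)
      -- λ`.
      have h1 : exp 2 * (6 * G.mu + 4 * noiseB σB σB2 η) / ((1 - α) * G.lam)
          ≤ exp 2 * (6 * (G.lam + ν) + 4 * ν) / ((1 - α) * G.lam) := by
        have := hB.mu_le
        gcongr
        linarith
      refine h1.trans (le_of_eq ?_)
      field_simp

end BurnIn

/-! ### From the abstract epoch bound to the output of the algorithm. -/

section Transfer

variable {n : ℕ} {Ξ Ω : Type*} [MeasurableSpace Ξ] [MeasurableSpace Ω] {G : Game n Ξ}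
  {σB σB2 σg α : ℝ} [IsProbabilityMeasure G.P] {Pr : Measure Ω} [IsProbabilityMeasure Pr]

/-- The output is integrable and obeys the bound of each epoch. -/
theorem outputSq_integrable_and_le (hB : AssumptionB G σB σB2) (hg : AssumptionG G σg)
    (hns : IsUnit G.meanB) (hα0 : 0 < α) (hα1 : α < 1) {ξ : ℕ → Ω → Ξ}
    (hlaw : ∀ t, HasLaw (ξ t) G.P Pr) (hind : iIndepFun ξ Pr) (x₀ y₀ : Vec n) :
    (∀ K, Integrable (fun ω => outputSq G σB σB2 σg α x₀ y₀ (fun t => ξ t ω) K) Pr) ∧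
    ∀ τ k, (τ = 0 ∨ τ ∈ G.restartTimes σB σB2 σg α (‖x₀‖ ^ 2 + ‖y₀‖ ^ 2)) →
      (∀ j, 0 < j → j < k →
        τ + j ∉ G.restartTimes σB σB2 σg α (‖x₀‖ ^ 2 + ‖y₀‖ ^ 2)) →
      ∫ ω, outputSq G σB σB2 σg α x₀ y₀ (fun t => ξ t ω) (τ + k) ∂Pr
        ≤ G.epochBound σB σB2 σg α
          (∫ ω, outputSq G σB σB2 σg α x₀ y₀ (fun t => ξ t ω) τ ∂Pr) k := by
  -- A law only requires almost everywhere measurability, so the samples are replaced by measurable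
  -- versions; the outputs agree almost surely.
  set ζ : ℕ → Ω → Ξ := fun t => (hlaw t).aemeasurable.mk (ξ t)
  have hζm : ∀ t, Measurable (ζ t) := fun t => (hlaw t).aemeasurable.measurable_mk
  have hζe : ∀ t, ξ t =ᵐ[Pr] ζ t := fun t => (hlaw t).aemeasurable.ae_eq_mk
  have hsamp := isSampling_of_iIndepFun (P := G.P) hζm
    (fun t => ((hlaw t).congr (hζe t).symm).map_eq) (hind.congr hζe)
  have hae : ∀ K, (fun ω => outputSq G σB σB2 σg α x₀ y₀ (fun t => ξ t ω) K)
      =ᵐ[Pr] fun ω => ‖(run G (fun _ => G.etaHat σB α)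
        (G.restartTimes σB σB2 σg α (‖x₀‖ ^ 2 + ‖y₀‖ ^ 2)) x₀ y₀ (fun t => ζ t ω) K).zhat‖ ^ 2 :=
    fun K => by
      filter_upwards [ae_all_iff.2 hζe] with ω hω
      rw [State.norm_sq_zhat, outputSq, show (fun t => ξ t ω) = fun t => ζ t ω from funext hω]
  have hf := isStep_etaHat hB hg hns hα0 hα1
  refine ⟨fun K => ((isAdaptedState_run hf hsamp _ x₀ y₀ K).integrable_zhat).congr (hae K).symm,
    fun τ k hτ hk => ?_⟩
  have h := run_average_le hf hsamp _ x₀ y₀ hτ k hk (fun t => integral_congr_ae (hae t))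
  have hlam := hB.lam_pos hns
  have hμ := hB.mu_pos
  have hη := hB.etaHat_pos hns hα0
  have h1α : 0 < 1 - α := by linarith
  set E := ∫ ω, outputSq G σB σB2 σg α x₀ y₀ (fun t => ξ t ω) τ ∂Pr
  -- Division by `κ = (1 - α) η̂² λ`: here `v / θ = 3σ_g²/μ`, `2w = 4η̂²ν` with `ν = σ_B² +
  -- η̂²σ_{B,2}²`, and `12 v = 18 η̂² σ_g²`.
  refine le_of_mul_le_mul_left (h.trans (le_of_eq ?_)) hf.κ_pos
  rw [Game.epochBound]
  field_simp
  ring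

end Transfer

end SEG

end

/-! ### Assembly of the main theorem. -/

theorem theorem2 {n : ℕ} {Ξ Ω : Type*} [MeasurableSpace Ξ] [MeasurableSpace Ω]
    (G : SEG.Game n Ξ) (hGP : IsProbabilityMeasure G.P)
    (σB σB2 σg : ℝ)
    (hB : SEG.AssumptionB G σB σB2) (hg : SEG.AssumptionG G σg)
    (hns : IsUnit G.meanB)
    (α : ℝ) (hα0 : 0 < α) (hα1 : α < 1)
    (Pr : Measure Ω) (hPr : IsProbabilityMeasure Pr)
    -- the samples are independent copies of the sample of the game
    (ξ : ℕ → Ω → Ξ) (hlaw : ∀ t, HasLaw (ξ t) G.P Pr) (hind : iIndepFun ξ Pr)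
    (x₀ y₀ : SEG.Vec n)
    (D : ℝ) (hD : D = ‖x₀‖ ^ 2 + ‖y₀‖ ^ 2)
    (η : ℝ) (hη : η = G.etaHat σB α) (ηbar : ℝ) (hηbar : ηbar = G.etaBar σB α)
    (Z : ℕ → Ω → ℝ)
    (hZ : Z = fun K ω => SEG.outputSq G σB σB2 σg α x₀ y₀ (fun t => ξ t ω) K)
    (T : ℕ → ℕ) (hT : T = G.timestamp σB σB2 σg α D) :
    -- the expectations exist
    (∀ K, Integrable (Z K) Pr) ∧
    -- the expected squared distance shrinks by the factor `e⁻²` in each epoch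
    (∀ i : ℕ, 1 ≤ i → (i : ℕ∞) ≤ G.numEpochs σg D →
      ∫ ω, Z (T i) ω ∂Pr ≤ Real.exp (-(2 * (i : ℝ))) * D) ∧
    -- after the `N` restarting epochs
    (∀ N : ℕ, G.numEpochs σg D = (N : ℕ∞) →
      -- the bound `k` iterations after the last restart
      (∀ k : ℕ,
        ∫ ω, Z (T N + k) ω ∂Pr ≤
          18 / ((1 - α) * G.lam) *
            (1 + 4 / 3 * (SEG.noiseB σB σB2 η / G.mu) +
              8 / (3 * ((k : ℝ) + 1) * (η ^ 2 * G.mu))) *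
            (σg ^ 2 / ((k : ℝ) + 1))) ∧
      -- the same with the second-order term moved into the burn-in
      (∀ Kc : ℝ, Kc = (T N : ℝ) + 8 / (3 * (η ^ 2 * G.mu)) →
        ∀ K : ℕ, Kc + 1 ≤ (K : ℝ) →
          ∫ ω, Z K ω ∂Pr ≤
            18 / ((1 - α) * G.lam) * (1 + 4 / 3 * (SEG.noiseB σB σB2 η / G.mu)) *
              (σg ^ 2 / ((K : ℝ) - Kc + 1))) ∧
      -- the length of the restarting phase is logarithmic in the initial distance
      ((T N : ℝ) ≤
        (Real.sqrt (16 * Real.exp 2 / ((1 - α) * η ^ 2 * G.lam)) +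
            4 * Real.exp 2 * SEG.noiseB σB σB2 η / ((1 - α) * G.lam)) * (N : ℝ) +
          Real.exp 2 * (6 * G.mu + 4 * SEG.noiseB σB σB2 η) /
            ((1 - α) * G.lam * (1 - Real.exp (-2)))) ∧
      (∀ s C₂ : ℝ, s = (1 / Real.exp 1) * Real.sqrt ((1 - α) * ηbar ^ 2 * G.lam) →
        C₂ = ηbar ^ (3 / 2 : ℝ) * G.lam ^ (1 / 4 : ℝ) *
          Real.sqrt (SEG.noiseB σB σB2 ηbar) →
        C₂ < s →
        (T N : ℝ) ≤
          (3 * max (G.logFactor σg D) 0 + 26 / Real.sqrt (1 - α)) / (s - C₂))) := by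
  subst hD hη hηbar hZ hT
  obtain ⟨hint, hle⟩ := SEG.outputSq_integrable_and_le hB hg hns hα0 hα1 hlaw hind x₀ y₀
  have hD : 0 ≤ ‖x₀‖ ^ 2 + ‖y₀‖ ^ 2 := by positivity
  have hlam := hB.lam_pos hns
  have hμ := hB.mu_pos
  have hη := hB.etaHat_pos hns hα0
  have hc : 0 < (1 - α) * G.lam := mul_pos (by linarith) hlam
  have hZ0 : ∫ ω, SEG.outputSq G σB σB2 σg α x₀ y₀ (fun t => ξ t ω) 0 ∂Pr
      = ‖x₀‖ ^ 2 + ‖y₀‖ ^ 2 := by simp [SEG.outputSq, SEG.run]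
  have hT := SEG.Game.moment_timestamp_le hc hD
    (Z := fun K => ∫ ω, SEG.outputSq G σB σB2 σg α x₀ y₀ (fun t => ξ t ω) K ∂Pr) hZ0 hle
  refine ⟨hint, fun i _ hi => hT i hi, fun N hN => ?_⟩
  have hlast : ∀ k : ℕ, ∫ ω, SEG.outputSq G σB σB2 σg α x₀ y₀ (fun t => ξ t ω)
      (G.timestamp σB σB2 σg α (‖x₀‖ ^ 2 + ‖y₀‖ ^ 2) N + k) ∂Pr ≤
        18 / ((1 - α) * G.lam) *
          (1 + 4 / 3 * (SEG.noiseB σB σB2 (G.etaHat σB α) / G.mu) +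
            8 / (3 * ((k : ℝ) + 1) * (G.etaHat σB α ^ 2 * G.mu))) *
          (σg ^ 2 / ((k : ℝ) + 1)) := fun k =>
    (hle _ k (SEG.Game.timestamp_restart hN.ge) fun j h0 _ =>
      SEG.Game.not_mem_restartTimes_of_last hN h0).trans
      ((SEG.Game.epochBound_mono hc ((hT N hN.ge).trans (SEG.Game.noise_floor hμ hD hN)) k).trans
        (SEG.Game.epochBound_noise_floor hc hη hμ k).le)
  refine ⟨hlast, ?_, SEG.Game.timestamp_le hc hμ hη hD hN,
    fun s C₂ hs hC hlt => hB.timestamp_le_etaBar hns hα0 hα1 hD hN hs hC hlt⟩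
  rintro Kc rfl K hK
  set T := G.timestamp σB σB2 σg α (‖x₀‖ ^ 2 + ‖y₀‖ ^ 2) N
  have ha : 0 ≤ 8 / (3 * (G.etaHat σB α ^ 2 * G.mu)) := by positivity
  have hTK : T ≤ K := by
    have : (T : ℝ) ≤ K := by linarith
    exact_mod_cast this
  -- Writing `K = T + k` reduces the claim to the bound `k` steps after the last restart, shifted by
  -- `burn_in_shift`.
  obtain ⟨k, rfl⟩ := Nat.exists_eq_add_of_le hTK
  have hν := SEG.noiseB_nonneg σB σB2 (G.etaHat σB α)
  refine (hlast k).trans ((le_of_eq ?_).trans (SEG.burn_in_shift (by positivity)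
    (le_add_of_nonneg_right (by positivity)) ha (sq_nonneg σg) hK))
  push_cast
  rw [add_sub_cancel_left, div_div, mul_right_comm 3]
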